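/- Let $(X,\omega)$ be a boundaryless, Hausdorff, paracompact, smooth effective symplectic orbifold of dimension $2n$ (not necessarily compact or a global quotient), let $\hbar>0$, and let $P\subset TX\otimes\mathbb C$ be an orbifold polarization (an involutive Lagrangian subbundle of rank $n$). Let $(L,\nabla)$ be a prequantum line bundle, i.e. a Hermitian orbifold line bundle with unitary connection of curvature $F_\nabla=-\frac{i}{\hbar}\omega$, and let $\delta_P$ be a half-form bundle, i.e. an orbifold line bundle with an isomorphism $\delta_P^{\otimes 2}\cong K_P:=\bigwedge^n P^\circ$, where $P^\circ\subset T^*X\otimes\mathbb C$ is the annihilator of $P$. Let $f\in C^\infty_{\mathrm{orb}}(X,\mathbb R)$ have Hamiltonian vector field $X_f$, $\iota_{X_f}\omega=-df$, and be quantizable: $[X_f,\Gamma(P)]\subset\Gamma(P)$ on every uniformizing chart. In a local frame $\nu_0$ of $\delta_P$ with $\nu_0^{\otimes2}=\mu$, define $\operatorname{div}_PX_f$ by $\mathcal L_{X_f}\mu=(\operatorname{div}_PX_f)\,\mu$, and let \[ Q_{\mathrm{meta}}(f)(s\otimes\nu_0)=\Bigl(-i\hbar\nabla_{X_f}s+fs-\tfrac{i\hbar}{2}(\operatorname{div}_PX_f)\,s\Bigr)\otimes\nu_0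 . \] A section of $L\otimes\delta_P$ is called polarized if it is covariantly constant along $P$, where $\delta_P$ carries the partial connection along $P$ with $\nabla_\xi\nu_0=\frac12\eta\,\nu_0$ if $\mathcal L_\xi\mu=\eta\mu$. Pairings are conjugate-linear in the first argument. 1. (Kähler case.) Suppose $P=T^{0,1}X$ for an orbifold complex structure for which $\omega$ is a positive $(1,1)$-form. On the space of smooth polarized sections of $L\otimes\delta_P$ with compact support in $X$, consider the pairing \[ \langle\psi_1,\psi_2\rangle=\int_X\langle\psi_1,\psi_2\rangle_{L\otimes\delta_P}\,\frac{\omega^n}{n!} \] (orbifold integration: a partition of unity subordinate to the charts, with weight $1/|G|$ on a chart $(V,G,\pi)$), where $\delta_P$ has the Hermitian metric $\langle\nu,\nu\rangle=|\nu^{\otimes 2}|$ induced by the Kähler metric. Then $Q_{\mathrm{meta}}(f)$ maps this space to itself and $\langle Q_{\mathrm{meta}}(f)\psi_1,\psi_2\rangle=\langle\psi_1,Q_{\mathrm{meta}}(f)\psi_2\rangle$ for all $\psi_1,\psi_2$ in it. 2. (Real case.) Suppose $P=\overline P$. On the space of smooth polarized sections of $L\otimes\delta_P$ with compact support in the leaf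 space $\Lambda$ of $P$, $Q_{\mathrm{meta}}(f)$ maps this space to itself. Suppose moreover that $\Lambda$ carries a smooth measure-space structure: a Borel measure, finite on compact sets, which on every $n$-dimensional transversal meeting each leaf at most once is given by one and the same smooth positive leaf-invariant transverse density, the leaves that meet no such transversal forming a null set (for example, $\Lambda$ a smooth orbifold quotient). Smooth leaf-invariant transverse densities with compact support in $\Lambda$ can then be integrated over $\Lambda$. Suppose that the integration-by-parts formula $\int_\Lambda\mathcal L_{X_f}\kappa=0$ holds for all such densities $\kappa$. Then $\langle Q_{\mathrm{meta}}(f)\psi_1,\psi_2\rangle=\langle\psi_1,Q_{\mathrm{meta}}(f)\psi_2\rangle$ for all $\psi_1,\psi_2$ in this space, where $\langle\psi_1,\psi_2\rangle=\int_\Lambda\langle s_1,s_2\rangle_L\,|\mu|$ if locally $\psi_j=s_j\otimes\nu_0$ and $\nu_0^{\otimes2}=\mu$, with $|\mu|$ the transverse density which is the absolute value of $\mu$. If $X$ (in case 1) or $\Lambda$ (in case 2) is compact, the support condition is void. -/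

import Mathlib

open scoped ContDiff

namespace GeomQuant

noncomputable section

/-! ## Complexified tangent vectors in coordinates -/

/-- Real tangent vectors in a chart of dimension `m`. -/
abbrev RV (m : ℕ) : Type := Fin m → ℝ

/-- Complexified tangent vectors in a chart of dimension `m`. -/
abbrev CV (m : ℕ) : Type := Fin m → ℂ

/-- Real part of a complexified tangent vector. -/
def reV {m : ℕ} (ξ : CV m) : RV m := fun a => (ξ a).re

/-- Imaginary part of a complexified tangent vector. -/
def imV {m : ℕ} (ξ : CV m) : RV m := fun a => (ξ a).im

/-- A real tangent vector as a complexified tangent vector. -/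
def toC {m : ℕ} (u : RV m) : CV m := fun a => (u a : ℂ)

/-- Complex conjugation of complexified tangent vectors. -/
def conjV {m : ℕ} (ξ : CV m) : CV m := fun a => (starRingEnd ℂ) (ξ a)

/-- Complex-linear extension of a real-linear map between tangent spaces. -/
def extC {m k : ℕ} (T : RV m →L[ℝ] RV k) (ξ : CV m) : CV k :=
  fun a => (T (reV ξ) a : ℂ) + Complex.I * (T (imV ξ) a : ℂ)

/-- Derivative of a function with complex values along a complexified tangent vector `ζ` at `x`
(complex-linear in `ζ`). -/
def cderiv {m : ℕ} {Y : Type*} [NormedAddCommGroup Y] [NormedSpace ℝ Y] [NormedSpace ℂ Y]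
    (F : RV m → Y) (x : RV m) (ζ : CV m) : Y :=
  fderiv ℝ F x (reV ζ) + Complex.I • fderiv ℝ F x (imV ζ)

/-- Lie bracket of two complex vector fields. -/
def cbracket {m : ℕ} (ξ η : RV m → CV m) (x : RV m) : CV m :=
  cderiv η x (ξ x) - cderiv ξ x (η x)

/-- Complex-bilinear extension of a real `2`-form on a tangent space. -/
def form2C {m : ℕ} (w : RV m [⋀^Fin 2]→L[ℝ] ℝ) (ξ η : CV m) : ℂ :=
  ((w ![reV ξ, reV η] - w ![imV ξ, imV η] : ℝ) : ℂ) +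
    Complex.I * ((w ![reV ξ, imV η] + w ![imV ξ, reV η] : ℝ) : ℂ)

/-- The Lie derivative `(L_ξ μ)(v₁, …, vₙ)` at `x` of a complex `n`-form `μ` along a complex
vector field `ξ`. -/
def lieForm {m n : ℕ} (ξ : RV m → CV m) (μ : RV m → CV m [⋀^Fin n]→ₗ[ℂ] ℂ) (x : RV m)
    (v : Fin n → CV m) : ℂ :=
  cderiv (fun y => μ y v) x (ξ x) +
    ∑ k, μ x (Function.update v k (cderiv ξ x (v k)))

/-- The coefficient `D` with `L_ξ μ = D μ` at `x`.  It exists and is unique whenever `ξ` preserves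
the line spanned by the nowhere vanishing form `μ`. -/
def divCoeff {m n : ℕ} (ξ : RV m → CV m) (μ : RV m → CV m [⋀^Fin n]→ₗ[ℂ] ℂ) (x : RV m) : ℂ :=
  Classical.epsilon fun D : ℂ => ∀ v : Fin n → CV m, lieForm ξ μ x v = D * μ x v

/-- The Lie derivative at `x` along a real vector field `Y` of a density-like field `κ` (a function
of a point and of `n` real tangent vectors): the derivative at `t = 0` of the pullback by the flow
of `Y`, whose first-order expansion is `x + t Y(x)` on points and `u + t DY(x) u` on vectors. -/
def lieDensity {m n : ℕ} (Y : RV m → RV m) (κ : RV m → (Fin n → RV m) → ℂ) (x : RV m)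
    (u : Fin n → RV m) : ℂ :=
  deriv (fun t : ℝ => κ (x + t • Y x) (fun k => u k + t • fderiv ℝ Y x (u k))) 0

/-! ## Effective orbifolds -/

/-- An effective smooth orbifold atlas of dimension `m` (without boundary) on a space `X`: charts
`(V i, G i, π i)` with `V i ⊆ ℝᵐ` open and connected, `G i` a finite group acting smoothly and
effectively on `V i`, and `π i` inducing a homeomorphism of `V i / G i` with an open subset of `X`.
Values of `act` and `π` outside `V i` are irrelevant. -/
structure OrbifoldCharts (X : Type*) [TopologicalSpace X] (m : ℕ) where
  ι : Type*
  V : ι → Set (RV m)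
  G : ι → Type*
  [group : ∀ i, Group (G i)]
  [finite : ∀ i, Finite (G i)]
  act : ∀ i, G i → RV m → RV m
  π : ι → RV m → X
  isOpen_V : ∀ i, IsOpen (V i)
  isConnected_V : ∀ i, IsConnected (V i)
  act_mapsTo : ∀ i g, Set.MapsTo (act i g) (V i) (V i)
  act_one : ∀ i, ∀ x ∈ V i, act i 1 x = x
  act_mul : ∀ i g h, ∀ x ∈ V i, act i (g * h) x = act i g (act i h x)
  act_smooth : ∀ i g, ContDiffOn ℝ ∞ (act i g) (V i)
  act_effective : ∀ i g, (∀ x ∈ V i, act i g x = x) → g = 1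
  π_continuous : ∀ i, ContinuousOn (π i) (V i)
  π_open : ∀ i, ∀ W ⊆ V i, IsOpen W → IsOpen (π i '' W)
  π_fiber : ∀ i, ∀ x ∈ V i, ∀ y ∈ V i, π i x = π i y ↔ ∃ g, act i g x = y
  covers : ∀ p : X, ∃ i, p ∈ π i '' V i

attribute [instance] OrbifoldCharts.group OrbifoldCharts.finite

/-- An embedding of orbifold charts: a smooth open embedding `V i → V j`, equivariant with respect
to an injective homomorphism `G i → G j` and compatible with the projections to `X`. -/
structure ChartEmb {X : Type*} [TopologicalSpace X] {m : ℕ} (O : OrbifoldCharts X m)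
    (i j : O.ι) where
  toFun : RV m → RV m
  hom : O.G i →* O.G j
  hom_injective : Function.Injective hom
  mapsTo : Set.MapsTo toFun (O.V i) (O.V j)
  smooth : ContDiffOn ℝ ∞ toFun (O.V i)
  injOn : Set.InjOn toFun (O.V i)
  bijective_fderiv : ∀ x ∈ O.V i, Function.Bijective (fderiv ℝ toFun x)
  equivariant : ∀ g, ∀ x ∈ O.V i, toFun (O.act i g x) = O.act j (hom g) (toFun x)
  π_comp : ∀ x ∈ O.V i, O.π j (toFun x) = O.π i x

instance {X : Type*} [TopologicalSpace X] {m : ℕ} (O : OrbifoldCharts X m) (i j : O.ι) :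
    CoeFun (ChartEmb O i j) (fun _ => RV m → RV m) := ⟨ChartEmb.toFun⟩

/-- An orbifold structure: a system of charts any two of which are compatible, that is, have
around every common point a smaller chart embedding into both. -/
structure Orbifold (X : Type*) [TopologicalSpace X] (m : ℕ) extends OrbifoldCharts X m where
  compatible : ∀ i j, ∀ p ∈ (π i '' V i) ∩ (π j '' V j), ∃ k, p ∈ π k '' V k ∧
    Nonempty (ChartEmb toOrbifoldCharts k i) ∧ Nonempty (ChartEmb toOrbifoldCharts k j)

/-- The elements of a local group are chart embeddings of a chart into itself.  Hence data that are
compatible with all chart embeddings are in particular equivariant under the local groups. -/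
def ChartEmb.ofGroup {X : Type*} [TopologicalSpace X] {m : ℕ} (O : OrbifoldCharts X m) (i : O.ι)
    (g : O.G i) : ChartEmb O i i where
  toFun := O.act i g
  hom := (MulAut.conj g).toMonoidHom
  hom_injective := (MulAut.conj g).injective
  mapsTo := O.act_mapsTo i g
  smooth := O.act_smooth i g
  injOn := by
    intro x hx y hy h
    have h2 := congrArg (O.act i g⁻¹) h
    rwa [← O.act_mul i _ _ x hx, ← O.act_mul i _ _ y hy, inv_mul_cancel, O.act_one i x hx,
      O.act_one i y hy] at h2
  bijective_fderiv := by
    intro x hx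
    have hd : ∀ h : O.G i, ∀ y ∈ O.V i, DifferentiableAt ℝ (O.act i h) y := fun h y hy =>
      ((O.act_smooth i h).contDiffAt ((O.isOpen_V i).mem_nhds hy)).differentiableAt (by simp)
    have key : (fderiv ℝ (O.act i g⁻¹) (O.act i g x)).comp (fderiv ℝ (O.act i g) x) =
        ContinuousLinearMap.id ℝ (RV m) := by
      rw [← fderiv_comp x (hd _ _ (O.act_mapsTo i g hx)) (hd g x hx), ← fderiv_id (x := x)]
      apply Filter.EventuallyEq.fderiv_eq
      filter_upwards [(O.isOpen_V i).mem_nhds hx] with y hy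
      simp only [Function.comp, id]
      rw [← O.act_mul i _ _ y hy, inv_mul_cancel, O.act_one i y hy]
    have hinj : Function.Injective (fderiv ℝ (O.act i g) x) := by
      intro a b hab
      have h1 := congrArg (fun T : RV m →L[ℝ] RV m => T a) key
      have h2 := congrArg (fun T : RV m →L[ℝ] RV m => T b) key
      simp only [ContinuousLinearMap.comp_apply, ContinuousLinearMap.id_apply] at h1 h2
      rw [← h1, ← h2, hab]
    exact ⟨hinj, LinearMap.surjective_of_injective
      (f := (fderiv ℝ (O.act i g) x).toLinearMap) hinj⟩
  equivariant := by
    intro h x hx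
    rw [← O.act_mul i _ _ x hx, ← O.act_mul i _ _ x hx]
    simp
  π_comp := by
    intro x hx
    exact ((O.π_fiber i x hx _ (O.act_mapsTo i g hx)).2 ⟨g, rfl⟩).symm

variable {X : Type*} [TopologicalSpace X] {n : ℕ}

/-- An observable: a real function on `X` whose lifts to all charts are smooth. -/
def OrbSmooth {m : ℕ} (O : Orbifold X m) (f : X → ℝ) : Prop :=
  ∀ i, ContDiffOn ℝ ∞ (fun x => f (O.π i x)) (O.V i)

/-- A symplectic form on an orbifold of dimension `2n`. -/
structure SymplecticForm (O : Orbifold X (2 * n)) where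
  form : O.ι → RV (2 * n) → RV (2 * n) [⋀^Fin 2]→L[ℝ] ℝ
  smooth : ∀ i, ContDiffOn ℝ ∞ (form i) (O.V i)
  closed : ∀ i, ∀ x ∈ O.V i, extDeriv (form i) x = 0
  nondegenerate : ∀ i, ∀ x ∈ O.V i, ∀ u : RV (2 * n), u ≠ 0 → ∃ v, form i x ![u, v] ≠ 0
  invariant : ∀ i j (φ : ChartEmb O.toOrbifoldCharts i j), ∀ x ∈ O.V i, ∀ u v,
    form j (φ x) ![fderiv ℝ φ x u, fderiv ℝ φ x v] = form i x ![u, v]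

/-- The Hamiltonian vector field `X_f` in the chart `i`: the unique vector field with
`ι_{X_f} Ω = -df`. -/
def hamVF {O : Orbifold X (2 * n)} (Ω : SymplecticForm O) (f : X → ℝ) (i : O.ι)
    (x : RV (2 * n)) : RV (2 * n) :=
  Classical.epsilon fun u => ∀ v, Ω.form i x ![u, v] = - fderiv ℝ (fun y => f (O.π i y)) x v

/-- The Lebesgue density of the Liouville measure `Ωⁿ / n!` in the chart `i`, that is the absolute
value `√(det Ω_{ab})` of the Pfaffian of the matrix `Ω_{ab}`. -/
def liouvilleDensity {O : Orbifold X (2 * n)} (Ω : SymplecticForm O) (i : O.ι)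
    (x : RV (2 * n)) : ℝ :=
  Real.sqrt (Matrix.det (Matrix.of fun a b : Fin (2 * n) =>
    Ω.form i x ![Pi.single a 1, Pi.single b 1]))

/-! ## Polarizations -/

/-- `ξ` is, on the open set `W`, a smooth section of the family `P` of subspaces. -/
def IsSmoothSection {m : ℕ} (P : RV m → Submodule ℂ (CV m)) (W : Set (RV m))
    (ξ : RV m → CV m) : Prop :=
  ContDiffOn ℝ ∞ ξ W ∧ ∀ x ∈ W, ξ x ∈ P x

/-- An orbifold polarization: an involutive Lagrangian subbundle of rank `n` of the complexified
tangent bundle. -/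
structure Polarization {O : Orbifold X (2 * n)} (Ω : SymplecticForm O) where
  P : O.ι → RV (2 * n) → Submodule ℂ (CV (2 * n))
  subbundle : ∀ i, ∀ x ∈ O.V i, ∃ W ⊆ O.V i, IsOpen W ∧ x ∈ W ∧
    ∃ ξ : Fin n → RV (2 * n) → CV (2 * n), (∀ k, IsSmoothSection (P i) W (ξ k)) ∧
      ∀ y ∈ W, LinearIndependent ℂ (fun k => ξ k y) ∧
        Submodule.span ℂ (Set.range fun k => ξ k y) = P i y
  compatible : ∀ i j (φ : ChartEmb O.toOrbifoldCharts i j), ∀ x ∈ O.V i, ∀ ξ,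
    ξ ∈ P i x ↔ extC (fderiv ℝ φ x) ξ ∈ P j (φ x)
  lagrangian : ∀ i, ∀ x ∈ O.V i, ∀ ξ ∈ P i x, ∀ η ∈ P i x, form2C (Ω.form i x) ξ η = 0
  involutive : ∀ i, ∀ W ⊆ O.V i, IsOpen W → ∀ ξ η, IsSmoothSection (P i) W ξ →
    IsSmoothSection (P i) W η → ∀ x ∈ W, cbracket ξ η x ∈ P i x

section Quantization

variable {O : Orbifold X (2 * n)} {Ω : SymplecticForm O}

/-- `f` is quantizable: `[X_f, Γ(P)] ⊆ Γ(P)` on every chart. -/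
def Quantizable (P : Polarization Ω) (f : X → ℝ) : Prop :=
  ∀ i, ∀ W ⊆ O.V i, IsOpen W → ∀ ξ, IsSmoothSection (P.P i) W ξ →
    ∀ x ∈ W, cbracket (fun y => toC (hamVF Ω f i y)) ξ x ∈ P.P i x

/-- An orbifold complex line bundle, given by its transition functions in trivializations over the
charts (every orbifold line bundle has this form after passing to a finer atlas of the same
orbifold, with contractible charts).  With frames `eᵢ`, the bundle map over a chart embedding
`φ : V i → V j` sends `eᵢ(x)` to `trans φ x • eⱼ(φ x)`; these maps are compatible with composition
of embeddings. -/
structure LineBundle (O : Orbifold X (2 * n)) where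
  trans : ∀ {i j : O.ι}, ChartEmb O.toOrbifoldCharts i j → RV (2 * n) → ℂ
  smooth : ∀ {i j} (φ : ChartEmb O.toOrbifoldCharts i j), ContDiffOn ℝ ∞ (trans φ) (O.V i)
  ne_zero : ∀ {i j} (φ : ChartEmb O.toOrbifoldCharts i j), ∀ x ∈ O.V i, trans φ x ≠ 0
  cocycle : ∀ {i j k} (φ : ChartEmb O.toOrbifoldCharts i j) (ψ : ChartEmb O.toOrbifoldCharts j k)
    (χ : ChartEmb O.toOrbifoldCharts i k), (∀ x ∈ O.V i, χ x = ψ (φ x)) →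
    ∀ x ∈ O.V i, trans χ x = trans ψ (φ x) * trans φ x

/-- A prequantum line bundle: a Hermitian orbifold line bundle, trivialized by unitary frames `eᵢ`,
with a unitary connection `∇ eᵢ = -i Aᵢ ⊗ eᵢ` (`Aᵢ` a real `1`-form) preserved by the bundle maps,
and with curvature `F_∇ = -i dA` equal to `-(i/ħ) Ω`. -/
structure PrequantumBundle (Ω : SymplecticForm O) (hbar : ℝ) extends LineBundle O where
  unitary : ∀ {i j} (φ : ChartEmb O.toOrbifoldCharts i j), ∀ x ∈ O.V i, ‖trans φ x‖ = 1
  A : O.ι → RV (2 * n) → RV (2 * n) →L[ℝ] ℝ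
  A_smooth : ∀ i, ContDiffOn ℝ ∞ (A i) (O.V i)
  A_compatible : ∀ {i j} (φ : ChartEmb O.toOrbifoldCharts i j), ∀ x ∈ O.V i, ∀ u,
    fderiv ℝ (trans φ) x u =
      Complex.I * ((A j (φ x) (fderiv ℝ φ x u) - A i x u : ℝ) : ℂ) * trans φ x
  curvature : ∀ i, ∀ x ∈ O.V i, ∀ u v,
    -Complex.I * ((fderiv ℝ (A i) x u v - fderiv ℝ (A i) x v u : ℝ) : ℂ) =
      -(Complex.I / (hbar : ℂ)) * (Ω.form i x ![u, v] : ℂ)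

/-- Covariant derivative of `s • eᵢ` along the complexified tangent vector `ζ`, as a coefficient of
`eᵢ`: `ds(ζ) - i A(ζ) s`. -/
def PrequantumBundle.cov {hbar : ℝ} (L : PrequantumBundle Ω hbar) (i : O.ι)
    (s : RV (2 * n) → ℂ) (x : RV (2 * n)) (ζ : CV (2 * n)) : ℂ :=
  cderiv s x ζ -
    Complex.I * ((L.A i x (reV ζ) : ℂ) + Complex.I * (L.A i x (imV ζ) : ℂ)) * s x

/-- `μ` lies in the determinant line `⋀ⁿ P°` of the annihilator `P°` of the subspace `P`: it is a
product `α₁ ∧ … ∧ αₙ` of covectors vanishing on `P`. -/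
def MemDetAnnihilator {m : ℕ} (P : Submodule ℂ (CV m)) (μ : CV m [⋀^Fin n]→ₗ[ℂ] ℂ) : Prop :=
  ∃ α : Fin n → (CV m →ₗ[ℂ] ℂ), (∀ k, ∀ ξ ∈ P, α k ξ = 0) ∧
    ∀ v, μ v = Matrix.det (Matrix.of fun k l => α k (v l))

/-- A half-form bundle for `P`: an orbifold line bundle `δ_P`, trivialized by frames `νᵢ`, with an
isomorphism of orbifold line bundles from `δ_P ⊗ δ_P` to `K_P = ⋀ⁿ P°`.  The isomorphism is given
by the images `μᵢ` of `νᵢ ⊗ νᵢ`, nowhere vanishing smooth sections of `K_P`. -/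
structure HalfFormBundle (P : Polarization Ω) extends LineBundle O where
  μ : O.ι → RV (2 * n) → CV (2 * n) [⋀^Fin n]→ₗ[ℂ] ℂ
  μ_smooth : ∀ i v, ContDiffOn ℝ ∞ (fun x => μ i x v) (O.V i)
  μ_ne_zero : ∀ i, ∀ x ∈ O.V i, μ i x ≠ 0
  μ_mem : ∀ i, ∀ x ∈ O.V i, MemDetAnnihilator (P.P i x) (μ i x)
  μ_compatible : ∀ {i j} (φ : ChartEmb O.toOrbifoldCharts i j), ∀ x ∈ O.V i, ∀ v,
    μ i x v = trans φ x ^ 2 * μ j (φ x) (fun k => extC (fderiv ℝ φ x) (v k))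

variable {P : Polarization Ω} {hbar : ℝ}

/-! ## Corrected sections and the corrected operator

A section of `L ⊗ δ_P` is a family `s` of functions, `s i` being its coefficient in the frame
`eᵢ ⊗ νᵢ` over the chart `i`. -/

/-- `s` is a smooth section of the orbifold line bundle `L ⊗ δ_P`. -/
structure IsSection (L : PrequantumBundle Ω hbar) (δ : HalfFormBundle P)
    (s : O.ι → RV (2 * n) → ℂ) : Prop where
  smooth : ∀ i, ContDiffOn ℝ ∞ (s i) (O.V i)
  compatible : ∀ i j (φ : ChartEmb O.toOrbifoldCharts i j), ∀ x ∈ O.V i,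
    s j (φ x) = L.trans φ x * δ.trans φ x * s i x

/-- The section `s` is polarized: `∇_ξ s = 0` for all local sections `ξ` of `P`, where `∇` is the
tensor product of the connection of `L` and of the partial connection on `δ_P` along `P` with
`∇_ξ νᵢ = ½ η νᵢ` for `L_ξ μᵢ = η μᵢ`. -/
def IsPolarized (L : PrequantumBundle Ω hbar) (δ : HalfFormBundle P)
    (s : O.ι → RV (2 * n) → ℂ) : Prop :=
  ∀ i, ∀ W ⊆ O.V i, IsOpen W → ∀ ξ, IsSmoothSection (P.P i) W ξ → ∀ x ∈ W,
    L.cov i (s i) x (ξ x) + (1 / 2) * divCoeff ξ (δ.μ i) x * s i x = 0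

/-- The prequantum operator `Q_pre(f) = -iħ ∇_{X_f} + f` on coefficients. -/
def Qpre (L : PrequantumBundle Ω hbar) (f : X → ℝ) (s : O.ι → RV (2 * n) → ℂ) (i : O.ι)
    (x : RV (2 * n)) : ℂ :=
  -Complex.I * hbar * L.cov i (s i) x (toC (hamVF Ω f i x)) + (f (O.π i x) : ℂ) * s i x

/-- The divergence `div_P X_f` in the frame `μᵢ` of `K_P`: `L_{X_f} μᵢ = (div_P X_f) μᵢ`. -/
def divP (δ : HalfFormBundle P) (f : X → ℝ) (i : O.ι) (x : RV (2 * n)) : ℂ :=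
  divCoeff (fun y => toC (hamVF Ω f i y)) (δ.μ i) x

/-- The metaplectically corrected operator `Q_meta(f) = Q_pre(f) - (iħ/2) div_P X_f`. -/
def Qmeta (L : PrequantumBundle Ω hbar) (δ : HalfFormBundle P) (f : X → ℝ)
    (s : O.ι → RV (2 * n) → ℂ) (i : O.ι) (x : RV (2 * n)) : ℂ :=
  Qpre L f s i x - (Complex.I * hbar / 2) * divP δ f i x * s i x

/-- The set of points of `X` at which a family of functions on the charts does not vanish. -/
def nonzeroSet (O : Orbifold X (2 * n)) (s : O.ι → RV (2 * n) → ℂ) : Set X :=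
  {p | ∃ i, ∃ x ∈ O.V i, O.π i x = p ∧ s i x ≠ 0}

/-! ## The Kähler case -/

/-- `P` is a Kähler polarization: `P = T^{0,1}` for a complex structure `J` (integrable because
`P` is involutive) such that `Ω` is a positive `(1,1)`-form. -/
structure KahlerStructure (P : Polarization Ω) where
  J : O.ι → RV (2 * n) → RV (2 * n) →L[ℝ] RV (2 * n)
  smooth : ∀ i, ContDiffOn ℝ ∞ (J i) (O.V i)
  J_J : ∀ i, ∀ x ∈ O.V i, ∀ u, J i x (J i x u) = -u
  compatible : ∀ i j (φ : ChartEmb O.toOrbifoldCharts i j), ∀ x ∈ O.V i, ∀ u,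
    J j (φ x) (fderiv ℝ φ x u) = fderiv ℝ φ x (J i x u)
  type_one_one : ∀ i, ∀ x ∈ O.V i, ∀ u v,
    Ω.form i x ![J i x u, J i x v] = Ω.form i x ![u, v]
  positive : ∀ i, ∀ x ∈ O.V i, ∀ u, u ≠ 0 → 0 < Ω.form i x ![u, J i x u]
  mem_iff : ∀ i, ∀ x ∈ O.V i, ∀ ξ, ξ ∈ P.P i x ↔ extC (J i x) ξ = -Complex.I • ξ

/-- The matrix `g_{ab}` of the Kähler metric `g(u,v) = Ω(u, Jv)`. -/
def KahlerStructure.metric (K : KahlerStructure P) (i : O.ι) (x : RV (2 * n)) :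
    Matrix (Fin (2 * n)) (Fin (2 * n)) ℝ :=
  Matrix.of fun a b => Ω.form i x ![Pi.single a 1, K.J i x (Pi.single b 1)]

/-- The norm on complex `n`-forms induced by the Kähler metric:
`|μ|² = (1/n!) ∑ g^{a₁b₁} ⋯ g^{aₙbₙ} μ_{a₁…aₙ} conj(μ_{b₁…bₙ})`. -/
def KahlerStructure.formNorm (K : KahlerStructure P) (i : O.ι) (x : RV (2 * n))
    (μ : CV (2 * n) [⋀^Fin n]→ₗ[ℂ] ℂ) : ℝ :=
  Real.sqrt (((n.factorial : ℂ)⁻¹ * ∑ a : Fin n → Fin (2 * n), ∑ b : Fin n → Fin (2 * n),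
    ((∏ k, (K.metric i x)⁻¹ (a k) (b k) : ℝ) : ℂ) *
      μ (fun k => Pi.single (a k) 1) * (starRingEnd ℂ) (μ (fun k => Pi.single (b k) 1))).re)

/-- The corrected pairing in the Kähler case: orbifold integration over `X`, by means of a partition
of unity `ρ` subordinate to the charts and with weights `1 / |G i|`, of the fibre inner product of
`L ⊗ δ_P` against the Liouville measure.  It is conjugate-linear in the first argument, and
`⟨νᵢ, νᵢ⟩ = |νᵢ ⊗ νᵢ| = |μᵢ|`. -/
def kahlerPairing (δ : HalfFormBundle P) (K : KahlerStructure P)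
    (ρ : PartitionOfUnity O.ι X Set.univ) (s t : O.ι → RV (2 * n) → ℂ) : ℂ :=
  ∑ᶠ i, ((Nat.card (O.G i) : ℂ))⁻¹ * ∫ x in O.V i,
    (ρ i (O.π i x) : ℂ) * ((starRingEnd ℂ) (s i x) * t i x) *
      ((K.formNorm i x (δ.μ i x) * liouvilleDensity Ω i x : ℝ) : ℂ)

/-- The domain in the Kähler case: smooth polarized sections of `L ⊗ δ_P` with compact support
in `X`. -/
def KahlerDomain (L : PrequantumBundle Ω hbar) (δ : HalfFormBundle P)
    (s : O.ι → RV (2 * n) → ℂ) : Prop :=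
  IsSection L δ s ∧ IsPolarized L δ s ∧ IsCompact (closure (nonzeroSet O s))

/-! ## Real polarizations -/

/-- `P` is a real polarization. -/
def Polarization.IsReal (P : Polarization Ω) : Prop :=
  ∀ i, ∀ x ∈ O.V i, ∀ ξ, ξ ∈ P.P i x ↔ conjV ξ ∈ P.P i x

/-- Two points of `X` are joined by a smooth path in a single chart that is tangent to the real
distribution of `P`. -/
def JoinedInLeaf (P : Polarization Ω) (p q : X) : Prop :=
  ∃ i, ∃ γ : ℝ → RV (2 * n), ContDiff ℝ ∞ γ ∧
    (∀ t ∈ Set.Icc (0 : ℝ) 1, γ t ∈ O.V i ∧ toC (deriv γ t) ∈ P.P i (γ t)) ∧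
    O.π i (γ 0) = p ∧ O.π i (γ 1) = q

/-- The leaf space of `P`: the quotient of `X` whose points are the leaves. -/
def LeafSpace (P : Polarization Ω) : Type _ :=
  Quotient (Relation.EqvGen.setoid (JoinedInLeaf P))

/-- The leaf through a point. -/
def leafOf (P : Polarization Ω) (p : X) : LeafSpace P :=
  Quotient.mk (Relation.EqvGen.setoid (JoinedInLeaf P)) p

instance (P : Polarization Ω) : TopologicalSpace (LeafSpace P) :=
  inferInstanceAs (TopologicalSpace (Quotient (Relation.EqvGen.setoid (JoinedInLeaf P))))

instance (P : Polarization Ω) : MeasurableSpace (LeafSpace P) := borel _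

instance (P : Polarization Ω) : BorelSpace (LeafSpace P) := ⟨rfl⟩

/-- The real vectors `u₁, …, uₙ` at `x` are a basis of the quotient of the tangent space by the
real distribution of `P`. -/
def IsTransverse (P : Polarization Ω) (i : O.ι) (x : RV (2 * n)) (u : Fin n → RV (2 * n)) : Prop :=
  ∀ c : Fin n → ℝ, toC (∑ k, c k • u k) ∈ P.P i x → c = 0

/-- `κ` is a smooth complex transverse density for the real polarization `P` that descends to the
leaf space: at every point a density on the quotient of the tangent space by the real distribution
(`shift`, `scale`), compatible with chart embeddings, and with vanishing Lie derivative along the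
leaves. -/
structure IsTransverseDensity (P : Polarization Ω)
    (κ : O.ι → RV (2 * n) → (Fin n → RV (2 * n)) → ℂ) : Prop where
  shift : ∀ i, ∀ x ∈ O.V i, ∀ u w : Fin n → RV (2 * n), (∀ k, toC (w k) ∈ P.P i x) →
    κ i x (u + w) = κ i x u
  scale : ∀ i, ∀ x ∈ O.V i, ∀ (u : Fin n → RV (2 * n)) (B : Matrix (Fin n) (Fin n) ℝ),
    κ i x (fun k => ∑ l, B k l • u l) = (|B.det| : ℝ) * κ i x u
  smooth : ∀ i, ∀ u : Fin n → RV (2 * n),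
    ContDiffOn ℝ ∞ (fun x => κ i x u) {x | x ∈ O.V i ∧ IsTransverse P i x u}
  compatible : ∀ i j (φ : ChartEmb O.toOrbifoldCharts i j), ∀ x ∈ O.V i, ∀ u,
    κ j (φ x) (fun k => fderiv ℝ φ x (u k)) = κ i x u
  basic : ∀ i, ∀ W ⊆ O.V i, IsOpen W → ∀ Y : RV (2 * n) → RV (2 * n), ContDiffOn ℝ ∞ Y W →
    (∀ x ∈ W, toC (Y x) ∈ P.P i x) → ∀ x ∈ W, ∀ u, IsTransverse P i x u →
    lieDensity Y (κ i) x u = 0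

/-- The set of leaves on which `κ` does not vanish. -/
def leafNonzeroSet (P : Polarization Ω)
    (κ : O.ι → RV (2 * n) → (Fin n → RV (2 * n)) → ℂ) : Set (LeafSpace P) :=
  {ℓ | ∃ i, ∃ x ∈ O.V i, leafOf P (O.π i x) = ℓ ∧ ∃ u, κ i x u ≠ 0}

/-- An injective transversal: an `n`-dimensional parametrized piece of a chart, transverse to the
leaves and meeting every leaf at most once. -/
structure Transversal (P : Polarization Ω) where
  i : O.ι
  D : Set (RV n)
  σ : RV n → RV (2 * n)
  isOpen_D : IsOpen D
  smooth : ContDiffOn ℝ ∞ σ D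
  mapsTo : Set.MapsTo σ D (O.V i)
  transverse : ∀ y ∈ D, IsTransverse P i (σ y) (fun k => fderiv ℝ σ y (Pi.single k 1))
  injOn : Set.InjOn (fun y => leafOf P (O.π i (σ y))) D

/-- The map from a transversal to the leaf space. -/
def Transversal.toLeaf {P : Polarization Ω} (T : Transversal P) (y : RV n) : LeafSpace P :=
  leafOf P (O.π T.i (T.σ y))

/-- A smooth measure-space structure on the leaf space of `P`: a Borel measure `m`, finite on
compact sets, that on every injective transversal is given by a smooth positive transverse density
`τ`, the leaves that meet no injective transversal (such as the singular leaves of an orbifold quotient)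
forming a null set.  (If the leaf space is a
smooth manifold or orbifold, such an `m` is a measure with smooth positive density on it, and `τ`
is the pullback of that density.) -/
structure SmoothLeafMeasure (P : Polarization Ω) where
  m : MeasureTheory.Measure (LeafSpace P)
  τ : O.ι → RV (2 * n) → (Fin n → RV (2 * n)) → ℝ
  finite_on_compacts : ∀ C, IsCompact C → m C < ⊤
  density : IsTransverseDensity P (fun i x u => (τ i x u : ℂ))
  positive : ∀ i, ∀ x ∈ O.V i, ∀ u, IsTransverse P i x u → 0 < τ i x u
  on_transversal : ∀ T : Transversal P, m.restrict (T.toLeaf '' T.D) =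
    MeasureTheory.Measure.map T.toLeaf
      ((MeasureTheory.volume.restrict T.D).withDensity fun y =>
        ENNReal.ofReal (τ T.i (T.σ y) fun k => fderiv ℝ T.σ y (Pi.single k 1)))
  conull : m {ℓ | ∀ T : Transversal P, ℓ ∉ T.toLeaf '' T.D} = 0

/-- The quotient `κ / τ` of transverse densities as a function on the leaf space: its value at the
leaf `ℓ` is the number `c` with `κ = c τ` along `ℓ`. -/
def SmoothLeafMeasure.quot {P : Polarization Ω} (M : SmoothLeafMeasure P)
    (κ : O.ι → RV (2 * n) → (Fin n → RV (2 * n)) → ℂ) (ℓ : LeafSpace P) : ℂ :=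
  Classical.epsilon fun c : ℂ => ∀ i, ∀ x ∈ O.V i, leafOf P (O.π i x) = ℓ →
    ∀ u, IsTransverse P i x u → κ i x u = c * (M.τ i x u : ℂ)

/-- The integral over the leaf space of a transverse density `κ = (κ / τ) τ`. -/
def SmoothLeafMeasure.integral {P : Polarization Ω} (M : SmoothLeafMeasure P)
    (κ : O.ι → RV (2 * n) → (Fin n → RV (2 * n)) → ℂ) : ℂ :=
  ∫ ℓ, M.quot κ ℓ ∂M.m

/-- The usual integration-by-parts formula on the leaf space for the vector field induced by `X_f`:
the integral of `L_{X_f} κ` vanishes for every smooth compactly supported density `κ` on the leaf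
space. -/
def SmoothLeafMeasure.IntegrationByParts {P : Polarization Ω} (M : SmoothLeafMeasure P)
    (f : X → ℝ) : Prop :=
  ∀ κ, IsTransverseDensity P κ → IsCompact (closure (leafNonzeroSet P κ)) →
    M.integral (fun i => lieDensity (hamVF Ω f i) (κ i)) = 0

/-- The transverse density `⟨s, t⟩` of two sections of `L ⊗ δ_P`: the frame `νᵢ` pairs with itself
to the density `|νᵢ ⊗ νᵢ| = |μᵢ|`.  Conjugate-linear in the first argument. -/
def pairingDensity (δ : HalfFormBundle P) (s t : O.ι → RV (2 * n) → ℂ) (i : O.ι)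
    (x : RV (2 * n)) (u : Fin n → RV (2 * n)) : ℂ :=
  (starRingEnd ℂ) (s i x) * t i x * (‖δ.μ i x (fun k => toC (u k))‖ : ℂ)

/-- The corrected pairing for a real polarization. -/
def realPairing (δ : HalfFormBundle P) (M : SmoothLeafMeasure P)
    (s t : O.ι → RV (2 * n) → ℂ) : ℂ :=
  M.integral (pairingDensity δ s t)

/-- The domain for a real polarization: smooth polarized sections of `L ⊗ δ_P` with compact support
in the leaf space. -/
def RealDomain (L : PrequantumBundle Ω hbar) (δ : HalfFormBundle P)
    (s : O.ι → RV (2 * n) → ℂ) : Prop :=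
  IsSection L δ s ∧ IsPolarized L δ s ∧ IsCompact (closure (leafOf P '' nonzeroSet O s))

end Quantization

end

end GeomQuant

namespace GeomQuant

/-! ## Calculus of complexified derivatives -/

section Calculus

variable {m n : ℕ} {Y : Type*} [NormedAddCommGroup Y] [NormedSpace ℝ Y] [NormedSpace ℂ Y]

/-! Write `D_ξ = ∇_ξ + ½ div_P ξ` for a complex vector field `ξ` whose bracket preserves the
sections of `P`. Polarized sections are those killed by `D_ξ` for all `ξ` in `P`, and the corrected
operator is `Q = -iħ D_X + f` with `X = X_f`. The theorem has two halves, invariance and symmetry.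

Invariance. The divergence satisfies the cocycle identity `ξ(div η) - η(div ξ) = div [ξ, η]`
(`DetFrame.cderiv_divCoeff_sub`), because Lie derivatives of forms represent the bracket. Hence the
half-divergence adds no curvature, and `[D_X, D_ξ] = D_[X,ξ] + F_∇(X, ξ)`. Quantizability puts `[X,
ξ]` into `P`, so that `D_[X,ξ]` kills polarized sections, and `-iħ` times the curvature cancels the
derivative of `f` along `ξ`. Thus `D_ξ s = 0` for all `ξ` in `P` implies `D_ξ (Q s) = 0`
(`IsPolarized.Qmeta`). Since `Q` is local, supports do not grow; its independence of the frames is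
`IsSection.Qmeta`.

Symmetry. In a frame the defect is `conj(Qs) t - conj(s) Qt = iħ (X(conj(s) t) + Re(div_P X) conj(s)
t)` (`conj_Qmeta_mul_sub`), and `Re(div_P X)` is the rate at which the flow of `X` changes `|μ|`. So
the defect of the pairing density is `iħ` times a Lie derivative along `X`, and it remains to see
that such a Lie derivative integrates to zero.

For a real polarization this is the assumed integration-by-parts formula. What has to be shown is
that `conj(s) t |μ|` is a transverse density with vanishing Lie derivative along the leaves. Its
quotient by the density of the measure is then a continuous function on the leaf space
(`IsTransverseDensity.quot_leafOf`, `IsTransverseDensity.continuous_quot`), integrable because of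
its compact support.

For a Kähler polarization `X` preserves `Ω` by Cartan's formula and `J` by quantizability
(`KahlerStructure.fderiv_J`), hence the metric, so the pointwise norm of `μ` also changes at the
rate `Re(div_P X)` (`fderiv_normSq`). The defect is then the derivative along `X` of a compactly
supported function on the orbifold. As `X` preserves the Liouville density
(`fderiv_liouvilleDensity`), the integral vanishes by Stokes' theorem (`orbInt_fieldDeriv`).

Stokes' theorem on the orbifold requires a comparison of integrals over different charts. The
weights `1/|G|` are the right ones because each point over a smaller embedded chart lies in exactly
as many translates of it as its group has elements (`ChartEmb.ncard_translates`,
`integral_embedded_chart`). This rests on the density of points with trivial stabilizer, a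
consequence of effectiveness (`exists_free_point`). -/

@[simp] lemma reV_toC (u : RV m) : reV (toC u) = u := rfl

@[simp] lemma imV_toC (u : RV m) : imV (toC u) = 0 := rfl

lemma reV_add (ξ η : CV m) : reV (ξ + η) = reV ξ + reV η := rfl

lemma imV_add (ξ η : CV m) : imV (ξ + η) = imV ξ + imV η := rfl

lemma toC_add (u v : RV m) : toC (u + v) = toC u + toC v := by
  ext a; simp [toC]

lemma toC_smul (c : ℝ) (u : RV m) : toC (c • u) = (c : ℂ) • toC u := by
  ext a; simp [toC]

lemma toC_neg (u : RV m) : toC (-u) = -toC u := by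
  ext a; simp [toC]

lemma toC_sum {ι : Type*} (s : Finset ι) (u : ι → RV m) :
    toC (∑ k ∈ s, u k) = ∑ k ∈ s, toC (u k) := by
  ext a; simp [toC]

lemma toC_single (a : Fin m) : toC (Pi.single a 1) = Pi.single a 1 := by
  ext b
  by_cases h : b = a
  · subst h; simp [toC]
  · simp [toC, h]

lemma cderiv_add_right (F : RV m → Y) (x : RV m) (ξ η : CV m) :
    cderiv F x (ξ + η) = cderiv F x ξ + cderiv F x η := by
  simp only [cderiv, reV_add, imV_add, map_add, smul_add]; abel

lemma cderiv_smul_right [IsScalarTower ℝ ℂ Y] (F : RV m → Y) (x : RV m) (c : ℂ) (ξ : CV m) :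
    cderiv F x (c • ξ) = c • cderiv F x ξ := by
  have h1 : reV (c • ξ) = c.re • reV ξ - c.im • imV ξ := by ext a; simp [reV, imV]
  have h2 : imV (c • ξ) = c.re • imV ξ + c.im • reV ξ := by ext a; simp [reV, imV]
  have hr : ∀ (r : ℝ) (y : Y), r • y = (r : ℂ) • y := fun r y =>
    (algebraMap_smul ℂ r y).symm
  rw [cderiv, cderiv, h1, h2, map_sub, map_add, map_smul, map_smul, map_smul, map_smul]
  simp only [hr, smul_add, smul_smul]
  conv_rhs => rw [← Complex.re_add_im c]
  simp only [add_smul]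
  have hI : ((c.im : ℂ) * Complex.I) * Complex.I = -(c.im : ℂ) := by
    rw [mul_assoc, Complex.I_mul_I]; ring
  simp only [add_mul, hI, add_smul, neg_smul]
  rw [mul_comm Complex.I, mul_comm Complex.I]
  abel

/-- `cderiv` as a complex-linear map of the direction. -/
noncomputable def cderivL [IsScalarTower ℝ ℂ Y] (F : RV m → Y) (x : RV m) : CV m →ₗ[ℂ] Y where
  toFun := cderiv F x
  map_add' := cderiv_add_right F x
  map_smul' := cderiv_smul_right F x

@[simp] lemma cderivL_apply [IsScalarTower ℝ ℂ Y] (F : RV m → Y) (x : RV m) (ξ : CV m) :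
    cderivL F x ξ = cderiv F x ξ := rfl

lemma cderiv_sub_right [IsScalarTower ℝ ℂ Y] (F : RV m → Y) (x : RV m) (ξ η : CV m) :
    cderiv F x (ξ - η) = cderiv F x ξ - cderiv F x η := map_sub (cderivL F x) ξ η

@[simp] lemma cderiv_toC (F : RV m → Y) (x : RV m) (u : RV m) :
    cderiv F x (toC u) = fderiv ℝ F x u := by
  simp [cderiv]

lemma cderiv_congr {F G : RV m → Y} {x : RV m} (h : F =ᶠ[nhds x] G) (ξ : CV m) :
    cderiv F x ξ = cderiv G x ξ := by
  rw [cderiv, cderiv, h.fderiv_eq]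

lemma cderiv_congr_of_isOpen {F G : RV m → Y} {x : RV m} {W : Set (RV m)} (hW : IsOpen W)
    (hx : x ∈ W) (h : ∀ y ∈ W, F y = G y) (ξ : CV m) : cderiv F x ξ = cderiv G x ξ :=
  cderiv_congr (Filter.mem_of_superset (hW.mem_nhds hx) h) ξ

@[simp] lemma cderiv_const (c : Y) (x : RV m) (ξ : CV m) : cderiv (fun _ => c) x ξ = 0 := by
  simp [cderiv]

lemma cderiv_add {F G : RV m → Y} {x : RV m} (hF : DifferentiableAt ℝ F x)
    (hG : DifferentiableAt ℝ G x) (ξ : CV m) :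
    cderiv (fun y => F y + G y) x ξ = cderiv F x ξ + cderiv G x ξ := by
  simp only [cderiv, fderiv_fun_add hF hG, _root_.add_apply, smul_add]; abel

lemma cderiv_sub {F G : RV m → Y} {x : RV m} (hF : DifferentiableAt ℝ F x)
    (hG : DifferentiableAt ℝ G x) (ξ : CV m) :
    cderiv (fun y => F y - G y) x ξ = cderiv F x ξ - cderiv G x ξ := by
  simp only [cderiv, fderiv_fun_sub hF hG, _root_.sub_apply, smul_sub]; abel

lemma cderiv_sum {ι : Type*} (s : Finset ι) {F : ι → RV m → Y} {x : RV m}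
    (hF : ∀ i ∈ s, DifferentiableAt ℝ (F i) x) (ξ : CV m) :
    cderiv (fun y => ∑ i ∈ s, F i y) x ξ = ∑ i ∈ s, cderiv (F i) x ξ := by
  simp only [cderiv, fderiv_fun_sum hF, _root_.sum_apply, Finset.smul_sum,
    Finset.sum_add_distrib]

lemma cderiv_mul {F G : RV m → ℂ} {x : RV m} (hF : DifferentiableAt ℝ F x)
    (hG : DifferentiableAt ℝ G x) (ξ : CV m) :
    cderiv (fun y => F y * G y) x ξ = F x * cderiv G x ξ + cderiv F x ξ * G x := by
  simp only [cderiv, fderiv_fun_mul hF hG, _root_.add_apply,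
    _root_.smul_apply, smul_eq_mul]
  ring

lemma cderiv_const_mul {F : RV m → ℂ} {x : RV m} (hF : DifferentiableAt ℝ F x) (c : ℂ)
    (ξ : CV m) : cderiv (fun y => c * F y) x ξ = c * cderiv F x ξ := by
  rw [cderiv_mul (differentiableAt_const c) hF]; simp

lemma cderiv_clm_comp {Z : Type*} [NormedAddCommGroup Z] [NormedSpace ℝ Z] [NormedSpace ℂ Z]
    [IsScalarTower ℝ ℂ Y] [IsScalarTower ℝ ℂ Z]
    (T : Y →L[ℂ] Z) {F : RV m → Y} {x : RV m} (hF : DifferentiableAt ℝ F x) (ξ : CV m) :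
    cderiv (fun y => T (F y)) x ξ = T (cderiv F x ξ) := by
  have : fderiv ℝ (fun y => T (F y)) x = (T.restrictScalars ℝ).comp (fderiv ℝ F x) :=
    ((T.restrictScalars ℝ).hasFDerivAt.comp x hF.hasFDerivAt).fderiv
  simp [cderiv, this]

lemma cderiv_toC_comp {k : ℕ} {F : RV m → RV k} {x : RV m} (hF : DifferentiableAt ℝ F x)
    (u : RV m) : fderiv ℝ (fun y => toC (F y)) x u = toC (fderiv ℝ F x u) := by
  have h : ∀ a, HasFDerivAt (fun y => toC (F y) a)
      (Complex.ofRealCLM.comp ((ContinuousLinearMap.proj a).comp (fderiv ℝ F x))) x := fun a =>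
    Complex.ofRealCLM.hasFDerivAt.comp x
      ((ContinuousLinearMap.proj (R := ℝ) (φ := fun _ : Fin k => ℝ) a).hasFDerivAt.comp x
        hF.hasFDerivAt)
  rw [(hasFDerivAt_pi.2 h).fderiv]
  rfl

lemma contDiff_toC {k : ℕ} {N : WithTop ℕ∞} : ContDiff ℝ N (toC : RV k → CV k) := by
  rw [contDiff_pi]
  intro a
  exact Complex.ofRealCLM.contDiff.comp (contDiff_apply ℝ ℝ a)

lemma contDiff_reV {k : ℕ} {N : WithTop ℕ∞} : ContDiff ℝ N (reV : CV k → RV k) := by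
  rw [contDiff_pi]
  intro a
  exact Complex.reCLM.contDiff.comp (contDiff_apply ℝ ℂ a)

lemma contDiff_imV {k : ℕ} {N : WithTop ℕ∞} : ContDiff ℝ N (imV : CV k → RV k) := by
  rw [contDiff_pi]
  intro a
  exact Complex.imCLM.contDiff.comp (contDiff_apply ℝ ℂ a)

/-! ### Smoothness of derivatives along vector fields, and second derivatives. -/

lemma contDiffOn_fderiv_apply {E F : Type*} [NormedAddCommGroup E] [NormedSpace ℝ E]
    [NormedAddCommGroup F] [NormedSpace ℝ F] {W : Set E} (hW : IsOpen W) {f : E → F}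
    (hf : ContDiffOn ℝ ∞ f W) {u : E → E} (hu : ContDiffOn ℝ ∞ u W) :
    ContDiffOn ℝ ∞ (fun y => fderiv ℝ f y (u y)) W :=
  (hf.fderiv_of_isOpen hW (by simp)).clm_apply hu

lemma contDiffOn_cderiv {W : Set (RV m)} (hW : IsOpen W) {F : RV m → Y}
    (hF : ContDiffOn ℝ ∞ F W) {ξ : RV m → CV m} (hξ : ContDiffOn ℝ ∞ ξ W) [IsScalarTower ℝ ℂ Y] :
    ContDiffOn ℝ ∞ (fun y => cderiv F y (ξ y)) W := by
  have h2 : ContDiffOn ℝ ∞ (fun y => Complex.I • fderiv ℝ F y (imV (ξ y))) W :=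
    (((ContinuousLinearMap.lsmul ℂ ℂ (E := Y) Complex.I).restrictScalars ℝ).contDiff).comp_contDiffOn
      (contDiffOn_fderiv_apply hW hF (contDiff_imV.comp_contDiffOn hξ))
  exact (contDiffOn_fderiv_apply hW hF (contDiff_reV.comp_contDiffOn hξ)).add h2

lemma ContDiffOn.differentiableAt' {E F : Type*} [NormedAddCommGroup E] [NormedSpace ℝ E]
    [NormedAddCommGroup F] [NormedSpace ℝ F] {W : Set E} (hW : IsOpen W) {f : E → F}
    (hf : ContDiffOn ℝ ∞ f W) {x : E} (hx : x ∈ W) : DifferentiableAt ℝ f x :=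
  (hf.contDiffAt (hW.mem_nhds hx)).differentiableAt (by simp)

lemma fderiv_fderiv_apply {E F : Type*} [NormedAddCommGroup E] [NormedSpace ℝ E]
    [NormedAddCommGroup F] [NormedSpace ℝ F] {W : Set E} (hW : IsOpen W) {f : E → F}
    (hf : ContDiffOn ℝ ∞ f W) {x : E} (hx : x ∈ W) {u : E → E} (hu : DifferentiableAt ℝ u x)
    (v : E) : fderiv ℝ (fun y => fderiv ℝ f y (u y)) x v =
      fderiv ℝ (fderiv ℝ f) x v (u x) + fderiv ℝ f x (fderiv ℝ u x v) := by
  have h := ContDiffOn.differentiableAt' hW (hf.fderiv_of_isOpen (m := ∞) hW (by simp)) hx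
  rw [fderiv_clm_apply h hu]
  simp [add_comm]

lemma fderiv_fderiv_symm {E F : Type*} [NormedAddCommGroup E] [NormedSpace ℝ E]
    [NormedAddCommGroup F] [NormedSpace ℝ F] {W : Set E} (hW : IsOpen W) {f : E → F}
    (hf : ContDiffOn ℝ ∞ f W) {x : E} (hx : x ∈ W) (u v : E) :
    fderiv ℝ (fderiv ℝ f) x u v = fderiv ℝ (fderiv ℝ f) x v u :=
  ((hf.contDiffAt (hW.mem_nhds hx)).isSymmSndFDerivAt
    (by simp only [minSmoothness_of_isRCLikeNormedField]; exact WithTop.coe_le_coe.2 le_top)).eq u v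

/-- The complexified second derivative. -/
noncomputable def cderiv₂ (F : RV m → Y) (x : RV m) (ξ η : CV m) : Y :=
  cderiv (fun y => cderiv F y η) x ξ

lemma cderiv₂_eq [IsScalarTower ℝ ℂ Y] {W : Set (RV m)} (hW : IsOpen W) {F : RV m → Y}
    (hF : ContDiffOn ℝ ∞ F W) {x : RV m} (hx : x ∈ W) (η ξ : CV m) :
    cderiv₂ F x ξ η = fderiv ℝ (fderiv ℝ F) x (reV ξ) (reV η)
      + Complex.I • fderiv ℝ (fderiv ℝ F) x (reV ξ) (imV η)
      + Complex.I • fderiv ℝ (fderiv ℝ F) x (imV ξ) (reV η)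
      - fderiv ℝ (fderiv ℝ F) x (imV ξ) (imV η) := by
  have h := ContDiffOn.differentiableAt' hW (hF.fderiv_of_isOpen (m := ∞) hW (by simp)) hx
  have h1 : ∀ u : RV m, DifferentiableAt ℝ (fun y => fderiv ℝ F y u) x := fun u =>
    h.clm_apply (differentiableAt_const u)
  have h2 : ∀ u v : RV m, fderiv ℝ (fun y => fderiv ℝ F y u) x v =
      fderiv ℝ (fderiv ℝ F) x v u := fun u v => by
    rw [fderiv_fderiv_apply hW hF hx (differentiableAt_const u)]; simp
  have h3 : ∀ ζ : CV m, cderiv (fun y => Complex.I • fderiv ℝ F y (imV η)) x ζ =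
      Complex.I • cderiv (fun y => fderiv ℝ F y (imV η)) x ζ := fun ζ =>
    cderiv_clm_comp (ContinuousLinearMap.lsmul ℂ ℂ (E := Y) Complex.I) (h1 _) ζ
  have h4 : DifferentiableAt ℝ (fun y => Complex.I • fderiv ℝ F y (imV η)) x :=
    ((ContinuousLinearMap.lsmul ℂ ℂ (E := Y) Complex.I).restrictScalars ℝ).differentiableAt.comp x
      (h1 _)
  unfold cderiv₂
  have h5 : cderiv (fun y => cderiv F y η) x ξ = cderiv (fun y => fderiv ℝ F y (reV η)) x ξ +
      cderiv (fun y => Complex.I • fderiv ℝ F y (imV η)) x ξ := cderiv_add (h1 _) h4 ξ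
  rw [h5, h3]
  simp only [cderiv, h2, smul_add, smul_smul, Complex.I_mul_I, neg_smul, one_smul]
  abel

lemma cderiv₂_comm [IsScalarTower ℝ ℂ Y] {W : Set (RV m)} (hW : IsOpen W) {F : RV m → Y}
    (hF : ContDiffOn ℝ ∞ F W) {x : RV m} (hx : x ∈ W) (ξ η : CV m) :
    cderiv₂ F x ξ η = cderiv₂ F x η ξ := by
  rw [cderiv₂_eq hW hF hx, cderiv₂_eq hW hF hx]
  have hs := fderiv_fderiv_symm hW hF hx
  rw [hs (reV ξ) (reV η), hs (reV ξ) (imV η), hs (imV ξ) (reV η), hs (imV ξ) (imV η)]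
  abel

/-- The first term is symmetric by `cderiv₂_comm`, so it drops out of brackets and commutators; only
the derivative of the moving direction survives there. -/
lemma cderiv_cderiv [IsScalarTower ℝ ℂ Y] {W : Set (RV m)} (hW : IsOpen W) {F : RV m → Y}
    (hF : ContDiffOn ℝ ∞ F W) {x : RV m} (hx : x ∈ W) {η : RV m → CV m}
    (hη : DifferentiableAt ℝ η x) (ξ : CV m) :
    cderiv (fun y => cderiv F y (η y)) x ξ = cderiv₂ F x ξ (η x) + cderiv F x (cderiv η x ξ) := by
  have h := ContDiffOn.differentiableAt' hW (hF.fderiv_of_isOpen (m := ∞) hW (by simp)) hx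
  have hre : DifferentiableAt ℝ (fun y => reV (η y)) x :=
    (contDiff_reV (N := 1)).differentiable (by simp) |>.differentiableAt.comp x hη
  have him : DifferentiableAt ℝ (fun y => imV (η y)) x :=
    (contDiff_imV (N := 1)).differentiable (by simp) |>.differentiableAt.comp x hη
  have h1 : DifferentiableAt ℝ (fun y => fderiv ℝ F y (reV (η y))) x := h.clm_apply hre
  have h1' : DifferentiableAt ℝ (fun y => fderiv ℝ F y (imV (η y))) x := h.clm_apply him
  have h3 : ∀ ζ : CV m, cderiv (fun y => Complex.I • fderiv ℝ F y (imV (η y))) x ζ =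
      Complex.I • cderiv (fun y => fderiv ℝ F y (imV (η y))) x ζ := fun ζ =>
    cderiv_clm_comp (ContinuousLinearMap.lsmul ℂ ℂ (E := Y) Complex.I) h1' ζ
  have h4 : DifferentiableAt ℝ (fun y => Complex.I • fderiv ℝ F y (imV (η y))) x :=
    ((ContinuousLinearMap.lsmul ℂ ℂ (E := Y) Complex.I).restrictScalars ℝ).differentiableAt.comp x
      h1'
  have h5 : cderiv (fun y => cderiv F y (η y)) x ξ =
      cderiv (fun y => fderiv ℝ F y (reV (η y))) x ξ +
      cderiv (fun y => Complex.I • fderiv ℝ F y (imV (η y))) x ξ := cderiv_add h1 h4 ξ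
  have hd : ∀ v, fderiv ℝ (fun y => reV (η y)) x v = reV (fderiv ℝ η x v) := by
    intro v
    let T : CV m →L[ℝ] RV m := ContinuousLinearMap.pi fun a =>
      Complex.reCLM.comp (ContinuousLinearMap.proj a)
    have : fderiv ℝ (fun y => T (η y)) x = T.comp (fderiv ℝ η x) :=
      (T.hasFDerivAt.comp x hη.hasFDerivAt).fderiv
    exact congrArg (fun S => S v) this
  have hd' : ∀ v, fderiv ℝ (fun y => imV (η y)) x v = imV (fderiv ℝ η x v) := by
    intro v
    let T : CV m →L[ℝ] RV m := ContinuousLinearMap.pi fun a =>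
      Complex.imCLM.comp (ContinuousLinearMap.proj a)
    have : fderiv ℝ (fun y => T (η y)) x = T.comp (fderiv ℝ η x) :=
      (T.hasFDerivAt.comp x hη.hasFDerivAt).fderiv
    exact congrArg (fun S => S v) this
  rw [h5, h3, cderiv₂_eq hW hF hx]
  have h6 : cderiv F x (cderiv η x ξ) = cderiv F x (fderiv ℝ η x (reV ξ)) +
      Complex.I • cderiv F x (fderiv ℝ η x (imV ξ)) := by
    rw [← cderiv_smul_right, ← cderiv_add_right]; rfl
  rw [h6]
  simp only [cderiv, fderiv_fderiv_apply hW hF hx hre, fderiv_fderiv_apply hW hF hx him, hd, hd',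
    smul_add, smul_smul, Complex.I_mul_I, neg_smul, one_smul]
  abel

/-- Chain rule. -/
lemma cderiv_comp {k : ℕ} {F : RV k → Y} {φ : RV m → RV k} {x : RV m}
    (hF : DifferentiableAt ℝ F (φ x)) (hφ : DifferentiableAt ℝ φ x) (ξ : CV m) :
    cderiv (fun y => F (φ y)) x ξ = cderiv F (φ x) (extC (fderiv ℝ φ x) ξ) := by
  have h : fderiv ℝ (fun y => F (φ y)) x = (fderiv ℝ F (φ x)).comp (fderiv ℝ φ x) :=
    fderiv_comp x hF hφ
  have h1 : reV (extC (fderiv ℝ φ x) ξ) = fderiv ℝ φ x (reV ξ) := by ext a; simp [reV, extC]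
  have h2 : imV (extC (fderiv ℝ φ x) ξ) = fderiv ℝ φ x (imV ξ) := by ext a; simp [imV, extC]
  simp [cderiv, h, h1, h2]

lemma extC_eq {k : ℕ} (T : RV m →L[ℝ] RV k) (ξ : CV m) :
    extC T ξ = toC (T (reV ξ)) + Complex.I • toC (T (imV ξ)) := by
  ext a; simp [extC, toC]

@[simp] lemma extC_toC {k : ℕ} (T : RV m →L[ℝ] RV k) (u : RV m) : extC T (toC u) = toC (T u) := by
  ext a; simp [extC, toC]

/-- With the push-forward written as a derivative of `toC ∘ φ`, the symmetry `cderiv₂_comm` applies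
to second derivatives of chart maps; `lieForm_pullback` needs this. -/
lemma extC_fderiv {k : ℕ} {φ : RV m → RV k} {x : RV m} (hφ : DifferentiableAt ℝ φ x) (ξ : CV m) :
    extC (fderiv ℝ φ x) ξ = cderiv (fun y => toC (φ y)) x ξ := by
  rw [extC_eq, cderiv, cderiv_toC_comp hφ, cderiv_toC_comp hφ]

end Calculus

end GeomQuant

namespace GeomQuant

/-! ## Differential forms with values in a determinant line -/

section Forms

variable {m n : ℕ}

lemma sum_smul_single (v : CV m) : v = ∑ a, v a • (Pi.single a 1 : CV m) := by
  ext b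
  simp [Finset.sum_apply, Pi.single_apply]

/-- The sum runs over all index tuples, not only increasing ones. It reduces continuity and
smoothness of fields of forms to their finitely many coefficients. -/
lemma form_expand (β : CV m [⋀^Fin n]→ₗ[ℂ] ℂ) (w : Fin n → CV m) :
    β w = ∑ a : Fin n → Fin m, (∏ k, w k (a k)) * β (fun k => Pi.single (a k) 1) := by
  conv_lhs => rw [show w = fun k => ∑ a, w k a • (Pi.single a 1 : CV m) from
    funext fun k => sum_smul_single (w k)]
  have h := β.toMultilinearMap.map_sum (fun (k : Fin n) (a : Fin m) =>
    w k a • (Pi.single a 1 : CV m))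
  simp only [AlternatingMap.coe_multilinearMap] at h
  rw [h]
  refine Finset.sum_congr rfl fun a _ => ?_
  have h2 := β.toMultilinearMap.map_smul_univ (fun k => w k (a k))
    (fun k => (Pi.single (a k) 1 : CV m))
  exact h2

/-- A complex form as a real continuous multilinear map. -/
noncomputable def formCMLM (β : CV m [⋀^Fin n]→ₗ[ℂ] ℂ) :
    ContinuousMultilinearMap ℝ (fun _ : Fin n => CV m) ℂ where
  toMultilinearMap := β.toMultilinearMap.restrictScalars ℝ
  cont := by
    change Continuous fun w => β w
    rw [show (fun w => β w) = _ from funext (form_expand β)]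
    fun_prop

lemma formCMLM_apply (β : CV m [⋀^Fin n]→ₗ[ℂ] ℂ) (w : Fin n → CV m) : formCMLM β w = β w := rfl

/-- The product of coordinates as a multilinear map. -/
noncomputable def coordCMLM (a : Fin n → Fin m) :
    ContinuousMultilinearMap ℝ (fun _ : Fin n => CV m) ℂ :=
  (ContinuousMultilinearMap.mkPiAlgebra ℝ (Fin n) ℂ).compContinuousLinearMap
    fun k => ContinuousLinearMap.proj (R := ℝ) (φ := fun _ : Fin m => ℂ) (a k)

lemma formCMLM_eq (β : CV m [⋀^Fin n]→ₗ[ℂ] ℂ) : formCMLM β =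
    ∑ a : Fin n → Fin m, β (fun k => Pi.single (a k) 1) • coordCMLM a := by
  ext w
  rw [formCMLM_apply, form_expand]
  simp [coordCMLM, mul_comm]

/-- Differentiability on each fixed tuple is enough because a form is a finite combination of the
fixed maps `coordCMLM a`. -/
lemma differentiableAt_formCMLM {μ : RV m → CV m [⋀^Fin n]→ₗ[ℂ] ℂ} {x : RV m}
    (hμ : ∀ v, DifferentiableAt ℝ (fun y => μ y v) x) :
    DifferentiableAt ℝ (fun y => formCMLM (μ y)) x := by
  simp_rw [formCMLM_eq]
  refine DifferentiableAt.fun_sum fun a _ => ?_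
  exact (hμ _).smul (differentiableAt_const _)

lemma contDiffOn_form_apply {μ : RV m → CV m [⋀^Fin n]→ₗ[ℂ] ℂ} {W : Set (RV m)}
    (hμ : ∀ v, ContDiffOn ℝ ∞ (fun y => μ y v) W) {w : Fin n → RV m → CV m}
    (hw : ∀ k, ContDiffOn ℝ ∞ (w k) W) :
    ContDiffOn ℝ ∞ (fun y => μ y (fun k => w k y)) W := by
  rw [show (fun y => μ y (fun k => w k y)) = _ from
    funext fun y => form_expand (μ y) (fun k => w k y)]
  refine ContDiffOn.sum fun a _ => ?_
  exact (contDiffOn_prod fun k _ => (contDiffOn_pi.1 (hw k)) (a k)).mul (hμ _)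

/-- The product rule for the evaluation of a field of forms along a map `a`. -/
lemma exists_hasFDerivAt_form {H : Type*} [NormedAddCommGroup H] [NormedSpace ℝ H]
    {μ : RV m → CV m [⋀^Fin n]→ₗ[ℂ] ℂ} {a : H → RV m} {a' : H →L[ℝ] RV m} {x : H}
    (hμ : ∀ v, DifferentiableAt ℝ (fun y => μ y v) (a x)) (ha : HasFDerivAt a a' x)
    {w : Fin n → H → CV m} {w' : Fin n → H →L[ℝ] CV m} (hw : ∀ k, HasFDerivAt (w k) (w' k) x) :
    ∃ D : H →L[ℝ] ℂ, HasFDerivAt (fun y => μ (a y) (fun k => w k y)) D x ∧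
      ∀ h, D h = fderiv ℝ (fun y => μ y (fun k => w k x)) (a x) (a' h) +
        ∑ k, μ (a x) (Function.update (fun k => w k x) k (w' k h)) := by
  have hM := (differentiableAt_formCMLM hμ).hasFDerivAt
  have h := (hM.comp x ha).continuousMultilinearMap_apply hw
  refine ⟨_, h, fun v => ?_⟩
  have h0 : fderiv ℝ (fun y => μ y (fun k => w k x)) (a x) =
      (ContinuousMultilinearMap.apply ℝ (fun _ : Fin n => CV m) ℂ (fun k => w k x)).comp
        (fderiv ℝ (fun y => formCMLM (μ y)) (a x)) :=
    ((ContinuousMultilinearMap.apply ℝ (fun _ : Fin n => CV m) ℂ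
      (fun k => w k x)).hasFDerivAt.comp (a x) hM).fderiv
  rw [h0]
  simp [ContinuousMultilinearMap.toContinuousLinearMap, formCMLM_apply]

lemma map_update_smul_I (β : CV m [⋀^Fin n]→ₗ[ℂ] ℂ) (v : Fin n → CV m) (k : Fin n) (a b : CV m) :
    β (Function.update v k a) + Complex.I * β (Function.update v k b) =
      β (Function.update v k (a + Complex.I • b)) := by
  rw [β.map_update_add, β.map_update_smul, smul_eq_mul]

/-- The product rule for the evaluation of a field of forms on vector fields. -/
lemma cderiv_form {μ : RV m → CV m [⋀^Fin n]→ₗ[ℂ] ℂ} {x : RV m}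
    (hμ : ∀ v, DifferentiableAt ℝ (fun y => μ y v) x)
    {w : Fin n → RV m → CV m} (hw : ∀ k, DifferentiableAt ℝ (w k) x) (ξ : CV m) :
    cderiv (fun y => μ y (fun k => w k y)) x ξ =
      cderiv (fun y => μ y (fun k => w k x)) x ξ +
        ∑ k, μ x (Function.update (fun k => w k x) k (cderiv (w k) x ξ)) := by
  obtain ⟨D, hD, hD'⟩ := exists_hasFDerivAt_form (a := fun y => y) hμ (hasFDerivAt_id x)
    (fun k => (hw k).hasFDerivAt)
  have h1 : ∀ k, μ x (Function.update (fun k => w k x) k (cderiv (w k) x ξ)) =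
      μ x (Function.update (fun k => w k x) k (fderiv ℝ (w k) x (reV ξ))) +
      Complex.I * μ x (Function.update (fun k => w k x) k (fderiv ℝ (w k) x (imV ξ))) :=
    fun k => (map_update_smul_I _ _ _ _ _).symm
  simp only [h1, Finset.sum_add_distrib, ← Finset.mul_sum]
  simp only [cderiv, hD.fderiv, hD', smul_eq_mul, ContinuousLinearMap.id_apply]
  ring

/-- The product rule when only one argument varies. -/
lemma cderiv_form_update {μ : RV m → CV m [⋀^Fin n]→ₗ[ℂ] ℂ} {x : RV m}
    (hμ : ∀ v, DifferentiableAt ℝ (fun y => μ y v) x) (v : Fin n → CV m) (k : Fin n)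
    {w : RV m → CV m} (hw : DifferentiableAt ℝ w x) (ξ : CV m) :
    cderiv (fun y => μ y (Function.update v k (w y))) x ξ =
      cderiv (fun y => μ y (Function.update v k (w x))) x ξ +
        μ x (Function.update v k (cderiv w x ξ)) := by
  have hw' : ∀ l, DifferentiableAt ℝ (fun y => Function.update v k (w y) l) x := by
    intro l
    by_cases h : l = k
    · subst h; simpa using hw
    · simp [h]
  have h := cderiv_form hμ hw' ξ
  rw [Finset.sum_eq_single k] at h
  · simpa using h
  · intro l _ hl
    refine (μ x).map_coord_zero l ?_
    simp [hl]
  · simp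

/-! ### The Lie derivative is an alternating form -/

/-- A summand that changes neither slot `i` nor slot `j` keeps two equal arguments and vanishes. The
two remaining ones differ by a transposition of the slots and cancel. -/
lemma sum_update_alternating (β : CV m [⋀^Fin n]→ₗ[ℂ] ℂ) (A : CV m →ₗ[ℂ] CV m)
    {v : Fin n → CV m} {i j : Fin n} (h : v i = v j) (hij : i ≠ j) :
    ∑ k, β (Function.update v k (A (v k))) = 0 := by
  rw [Finset.sum_eq_add i j hij]
  · have hs : Function.update v j (A (v j)) =
        (Function.update v i (A (v i))) ∘ Equiv.swap i j := by
      ext1 l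
      by_cases hi : l = i
      · subst hi; simp [hij, hij.symm, h]
      · by_cases hj : l = j
        · subst hj; simp [h]
        · simp [hi, hj, Equiv.swap_apply_of_ne_of_ne hi hj]
    rw [hs, β.map_swap _ hij]
    ring
  · intro k _ hk
    exact β.map_eq_zero_of_eq _ (i := i) (j := j) (by simp [hk.1.symm, hk.2.symm, h]) hij
  · simp
  · simp

/-- The sum over all slots of the insertion of an endomorphism. -/
noncomputable def derivMLM (β : CV m [⋀^Fin n]→ₗ[ℂ] ℂ) (A : CV m →ₗ[ℂ] CV m) :
    MultilinearMap ℂ (fun _ : Fin n => CV m) ℂ :=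
  ∑ k, β.toMultilinearMap.compLinearMap (fun l => if l = k then A else LinearMap.id)

lemma derivMLM_apply (β : CV m [⋀^Fin n]→ₗ[ℂ] ℂ) (A : CV m →ₗ[ℂ] CV m) (v : Fin n → CV m) :
    derivMLM β A v = ∑ k, β (Function.update v k (A (v k))) := by
  simp only [derivMLM, _root_.sum_apply, MultilinearMap.compLinearMap_apply,
    AlternatingMap.coe_multilinearMap]
  refine Finset.sum_congr rfl fun k _ => congrArg β ?_
  ext1 l
  by_cases h : l = k
  · subst h; simp
  · simp [h]

/-- The Lie derivative as an alternating form. -/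
noncomputable def lieFormAlt (ξ : RV m → CV m) (μ : RV m → CV m [⋀^Fin n]→ₗ[ℂ] ℂ) (x : RV m)
    (hμ : ∀ v, DifferentiableAt ℝ (fun y => μ y v) x) : CV m [⋀^Fin n]→ₗ[ℂ] ℂ where
  toFun := lieForm ξ μ x
  map_update_add' v k a b := by
    -- The structure field quantifies over an arbitrary decidability instance; it is identified with
    -- the one that occurs in `derivMLM_apply`.
    rename_i inst
    obtain rfl : inst = instDecidableEqFin n := Subsingleton.elim _ _
    have h := (derivMLM (μ x) (cderivL ξ x)).map_update_add v k a b
    simp only [derivMLM_apply, cderivL_apply] at h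
    simp only [lieForm, h, AlternatingMap.map_update_add]
    rw [cderiv_add (hμ _) (hμ _)]
    ring
  map_update_smul' v k c a := by
    rename_i inst
    obtain rfl : inst = instDecidableEqFin n := Subsingleton.elim _ _
    have h := (derivMLM (μ x) (cderivL ξ x)).map_update_smul v k c a
    simp only [derivMLM_apply, cderivL_apply] at h
    simp only [lieForm, h, AlternatingMap.map_update_smul, smul_eq_mul]
    rw [cderiv_const_mul (hμ _)]
    ring
  map_eq_zero_of_eq' v i j h hij := by
    have h0 : ∀ y, μ y v = 0 := fun y => (μ y).map_eq_zero_of_eq v h hij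
    have h1 := sum_update_alternating (μ x) (cderivL ξ x) h hij
    simp only [cderivL_apply] at h1
    simp [lieForm, h0, h1]

/-! ### Forms vanishing on a subspace -/

/-- The arguments are changed one slot at a time; by additivity each change adds a value of `β` with
an argument in `P`. -/
lemma form_shift (β : CV m [⋀^Fin n]→ₗ[ℂ] ℂ) (P : Submodule ℂ (CV m))
    (hβ : ∀ v k, v k ∈ P → β v = 0) (v w : Fin n → CV m) (hw : ∀ k, w k ∈ P) :
    β (v + w) = β v := by
  have key : ∀ s : Finset (Fin n), β (s.piecewise (v + w) v) = β v := by
    intro s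
    induction s using Finset.induction_on with
    | empty => simp
    | insert k s hk ih =>
      have h1 : (insert k s).piecewise (v + w) v =
          Function.update (s.piecewise (v + w) v) k (v k + w k) := by
        rw [Finset.piecewise_insert]; rfl
      have h2 : Function.update (s.piecewise (v + w) v) k (v k) = s.piecewise (v + w) v := by
        apply Function.update_eq_self_iff.2
        simp [hk]
      have h3 : β (Function.update (s.piecewise (v + w) v) k (w k)) = 0 :=
        hβ _ k (by simpa using hw k)
      rw [h1, β.map_update_add, h2, ih, h3, add_zero]
  simpa using key Finset.univ

/-- Pulling `β` back along `c ↦ ∑ c_l u_l` gives an `n`-form on `ℂⁿ`, which is a multiple of the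
determinant. -/
lemma form_scale (β : CV m [⋀^Fin n]→ₗ[ℂ] ℂ) (u : Fin n → CV m) (C : Fin n → Fin n → ℂ) :
    β (fun k => ∑ l, C k l • u l) = (Matrix.of C).det * β u := by
  let T : (Fin n → ℂ) →ₗ[ℂ] CV m := Fintype.linearCombination ℂ u
  have h := (β.compLinearMap T).eq_smul_basis_det (Pi.basisFun ℂ (Fin n))
  have h1 := congrArg (fun g => g C) h
  simp only [AlternatingMap.smul_apply, Pi.basisFun_det_apply, smul_eq_mul] at h1
  rw [AlternatingMap.compLinearMap_apply, AlternatingMap.compLinearMap_apply] at h1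
  have e1 : (fun i => T (C i)) = fun k => ∑ l, C k l • u l := by
    ext1 k; simp [T, Fintype.linearCombination_apply]
  have e2 : (fun i => T ((Pi.basisFun ℂ (Fin n)) i)) = u := by
    ext1 k; simp [T, Fintype.linearCombination_apply, Pi.single_apply]
  rw [e1, e2] at h1
  rw [h1]
  exact mul_comm _ _

/-- If a combination `∑ c_l u_l` lies in `P`, inserting it into slot `k` gives zero, while expanding
it gives `c_k β(u)`. -/
lemma form_linearIndependent_mkQ (β : CV m [⋀^Fin n]→ₗ[ℂ] ℂ) (P : Submodule ℂ (CV m))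
    (hβ : ∀ v k, v k ∈ P → β v = 0) {u : Fin n → CV m} (hu : β u ≠ 0) :
    LinearIndependent ℂ (fun k => P.mkQ (u k)) := by
  rw [Fintype.linearIndependent_iff]
  intro c hc k
  by_contra hk
  have hmem : ∑ l, c l • u l ∈ P := by
    rw [← Submodule.Quotient.mk_eq_zero, ← Submodule.mkQ_apply]
    simpa using hc
  have h0 : β (Function.update u k (∑ l, c l • u l)) = 0 := hβ _ k (by simpa using hmem)
  have h1 : β (Function.update u k (∑ l, c l • u l)) = c k * β u := by
    rw [show β (Function.update u k (∑ l, c l • u l)) =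
      ∑ l, β (Function.update u k (c l • u l)) from β.map_update_sum _ _ _ _]
    rw [Finset.sum_eq_single k]
    · rw [β.map_update_smul, Function.update_eq_self, smul_eq_mul]
    · intro l _ hl
      rw [β.map_update_smul, β.map_update_self u hl.symm, smul_zero]
    · simp
  rw [h0] at h1
  rcases mul_eq_zero.1 h1.symm with h | h
  · exact hk h
  · exact hu h

/-- The `n` vectors `u_l` are independent modulo `P`, and the quotient has dimension `2n - n = n`,
so they span it. -/
lemma form_decompose (β : CV (2 * n) [⋀^Fin n]→ₗ[ℂ] ℂ) (P : Submodule ℂ (CV (2 * n)))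
    (hP : Module.finrank ℂ P = n) (hβ : ∀ v k, v k ∈ P → β v = 0)
    {u : Fin n → CV (2 * n)} (hu : β u ≠ 0) (v : CV (2 * n)) :
    ∃ c : Fin n → ℂ, v - ∑ l, c l • u l ∈ P := by
  have hli := form_linearIndependent_mkQ β P hβ hu
  have hfr : Module.finrank ℂ (CV (2 * n) ⧸ P) = n := by
    have := P.finrank_quotient_add_finrank
    rw [hP, Module.finrank_fin_fun] at this
    omega
  have hspan := hli.span_eq_top_of_card_eq_finrank' (by simp [hfr])
  have hv : P.mkQ v ∈ Submodule.span ℂ (Set.range fun k => P.mkQ (u k)) := by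
    rw [hspan]; trivial
  obtain ⟨c, hc⟩ := (Submodule.mem_span_range_iff_exists_fun ℂ).1 hv
  refine ⟨c, ?_⟩
  rw [← Submodule.Quotient.mk_eq_zero, ← Submodule.mkQ_apply, map_sub, map_sum]
  simp only [map_smul, hc, sub_self]

/-- Two forms vanishing on a subspace of half dimension are proportional. -/
lemma form_proportional (β γ : CV (2 * n) [⋀^Fin n]→ₗ[ℂ] ℂ) (P : Submodule ℂ (CV (2 * n)))
    (hP : Module.finrank ℂ P = n) (hβ : ∀ v k, v k ∈ P → β v = 0)
    (hγ : ∀ v k, v k ∈ P → γ v = 0) {u : Fin n → CV (2 * n)} (hu : β u ≠ 0)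
    (v : Fin n → CV (2 * n)) : γ v = (γ u / β u) * β v := by
  choose c hc using fun k => form_decompose β P hP hβ hu (v k)
  have e : v = (fun k => ∑ l, c k l • u l) + fun k => v k - ∑ l, c k l • u l := by
    ext1 k; simp
  rw [e, form_shift β P hβ _ _ hc, form_shift γ P hγ _ _ hc, form_scale, form_scale]
  field_simp

lemma exists_single_ne_zero {β : CV m [⋀^Fin n]→ₗ[ℂ] ℂ} (hβ : β ≠ 0) :
    ∃ a : Fin n → Fin m, β (fun k => Pi.single (a k) 1) ≠ 0 := by
  by_contra! h
  apply hβ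
  ext v
  rw [form_expand]
  simp [h]

lemma MemDetAnnihilator.vanish {P : Submodule ℂ (CV m)} {β : CV m [⋀^Fin n]→ₗ[ℂ] ℂ}
    (h : MemDetAnnihilator P β) (v : Fin n → CV m) (k : Fin n) (hk : v k ∈ P) : β v = 0 := by
  obtain ⟨α, hα, hβ⟩ := h
  rw [hβ]
  exact Matrix.det_eq_zero_of_column_eq_zero k fun l => by simp [hα l _ hk]

end Forms

/-! ## Divergence -/

section Divergence

variable {n : ℕ}

/-- The family of subspaces `P` has smooth sections through all of its vectors over `W`. -/
def HasLocalSections {m : ℕ} (P : RV m → Submodule ℂ (CV m)) (W : Set (RV m)) : Prop :=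
  ∀ x ∈ W, ∀ p ∈ P x, ∃ W' ⊆ W, IsOpen W' ∧ x ∈ W' ∧ ∃ ζ, IsSmoothSection P W' ζ ∧ ζ x = p

/-- Bracketing with `ξ` preserves the local sections of `P` over `W`. -/
def PreservesSections {m : ℕ} (P : RV m → Submodule ℂ (CV m)) (W : Set (RV m))
    (ξ : RV m → CV m) : Prop :=
  ∀ W' ⊆ W, IsOpen W' → ∀ ζ, IsSmoothSection P W' ζ → ∀ x ∈ W', cbracket ξ ζ x ∈ P x

/-- `μ` is a smooth frame over the open set `W` of the determinant line of the annihilator of a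
family `P` of half-dimensional subspaces. -/
structure DetFrame (P : RV (2 * n) → Submodule ℂ (CV (2 * n)))
    (μ : RV (2 * n) → CV (2 * n) [⋀^Fin n]→ₗ[ℂ] ℂ) (W : Set (RV (2 * n))) : Prop where
  isOpen : IsOpen W
  finrank : ∀ x ∈ W, Module.finrank ℂ (P x) = n
  sections : HasLocalSections P W
  smooth : ∀ v, ContDiffOn ℝ ∞ (fun x => μ x v) W
  ne_zero : ∀ x ∈ W, μ x ≠ 0
  vanish : ∀ x ∈ W, ∀ v k, v k ∈ P x → μ x v = 0

variable {P : RV (2 * n) → Submodule ℂ (CV (2 * n))}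
  {μ : RV (2 * n) → CV (2 * n) [⋀^Fin n]→ₗ[ℂ] ℂ} {W W' : Set (RV (2 * n))}

lemma DetFrame.mono (h : DetFrame P μ W) (hW' : IsOpen W') (hs : W' ⊆ W) : DetFrame P μ W' where
  isOpen := hW'
  finrank x hx := h.finrank x (hs hx)
  sections x hx p hp := by
    obtain ⟨U, hU, hUo, hxU, ζ, hζ, hp⟩ := h.sections x (hs hx) p hp
    exact ⟨U ∩ W', Set.inter_subset_right, hUo.inter hW', ⟨hxU, hx⟩, ζ,
      ⟨hζ.1.mono Set.inter_subset_left, fun y hy => hζ.2 y hy.1⟩, hp⟩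
  smooth v := (h.smooth v).mono hs
  ne_zero x hx := h.ne_zero x (hs hx)
  vanish x hx := h.vanish x (hs hx)

lemma PreservesSections.mono {ξ : RV (2 * n) → CV (2 * n)} (h : PreservesSections P W ξ)
    (hs : W' ⊆ W) : PreservesSections P W' ξ :=
  fun U hU => h U (hU.trans hs)

lemma DetFrame.differentiableAt (h : DetFrame P μ W) {x : RV (2 * n)} (hx : x ∈ W)
    (v : Fin n → CV (2 * n)) : DifferentiableAt ℝ (fun y => μ y v) x :=
  ContDiffOn.differentiableAt' h.isOpen (h.smooth v) hx

/-- Extend `v k` to a local section `ζ` of `P`. The function `μ(…, ζ, …)` vanishes identically,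
hence so does its derivative along `ξ`; compared with the Lie derivative this leaves `μ(…, [ξ, ζ],
…)`, which is zero because the bracket stays in `P`. -/
lemma DetFrame.lieForm_vanish (h : DetFrame P μ W) {ξ : RV (2 * n) → CV (2 * n)}
    (hP : PreservesSections P W ξ) {x : RV (2 * n)} (hx : x ∈ W)
    (v : Fin n → CV (2 * n)) (k : Fin n) (hk : v k ∈ P x) : lieForm ξ μ x v = 0 := by
  obtain ⟨U, hU, hUo, hxU, ζ, hζ, hp⟩ := h.sections x hx _ hk
  have hd := ContDiffOn.differentiableAt' hUo hζ.1 hxU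
  have h1 := cderiv_form_update (h.differentiableAt hx) v k hd (ξ x)
  have h2 : cderiv (fun y => μ y (Function.update v k (ζ y))) x (ξ x) = 0 := by
    rw [cderiv_congr_of_isOpen hUo hxU (G := fun _ => 0), cderiv_const]
    intro y hy
    exact h.vanish y (hU hy) _ k (by simpa using hζ.2 y hy)
  have h3 := h.vanish x hx (Function.update v k (cbracket ξ ζ x)) k
    (by simpa using hP U hU hUo ζ hζ x hxU)
  rw [cbracket, (μ x).map_update_sub, hp] at h3
  rw [hp, Function.update_eq_self, h2] at h1
  rw [lieForm, Finset.sum_eq_single k]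
  · linear_combination -h1 - h3
  · intro l _ hl
    exact h.vanish x hx _ k (by simpa [hl.symm] using hk)
  · simp

/-- Both `μ` and its Lie derivative vanish as soon as one argument lies in `P`, so they belong to
the same determinant line. -/
lemma DetFrame.exists_div (h : DetFrame P μ W) {ξ : RV (2 * n) → CV (2 * n)}
    (hP : PreservesSections P W ξ) {x : RV (2 * n)} (hx : x ∈ W) {u : Fin n → CV (2 * n)}
    (hu : μ x u ≠ 0) (v : Fin n → CV (2 * n)) :
    lieForm ξ μ x v = (lieForm ξ μ x u / μ x u) * μ x v :=
  form_proportional (μ x) (lieFormAlt ξ μ x (h.differentiableAt hx)) (P x) (h.finrank x hx)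
    (h.vanish x hx) (fun v k => h.lieForm_vanish hP hx v k) hu v

lemma DetFrame.exists_apply_ne_zero (h : DetFrame P μ W) {x : RV (2 * n)} (hx : x ∈ W) :
    ∃ u, μ x u ≠ 0 :=
  let ⟨_, ha⟩ := exists_single_ne_zero (h.ne_zero x hx)
  ⟨_, ha⟩

lemma DetFrame.lieForm_eq (h : DetFrame P μ W) {ξ : RV (2 * n) → CV (2 * n)}
    (hP : PreservesSections P W ξ) {x : RV (2 * n)} (hx : x ∈ W) (v : Fin n → CV (2 * n)) :
    lieForm ξ μ x v = divCoeff ξ μ x * μ x v := by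
  obtain ⟨u, hu⟩ := h.exists_apply_ne_zero hx
  exact Classical.epsilon_spec (p := fun D : ℂ => ∀ v, lieForm ξ μ x v = D * μ x v)
    ⟨_, h.exists_div hP hx hu⟩ v

/-- A nonzero form has a nonzero value, and that value determines the coefficient; hence the choice
made by `Classical.epsilon` is forced. -/
lemma divCoeff_eq_of {m k : ℕ} {μ : RV m → CV m [⋀^Fin k]→ₗ[ℂ] ℂ} {ξ : RV m → CV m} {x : RV m}
    {D : ℂ} (hD : ∀ v, lieForm ξ μ x v = D * μ x v) (hμ : μ x ≠ 0) : divCoeff ξ μ x = D := by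
  have h := Classical.epsilon_spec (p := fun D : ℂ => ∀ v, lieForm ξ μ x v = D * μ x v) ⟨D, hD⟩
  obtain ⟨u, hu⟩ := exists_single_ne_zero hμ
  have h2 := (h (fun k => Pi.single (u k) 1)).symm.trans (hD _)
  exact mul_right_cancel₀ hu h2

lemma DetFrame.divCoeff_eq_div (h : DetFrame P μ W) {ξ : RV (2 * n) → CV (2 * n)}
    (hP : PreservesSections P W ξ) {x : RV (2 * n)} (hx : x ∈ W) {u : Fin n → CV (2 * n)}
    (hu : μ x u ≠ 0) : divCoeff ξ μ x = lieForm ξ μ x u / μ x u :=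
  divCoeff_eq_of (h.exists_div hP hx hu) (h.ne_zero x hx)

/-! ### Smoothness and cocycle identity of the divergence. -/

lemma contDiffOn_update_cderiv {m k : ℕ} {W : Set (RV m)} (hW : IsOpen W) {ξ : RV m → CV m}
    (hξ : ContDiffOn ℝ ∞ ξ W) (v : Fin k → CV m) (i l : Fin k) :
    ContDiffOn ℝ ∞ (fun y => Function.update v i (cderiv ξ y (v i)) l) W := by
  by_cases hl : l = i
  · subst hl
    simpa using contDiffOn_cderiv hW hξ contDiffOn_const
  · simpa [hl] using contDiffOn_const

lemma contDiffOn_lieForm {m k : ℕ} {μ : RV m → CV m [⋀^Fin k]→ₗ[ℂ] ℂ} {W : Set (RV m)}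
    (hW : IsOpen W) (hμ : ∀ v, ContDiffOn ℝ ∞ (fun x => μ x v) W) {ξ : RV m → CV m}
    (hξ : ContDiffOn ℝ ∞ ξ W) (v : Fin k → CV m) :
    ContDiffOn ℝ ∞ (fun x => lieForm ξ μ x v) W := by
  refine (contDiffOn_cderiv hW (hμ v) hξ).add (ContDiffOn.sum fun i _ => ?_)
  exact contDiffOn_form_apply hμ (fun l => contDiffOn_update_cderiv hW hξ v i l)

/-- Near a point the divergence is a quotient of smooth functions: the values of the Lie derivative
and of `μ` on one fixed tuple where `μ` does not vanish. -/
lemma DetFrame.contDiffOn_divCoeff (h : DetFrame P μ W) {ξ : RV (2 * n) → CV (2 * n)}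
    (hξ : ContDiffOn ℝ ∞ ξ W) (hP : PreservesSections P W ξ) :
    ContDiffOn ℝ ∞ (fun x => divCoeff ξ μ x) W := by
  intro x hx
  obtain ⟨u, hu⟩ := h.exists_apply_ne_zero hx
  have hc : ContDiffAt ℝ ∞ (fun y => lieForm ξ μ y u / μ y u) x :=
    ((contDiffOn_lieForm h.isOpen h.smooth hξ u).contDiffAt (h.isOpen.mem_nhds hx)).mul
      (((h.smooth u).contDiffAt (h.isOpen.mem_nhds hx)).inv hu)
  refine (hc.congr_of_eventuallyEq ?_).contDiffWithinAt
  filter_upwards [h.isOpen.mem_nhds hx,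
    ((h.differentiableAt hx u).continuousAt).eventually_ne hu] with y hy hyu
  exact h.divCoeff_eq_div hP hy hyu

/-- Once the terms with both endomorphisms in the same slot are removed, `A` and `B` act in two
different slots, and the order of insertion is irrelevant. -/
lemma update_update_cderiv_symm {m k : ℕ} (β : CV m [⋀^Fin k]→ₗ[ℂ] ℂ) (A B : CV m →ₗ[ℂ] CV m)
    (v : Fin k → CV m) :
    ∑ i, ∑ l, β (Function.update (Function.update v i (A (v i))) l
        (B (Function.update v i (A (v i)) l))) - ∑ i, β (Function.update v i (B (A (v i)))) =
    ∑ i, ∑ l, β (Function.update (Function.update v i (B (v i))) l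
        (A (Function.update v i (B (v i)) l))) - ∑ i, β (Function.update v i (A (B (v i)))) := by
  have key : ∀ A B : CV m →ₗ[ℂ] CV m,
      ∑ i, ∑ l, β (Function.update (Function.update v i (A (v i))) l
        (B (Function.update v i (A (v i)) l))) - ∑ i, β (Function.update v i (B (A (v i)))) =
      ∑ i, ∑ l, if l = i then 0 else
        β (Function.update (Function.update v i (A (v i))) l (B (v l))) := by
    intro A B
    rw [← Finset.sum_sub_distrib]
    refine Finset.sum_congr rfl fun i _ => ?_
    rw [sub_eq_iff_eq_add, ← Finset.add_sum_erase _ _ (Finset.mem_univ i),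
      ← Finset.add_sum_erase Finset.univ (fun l => if l = i then (0 : ℂ) else _)
        (Finset.mem_univ i)]
    simp only [Function.update_self, Function.update_idem, if_true, zero_add]
    rw [add_comm]
    congr 1
    refine Finset.sum_congr rfl fun l hl => ?_
    have hl' : l ≠ i := Finset.ne_of_mem_erase hl
    simp [hl']
  rw [key, key, Finset.sum_comm]
  refine Finset.sum_congr rfl fun i _ => Finset.sum_congr rfl fun l _ => ?_
  by_cases h : l = i
  · subst h; simp
  · rw [if_neg h, if_neg (Ne.symm h), Function.update_comm h]

/-- `L_ξ L_η μ - L_η L_ξ μ = L_{[ξ, η]} μ`. -/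
lemma lieForm_commutator {m k : ℕ} {μ : RV m → CV m [⋀^Fin k]→ₗ[ℂ] ℂ} {W : Set (RV m)}
    (hW : IsOpen W) (hμ : ∀ v, ContDiffOn ℝ ∞ (fun x => μ x v) W) {ξ η : RV m → CV m}
    (hξ : ContDiffOn ℝ ∞ ξ W) (hη : ContDiffOn ℝ ∞ η W) {x : RV m} (hx : x ∈ W)
    (v : Fin k → CV m) :
    (cderiv (fun y => lieForm η μ y v) x (ξ x) +
        ∑ i, lieForm η μ x (Function.update v i (cderiv ξ x (v i)))) -
      (cderiv (fun y => lieForm ξ μ y v) x (η x) +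
        ∑ i, lieForm ξ μ x (Function.update v i (cderiv η x (v i)))) =
      lieForm (cbracket ξ η) μ x v := by
  have hμd : ∀ v, DifferentiableAt ℝ (fun y => μ y v) x := fun v =>
    ContDiffOn.differentiableAt' hW (hμ v) hx
  -- The second derivatives of `μ` and of `η` are set apart here: after symmetrization by
  -- `cderiv₂_comm` they either cancel in the commutator or become the second-order part of the
  -- derivative of the bracket.
  have first : ∀ {ξ η : RV m → CV m}, ContDiffOn ℝ ∞ ξ W → ContDiffOn ℝ ∞ η W →
      cderiv (fun y => lieForm η μ y v) x (ξ x) = cderiv₂ (fun y => μ y v) x (ξ x) (η x) +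
        cderiv (fun y => μ y v) x (cderiv η x (ξ x)) +
        ∑ i, (cderiv (fun y => μ y (Function.update v i (cderiv η x (v i)))) x (ξ x) +
          μ x (Function.update v i (cderiv₂ η x (ξ x) (v i)))) := by
    intro ξ η hξ hη
    have hs : ∀ i, DifferentiableAt ℝ (fun y =>
        μ y (Function.update v i (cderiv η y (v i)))) x := fun i =>
      ContDiffOn.differentiableAt' hW (contDiffOn_form_apply hμ
        (fun l => contDiffOn_update_cderiv hW hη v i l)) hx
    have h1 : cderiv (fun y => lieForm η μ y v) x (ξ x) =
        cderiv (fun y => cderiv (fun z => μ z v) y (η y)) x (ξ x) +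
        cderiv (fun y => ∑ i, μ y (Function.update v i (cderiv η y (v i)))) x (ξ x) :=
      cderiv_add (ContDiffOn.differentiableAt' hW (contDiffOn_cderiv hW (hμ v) hη) hx)
        (DifferentiableAt.fun_sum fun i _ => hs i) _
    rw [h1, cderiv_cderiv hW (hμ v) hx (ContDiffOn.differentiableAt' hW hη hx),
      cderiv_sum _ (fun i _ => hs i)]
    congr 1
    refine Finset.sum_congr rfl fun i _ => ?_
    rw [cderiv_form_update hμd v i (w := fun y => cderiv η y (v i))
      (ContDiffOn.differentiableAt' hW (contDiffOn_cderiv hW hη contDiffOn_const) hx)]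
    rfl
  have hbr : ∀ ζ, cderiv (cbracket ξ η) x ζ = (cderiv₂ η x ζ (ξ x) + cderiv η x (cderiv ξ x ζ)) -
      (cderiv₂ ξ x ζ (η x) + cderiv ξ x (cderiv η x ζ)) := by
    intro ζ
    rw [← cderiv_cderiv hW hη hx (ContDiffOn.differentiableAt' hW hξ hx),
      ← cderiv_cderiv hW hξ hx (ContDiffOn.differentiableAt' hW hη hx)]
    exact cderiv_sub (ContDiffOn.differentiableAt' hW (contDiffOn_cderiv hW hη hξ) hx)
      (ContDiffOn.differentiableAt' hW (contDiffOn_cderiv hW hξ hη) hx) ζ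
  rw [first hξ hη, first hη hξ]
  -- The first derivatives of `ξ` and `η` fail to commute only where both act on the same slot;
  -- these terms belong to the derivative of the bracket.
  have hsym := update_update_cderiv_symm (μ x) (cderivL ξ x) (cderivL η x) v
  simp only [cderivL_apply] at hsym
  simp only [lieForm, hbr, Finset.sum_add_distrib, AlternatingMap.map_update_sub,
    AlternatingMap.map_update_add, Finset.sum_sub_distrib]
  rw [cderiv₂_comm hW (hμ v) hx (ξ x) (η x)]
  have e0 : cbracket ξ η x = cderiv η x (ξ x) - cderiv ξ x (η x) := rfl
  rw [e0, cderiv_sub_right]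
  simp only [cderiv₂_comm hW hξ hx (η x), cderiv₂_comm hW hη hx (ξ x)]
  linear_combination hsym

/-- The cocycle identity of the divergence. -/
lemma DetFrame.cderiv_divCoeff_sub (h : DetFrame P μ W) {ξ η : RV (2 * n) → CV (2 * n)}
    (hξ : ContDiffOn ℝ ∞ ξ W) (hη : ContDiffOn ℝ ∞ η W) (hPξ : PreservesSections P W ξ)
    (hPη : PreservesSections P W η) {x : RV (2 * n)} (hx : x ∈ W) :
    cderiv (fun y => divCoeff η μ y) x (ξ x) - cderiv (fun y => divCoeff ξ μ y) x (η x) =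
      divCoeff (cbracket ξ η) μ x := by
  symm
  refine divCoeff_eq_of (fun v => ?_) (h.ne_zero x hx)
  rw [← lieForm_commutator h.isOpen h.smooth hξ hη hx v]
  -- `L_ξ (D_η μ) = (ξ(D_η) + D_η D_ξ) μ`, with `D` the divergence coefficients; the product is
  -- symmetric and disappears from the difference.
  have key : ∀ {ξ η : RV (2 * n) → CV (2 * n)}, ContDiffOn ℝ ∞ η W →
      PreservesSections P W ξ → PreservesSections P W η →
      cderiv (fun y => lieForm η μ y v) x (ξ x) +
        ∑ i, lieForm η μ x (Function.update v i (cderiv ξ x (v i))) =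
      (cderiv (fun y => divCoeff η μ y) x (ξ x) + divCoeff η μ x * divCoeff ξ μ x) * μ x v := by
    intro ξ η hη hPξ hPη
    rw [cderiv_congr_of_isOpen h.isOpen hx (fun y hy => h.lieForm_eq hPη hy v),
      cderiv_mul (ContDiffOn.differentiableAt' h.isOpen (h.contDiffOn_divCoeff hη hPη) hx)
        (h.differentiableAt hx v)]
    simp only [h.lieForm_eq hPη hx, ← Finset.mul_sum]
    have := h.lieForm_eq hPξ hx v
    rw [lieForm] at this
    linear_combination divCoeff η μ x * this
  rw [key hη hPξ hPη, key hξ hPη hPξ]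
  ring

end Divergence

end GeomQuant

namespace GeomQuant

/-! ## Real 2-forms as bilinear maps -/

section Flat

variable {m : ℕ}

lemma form2_swap (w : RV m [⋀^Fin 2]→L[ℝ] ℝ) (u v : RV m) : w ![u, v] = -w ![v, u] := by
  have h := w.toAlternatingMap.map_swap ![v, u] (i := 0) (j := 1) (by decide)
  have e : ![v, u] ∘ Equiv.swap (0 : Fin 2) 1 = ![u, v] := by
    ext k; fin_cases k <;> rfl
  rw [e] at h
  exact h

lemma form2_add_left (w : RV m [⋀^Fin 2]→L[ℝ] ℝ) (u u' v : RV m) :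
    w ![u + u', v] = w ![u, v] + w ![u', v] := w.vecCons_add ![v] u u'

lemma form2_smul_left (w : RV m [⋀^Fin 2]→L[ℝ] ℝ) (c : ℝ) (u v : RV m) :
    w ![c • u, v] = c * w ![u, v] := w.vecCons_smul ![v] c u

/-- A `2`-form as a continuous bilinear map. -/
noncomputable def flat (w : RV m [⋀^Fin 2]→L[ℝ] ℝ) : RV m →L[ℝ] RV m →L[ℝ] ℝ :=
  LinearMap.toContinuousLinearMap
    ((LinearMap.toContinuousLinearMap (𝕜 := ℝ) (E := RV m) (F' := ℝ)).toLinearMap ∘ₗ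
      LinearMap.mk₂ ℝ (fun u v => w ![u, v]) (form2_add_left w) (form2_smul_left w)
        (fun u v v' => by
          rw [form2_swap, form2_add_left, form2_swap w u v, form2_swap w u v']; ring)
        (fun c u v => by
          rw [form2_swap, form2_smul_left, form2_swap w u v, smul_eq_mul]; ring))

@[simp] lemma flat_apply (w : RV m [⋀^Fin 2]→L[ℝ] ℝ) (u v : RV m) : flat w u v = w ![u, v] := rfl

lemma contDiffOn_flat {W : Set (RV m)} {w : RV m → RV m [⋀^Fin 2]→L[ℝ] ℝ}
    (h : ContDiffOn ℝ ∞ w W) : ContDiffOn ℝ ∞ (fun x => flat (w x)) W := by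
  rw [contDiffOn_clm_apply]
  intro u
  rw [contDiffOn_clm_apply]
  intro v
  exact (ContinuousAlternatingMap.apply ℝ (RV m) ℝ ![u, v]).contDiff.comp_contDiffOn h

lemma fderiv_flat {W : Set (RV m)} (hW : IsOpen W) {w : RV m → RV m [⋀^Fin 2]→L[ℝ] ℝ}
    (h : ContDiffOn ℝ ∞ w W) {x : RV m} (hx : x ∈ W) (ξ u v : RV m) :
    fderiv ℝ (fun y => flat (w y)) x ξ u v = fderiv ℝ (fun y => w y ![u, v]) x ξ := by
  have hd := ContDiffOn.differentiableAt' hW (contDiffOn_flat h) hx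
  have h2 : HasFDerivAt (fun y => flat (w y) u v) _ x :=
    (hd.hasFDerivAt.clm_apply (hasFDerivAt_const u x)).clm_apply (hasFDerivAt_const v x)
  have h3 := congrArg (fun T => T ξ) h2.fderiv
  simp only [flat_apply] at h3
  rw [h3]
  simp

/-- A closed `2`-form. -/
lemma fderiv_flat_closed {W : Set (RV m)} (hW : IsOpen W) {w : RV m → RV m [⋀^Fin 2]→L[ℝ] ℝ}
    (h : ContDiffOn ℝ ∞ w W) {x : RV m} (hx : x ∈ W) (hc : extDeriv w x = 0) (a b c : RV m) :
    fderiv ℝ (fun y => flat (w y)) x a b c - fderiv ℝ (fun y => flat (w y)) x b a c +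
      fderiv ℝ (fun y => flat (w y)) x c a b = 0 := by
  have h1 := extDeriv_apply (ContDiffOn.differentiableAt' hW h hx) ![a, b, c]
  rw [hc, Fin.sum_univ_three] at h1
  have e0 : (0 : Fin 3).removeNth ![a, b, c] = ![b, c] := by ext k; fin_cases k <;> rfl
  have e1 : (1 : Fin 3).removeNth ![a, b, c] = ![a, c] := by ext k; fin_cases k <;> rfl
  have e2 : (2 : Fin 3).removeNth ![a, b, c] = ![a, b] := by ext k; fin_cases k <;> rfl
  rw [e0, e1, e2] at h1
  simp only [fderiv_flat hW h hx]
  simp at h1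
  linarith

end Flat

/-! ## Hamiltonian vector fields -/

section Hamiltonian

variable {X : Type*} [TopologicalSpace X] {n : ℕ} {O : Orbifold X (2 * n)} (Ω : SymplecticForm O)
  {f : X → ℝ}

lemma flat_injective (i : O.ι) {x : RV (2 * n)} (hx : x ∈ O.V i) :
    Function.Injective (flat (Ω.form i x)) := by
  rw [injective_iff_map_eq_zero]
  intro u hu
  by_contra h
  obtain ⟨v, hv⟩ := Ω.nondegenerate i x hx u h
  exact hv (by rw [← flat_apply, hu]; rfl)

lemma exists_flat_equiv (i : O.ι) {x : RV (2 * n)} (hx : x ∈ O.V i) :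
    ∃ e : RV (2 * n) ≃L[ℝ] (RV (2 * n) →L[ℝ] ℝ), (e : RV (2 * n) →L[ℝ] _) = flat (Ω.form i x) := by
  have hfr : Module.finrank ℝ (RV (2 * n)) = Module.finrank ℝ (RV (2 * n) →L[ℝ] ℝ) := by
    rw [← (LinearMap.toContinuousLinearMap (𝕜 := ℝ) (E := RV (2 * n)) (F' := ℝ)).finrank_eq,
      Module.finrank_linearMap]
    simp
  let e := LinearEquiv.ofInjectiveOfFinrankEq (flat (Ω.form i x)).toLinearMap
    (flat_injective Ω i hx) hfr
  exact ⟨e.toContinuousLinearEquiv, by ext; rfl⟩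

lemma hamVF_spec (f : X → ℝ) (i : O.ι) {x : RV (2 * n)} (hx : x ∈ O.V i) (v : RV (2 * n)) :
    Ω.form i x ![hamVF Ω f i x, v] = - fderiv ℝ (fun y => f (O.π i y)) x v := by
  obtain ⟨e, he⟩ := exists_flat_equiv Ω i hx
  refine Classical.epsilon_spec (p := fun u => ∀ v, Ω.form i x ![u, v] =
    - fderiv ℝ (fun y => f (O.π i y)) x v)
    ⟨e.symm (-fderiv ℝ (fun y => f (O.π i y)) x), fun v => ?_⟩ v
  rw [← flat_apply, ← he]
  simp

lemma hamVF_unique (f : X → ℝ) (i : O.ι) {x : RV (2 * n)} (hx : x ∈ O.V i) {u : RV (2 * n)}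
    (hu : ∀ v, Ω.form i x ![u, v] = - fderiv ℝ (fun y => f (O.π i y)) x v) :
    u = hamVF Ω f i x := by
  apply flat_injective Ω i hx
  ext v
  simp only [flat_apply, hu, hamVF_spec Ω f i hx]

/-- The field is the inverse of `flat` applied to `-df`, and inversion of continuous linear maps is
smooth at an invertible one. -/
lemma contDiffOn_hamVF (hf : OrbSmooth O f) (i : O.ι) : ContDiffOn ℝ ∞ (hamVF Ω f i) (O.V i) := by
  have h1 : ContDiffOn ℝ ∞ (fun x => fderiv ℝ (fun y => f (O.π i y)) x) (O.V i) :=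
    (hf i).fderiv_of_isOpen (O.isOpen_V i) (by simp)
  have h2 : ContDiffOn ℝ ∞ (fun x => ContinuousLinearMap.inverse (flat (Ω.form i x))) (O.V i) := by
    intro x hx
    obtain ⟨e, he⟩ := exists_flat_equiv Ω i hx
    have hc := contDiffAt_map_inverse (𝕜 := ℝ) (n := ∞) e
    rw [he] at hc
    exact hc.comp_contDiffWithinAt x (contDiffOn_flat (Ω.smooth i) x hx)
  refine (h2.clm_apply h1.neg).congr fun x hx => ?_
  symm
  apply hamVF_unique Ω f i hx
  obtain ⟨e, he⟩ := exists_flat_equiv Ω i hx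
  intro v
  rw [← flat_apply, ← he, ContinuousLinearMap.inverse_equiv]
  simp

lemma contDiffOn_toC_hamVF (hf : OrbSmooth O f) (i : O.ι) :
    ContDiffOn ℝ ∞ (fun x => toC (hamVF Ω f i x)) (O.V i) :=
  contDiff_toC.comp_contDiffOn (contDiffOn_hamVF Ω hf i)

lemma ChartEmb.differentiableAt {m : ℕ} {O : OrbifoldCharts X m} {i j : O.ι} (φ : ChartEmb O i j)
    {x : RV m} (hx : x ∈ O.V i) : DifferentiableAt ℝ φ x :=
  ContDiffOn.differentiableAt' (O.isOpen_V i) φ.smooth hx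

lemma fderiv_comp_chartEmb {Y : Type*} [NormedAddCommGroup Y] [NormedSpace ℝ Y] {m : ℕ}
    {O : OrbifoldCharts X m} {i j : O.ι} (φ : ChartEmb O i j) {F G : RV m → Y}
    (h : ∀ x ∈ O.V i, F (φ x) = G x) {x : RV m} (hx : x ∈ O.V i)
    (hF : DifferentiableAt ℝ F (φ x)) (v : RV m) :
    fderiv ℝ G x v = fderiv ℝ F (φ x) (fderiv ℝ φ x v) := by
  have h1 : G =ᶠ[nhds x] F ∘ φ :=
    Filter.mem_of_superset ((O.isOpen_V i).mem_nhds hx) fun y hy => (h y hy).symm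
  rw [h1.fderiv_eq, fderiv_comp x hF (φ.differentiableAt hx)]
  rfl

/-- By uniqueness of the Hamiltonian field it suffices to test the push-forward against the vectors
`dφ(v)`, and these are all vectors since `dφ` is surjective. -/
lemma hamVF_naturality (hf : OrbSmooth O f) {i j : O.ι} (φ : ChartEmb O.toOrbifoldCharts i j)
    {x : RV (2 * n)} (hx : x ∈ O.V i) :
    fderiv ℝ φ x (hamVF Ω f i x) = hamVF Ω f j (φ x) := by
  apply hamVF_unique Ω f j (φ.mapsTo hx)
  intro w
  obtain ⟨v, rfl⟩ := (φ.bijective_fderiv x hx).2 w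
  rw [Ω.invariant i j φ x hx, hamVF_spec Ω f i hx,
    fderiv_comp_chartEmb φ (F := fun y => f (O.π j y)) (fun y hy => by rw [φ.π_comp y hy]) hx
      (ContDiffOn.differentiableAt' (O.isOpen_V j) (hf j) (φ.mapsTo hx))]

/-- The Hamiltonian vector field preserves the symplectic form. -/
lemma lie_hamVF_form (hf : OrbSmooth O f) (i : O.ι) {x : RV (2 * n)} (hx : x ∈ O.V i)
    (u v : RV (2 * n)) :
    fderiv ℝ (fun y => flat (Ω.form i y)) x (hamVF Ω f i x) u v +
      Ω.form i x ![fderiv ℝ (hamVF Ω f i) x u, v] +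
      Ω.form i x ![u, fderiv ℝ (hamVF Ω f i) x v] = 0 := by
  have hV := O.isOpen_V i
  have hX := ContDiffOn.differentiableAt' hV (contDiffOn_hamVF Ω hf i) hx
  have hB := ContDiffOn.differentiableAt' hV (contDiffOn_flat (Ω.smooth i)) hx
  -- The derivative in the direction `a` of the defining equation `Ω(X, b) = -df(b)`, with `b`
  -- constant.
  have key : ∀ a b, fderiv ℝ (fun y => flat (Ω.form i y)) x a (hamVF Ω f i x) b +
      Ω.form i x ![fderiv ℝ (hamVF Ω f i) x a, b] =
      - fderiv ℝ (fderiv ℝ (fun y => f (O.π i y))) x a b := by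
    intro a b
    have h1 : fderiv ℝ (fun y => flat (Ω.form i y) (hamVF Ω f i y) b) x a =
        fderiv ℝ (fun y => - fderiv ℝ (fun y => f (O.π i y)) y b) x a := by
      congr 1
      apply Filter.EventuallyEq.fderiv_eq
      filter_upwards [hV.mem_nhds hx] with y hy
      exact hamVF_spec Ω f i hy b
    have h2 : HasFDerivAt (fun y => flat (Ω.form i y) (hamVF Ω f i y) b) _ x :=
      (hB.hasFDerivAt.clm_apply hX.hasFDerivAt).clm_apply (hasFDerivAt_const b x)
    rw [h2.fderiv, fderiv_fun_neg] at h1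
    rw [_root_.neg_apply, fderiv_fderiv_apply hV (hf i) hx (differentiableAt_const b)] at h1
    simp at h1
    linarith
  -- Closedness exchanges the derivative of `Ω` along `X` for derivatives along `u` and `v`, to
  -- which `key` applies; the two Hessians of `f` then cancel by symmetry.
  have hc := fderiv_flat_closed hV (Ω.smooth i) hx (Ω.closed i x hx) (hamVF Ω f i x) u v
  have h1 := key u v
  have h2 := key v u
  rw [fderiv_fderiv_symm hV (hf i) hx v u] at h2
  rw [form2_swap (Ω.form i x) u]
  linarith

end Hamiltonian

/-! ## Naturality of the Lie derivative -/

section Naturality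

variable {m n : ℕ}

lemma toC_reV_imV_extC (T : RV m →L[ℝ] RV m) (ξ : CV m) :
    reV (extC T ξ) = T (reV ξ) ∧ imV (extC T ξ) = T (imV ξ) := by
  constructor <;> ext a <;> simp [reV, imV, extC]

/-- The product rule along a map. -/
lemma cderiv_form_comp {ν : RV m → CV m [⋀^Fin n]→ₗ[ℂ] ℂ} {φ : RV m → RV m} {x : RV m}
    (hν : ∀ v, DifferentiableAt ℝ (fun y => ν y v) (φ x)) (hφ : DifferentiableAt ℝ φ x)
    {w : Fin n → RV m → CV m} (hw : ∀ k, DifferentiableAt ℝ (w k) x) (ξ : CV m) :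
    cderiv (fun y => ν (φ y) (fun k => w k y)) x ξ =
      cderiv (fun y => ν y (fun k => w k x)) (φ x) (extC (fderiv ℝ φ x) ξ) +
        ∑ k, ν (φ x) (Function.update (fun k => w k x) k (cderiv (w k) x ξ)) := by
  obtain ⟨D, hD, hD'⟩ := exists_hasFDerivAt_form hν hφ.hasFDerivAt (fun k => (hw k).hasFDerivAt)
  have h1 : ∀ k, ν (φ x) (Function.update (fun k => w k x) k (cderiv (w k) x ξ)) =
      ν (φ x) (Function.update (fun k => w k x) k (fderiv ℝ (w k) x (reV ξ))) +
      Complex.I * ν (φ x) (Function.update (fun k => w k x) k (fderiv ℝ (w k) x (imV ξ))) :=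
    fun k => (map_update_smul_I _ _ _ _ _).symm
  simp only [h1, Finset.sum_add_distrib, ← Finset.mul_sum]
  simp only [cderiv, hD.fderiv, hD', smul_eq_mul, toC_reV_imV_extC]
  ring

/-- The Lie derivative commutes with pullback. -/
lemma lieForm_pullback {W W' : Set (RV m)} (hW : IsOpen W) (hW' : IsOpen W')
    {φ : RV m → RV m} (hφ : ContDiffOn ℝ ∞ φ W) (hm : Set.MapsTo φ W W')
    {ν : RV m → CV m [⋀^Fin n]→ₗ[ℂ] ℂ} (hν : ∀ v, ContDiffOn ℝ ∞ (fun y => ν y v) W')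
    {μ : RV m → CV m [⋀^Fin n]→ₗ[ℂ] ℂ}
    (hμ : ∀ x ∈ W, ∀ v, μ x v = ν (φ x) (fun k => extC (fderiv ℝ φ x) (v k)))
    {ξ η : RV m → CV m} (hξ : ContDiffOn ℝ ∞ ξ W) (hη : ContDiffOn ℝ ∞ η W')
    (hrel : ∀ x ∈ W, extC (fderiv ℝ φ x) (ξ x) = η (φ x)) {x : RV m} (hx : x ∈ W)
    (v : Fin n → CV m) :
    lieForm ξ μ x v = lieForm η ν (φ x) (fun k => extC (fderiv ℝ φ x) (v k)) := by
  have hφd : ∀ y ∈ W, DifferentiableAt ℝ φ y := fun y hy =>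
    ContDiffOn.differentiableAt' hW hφ hy
  set Φ : RV m → CV m := fun y => toC (φ y) with hΦ
  have hΦs : ContDiffOn ℝ ∞ Φ W := contDiff_toC.comp_contDiffOn hφ
  have hext : ∀ y ∈ W, ∀ ζ, extC (fderiv ℝ φ y) ζ = cderiv Φ y ζ := fun y hy ζ =>
    extC_fderiv (hφd y hy) ζ
  have h1 : cderiv (fun y => μ y v) x (ξ x) =
      cderiv (fun y => ν (φ y) (fun k => cderiv Φ y (v k))) x (ξ x) :=
    cderiv_congr_of_isOpen hW hx (fun y hy => by rw [hμ y hy]; simp only [hext y hy]) _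
  have hΦd : ∀ k, DifferentiableAt ℝ (fun y => cderiv Φ y (v k)) x := fun k =>
    ContDiffOn.differentiableAt' hW (contDiffOn_cderiv hW hΦs contDiffOn_const) hx
  -- This differentiates the relation `dφ(ξ) = η ∘ φ` along `v k`. By symmetry the second derivative
  -- of `φ` is the one produced when the arguments of `ν` are differentiated along `ξ`.
  have h2 : ∀ k, cderiv η (φ x) (cderiv Φ x (v k)) =
      cderiv₂ Φ x (ξ x) (v k) + cderiv Φ x (cderiv ξ x (v k)) := by
    intro k
    rw [cderiv₂_comm hW hΦs hx, ← cderiv_cderiv hW hΦs hx (ContDiffOn.differentiableAt' hW hξ hx),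
      ← hext x hx, ← cderiv_comp (ContDiffOn.differentiableAt' hW' hη (hm hx)) (hφd x hx)]
    exact cderiv_congr_of_isOpen hW hx (fun y hy => by rw [← hrel y hy, hext y hy]) _
  rw [lieForm, h1, cderiv_form_comp
    (fun v => ContDiffOn.differentiableAt' hW' (hν v) (hm hx)) (hφd x hx) hΦd, lieForm, hrel x hx]
  simp only [hext x hx, h2, AlternatingMap.map_update_add, Finset.sum_add_distrib, hμ x hx]
  rw [add_assoc]
  congr 2
  refine Finset.sum_congr rfl fun k _ => congrArg _ ?_
  ext1 l
  by_cases hl : l = k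
  · subst hl; simp
  · simp [hl]

lemma lieForm_mul {μ : RV m → CV m [⋀^Fin n]→ₗ[ℂ] ℂ} {g : RV m → ℂ} {x : RV m}
    (hμ : ∀ v, DifferentiableAt ℝ (fun y => μ y v) x) (hg : DifferentiableAt ℝ g x)
    (ξ : RV m → CV m) (v : Fin n → CV m) :
    lieForm ξ (fun y => g y • μ y) x v = g x * lieForm ξ μ x v + cderiv g x (ξ x) * μ x v := by
  simp only [lieForm, AlternatingMap.smul_apply, smul_eq_mul, ← Finset.mul_sum]
  rw [cderiv_mul hg (hμ v)]
  ring

lemma lieForm_congr {μ ν : RV m → CV m [⋀^Fin n]→ₗ[ℂ] ℂ} {W : Set (RV m)} (hW : IsOpen W)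
    (h : ∀ y ∈ W, μ y = ν y) {x : RV m} (hx : x ∈ W) (ξ : RV m → CV m) (v : Fin n → CV m) :
    lieForm ξ μ x v = lieForm ξ ν x v := by
  simp only [lieForm, h x hx]
  rw [cderiv_congr_of_isOpen hW hx (fun y hy => by rw [h y hy])]

end Naturality

/-! ## The corrected operator on sections -/

section Sections

variable {X : Type*} [TopologicalSpace X] {n : ℕ} {O : Orbifold X (2 * n)} {Ω : SymplecticForm O}
  {P : Polarization Ω} {hbar : ℝ} {f : X → ℝ}

lemma Polarization.hasLocalSections (P : Polarization Ω) (i : O.ι) :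
    HasLocalSections (P.P i) (O.V i) := by
  intro x hx p hp
  obtain ⟨W, hW, hWo, hxW, ξ, hξ, h⟩ := P.subbundle i x hx
  rw [← (h x hxW).2] at hp
  obtain ⟨c, rfl⟩ := (Submodule.mem_span_range_iff_exists_fun ℂ).1 hp
  refine ⟨W, hW, hWo, hxW, fun y => ∑ k, c k • ξ k y, ⟨?_, fun y hy => ?_⟩, rfl⟩
  · exact ContDiffOn.sum fun k _ => (hξ k).1.const_smul (c k)
  · exact Submodule.sum_mem _ fun k _ => Submodule.smul_mem _ _ ((hξ k).2 y hy)

lemma Polarization.finrank_eq (P : Polarization Ω) (i : O.ι) {x : RV (2 * n)} (hx : x ∈ O.V i) :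
    Module.finrank ℂ (P.P i x) = n := by
  obtain ⟨W, hW, hWo, hxW, ξ, hξ, h⟩ := P.subbundle i x hx
  rw [← (h x hxW).2, finrank_span_eq_card (h x hxW).1, Fintype.card_fin]

lemma HalfFormBundle.detFrame (δ : HalfFormBundle P) (i : O.ι) :
    DetFrame (P.P i) (δ.μ i) (O.V i) where
  isOpen := O.isOpen_V i
  finrank _ hx := P.finrank_eq i hx
  sections := P.hasLocalSections i
  smooth := δ.μ_smooth i
  ne_zero := δ.μ_ne_zero i
  vanish x hx v k hk := (δ.μ_mem i x hx).vanish v k hk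

lemma Polarization.preservesSections (P : Polarization Ω) {i : O.ι} {W : Set (RV (2 * n))}
    (hW : W ⊆ O.V i) {ξ : RV (2 * n) → CV (2 * n)} (hξ : IsSmoothSection (P.P i) W ξ) :
    PreservesSections (P.P i) W ξ := fun U hU hUo ζ hζ x hx =>
  P.involutive i U (hU.trans hW) hUo ξ ζ ⟨hξ.1.mono hU, fun y hy => hξ.2 y (hU hy)⟩ hζ x hx

lemma Quantizable.preservesSections (hq : Quantizable P f) (i : O.ι) :
    PreservesSections (P.P i) (O.V i) (fun y => toC (hamVF Ω f i y)) :=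
  fun U hU hUo ζ hζ x hx => hq i U hU hUo ζ hζ x hx

lemma contDiffOn_divP (δ : HalfFormBundle P) (hf : OrbSmooth O f) (hq : Quantizable P f)
    (i : O.ι) : ContDiffOn ℝ ∞ (divP δ f i) (O.V i) :=
  (δ.detFrame i).contDiffOn_divCoeff (contDiffOn_toC_hamVF Ω hf i) (hq.preservesSections i)

lemma lieForm_eq_divP (δ : HalfFormBundle P) (hq : Quantizable P f)
    {i : O.ι} {x : RV (2 * n)} (hx : x ∈ O.V i) (v : Fin n → CV (2 * n)) :
    lieForm (fun y => toC (hamVF Ω f i y)) (δ.μ i) x v = divP δ f i x * δ.μ i x v :=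
  (δ.detFrame i).lieForm_eq (hq.preservesSections i) hx v

/-- The complex-linear extension as a linear map. -/
def extCL {m k : ℕ} (T : RV m →L[ℝ] RV k) : CV m →ₗ[ℂ] CV k where
  toFun := extC T
  map_add' ξ η := by
    ext a; simp only [extC, reV_add, imV_add, map_add, Pi.add_apply]; push_cast; ring
  map_smul' c ξ := by
    ext a
    have h1 : reV (c • ξ) = c.re • reV ξ - c.im • imV ξ := by ext a; simp [reV, imV]
    have h2 : imV (c • ξ) = c.re • imV ξ + c.im • reV ξ := by ext a; simp [reV, imV]
    simp only [extC, h1, h2, map_sub, map_add, map_smul, Pi.add_apply, Pi.sub_apply, Pi.smul_apply,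
      smul_eq_mul, RingHom.id_apply]
    conv_rhs => rw [← Complex.re_add_im c]
    push_cast
    linear_combination (-(c.im : ℂ) * (T (imV ξ) a : ℂ)) * Complex.I_sq

/-- With `t` the transition function of `δ`, the frames are related by `μ_i = t² φ^*μ_j`, so the
divergences differ by the logarithmic derivative `2 X(t)/t`. The identity is stated multiplied by
`t`. -/
lemma divP_naturality (δ : HalfFormBundle P) (hf : OrbSmooth O f) (hq : Quantizable P f)
    {i j : O.ι} (φ : ChartEmb O.toOrbifoldCharts i j) {x : RV (2 * n)} (hx : x ∈ O.V i) :
    divP δ f i x * δ.trans φ x = divP δ f j (φ x) * δ.trans φ x +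
      2 * fderiv ℝ (δ.trans φ) x (hamVF Ω f i x) := by
  have ht := ContDiffOn.differentiableAt' (O.isOpen_V i) (δ.smooth φ) hx
  have ht2 : DifferentiableAt ℝ (fun y => δ.trans φ y ^ 2) x := ht.pow 2
  let ν : RV (2 * n) → CV (2 * n) [⋀^Fin n]→ₗ[ℂ] ℂ := fun y =>
    (δ.μ j (φ y)).compLinearMap (extCL (fderiv ℝ φ y))
  have hν : ∀ y v, ν y v = δ.μ j (φ y) (fun k => extC (fderiv ℝ φ y) (v k)) := fun y v => rfl
  have hνeq : ∀ y ∈ O.V i, δ.μ i y = δ.trans φ y ^ 2 • ν y := by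
    intro y hy
    ext v
    rw [δ.μ_compatible φ y hy]; rfl
  -- Differentiability of the pullback is read off from `μ_i = t² ν` by dividing by `t²`, without
  -- differentiating `dφ`.
  have hνs : ∀ v, DifferentiableAt ℝ (fun y => ν y v) x := by
    intro v
    have h1 : DifferentiableAt ℝ (fun y => (δ.trans φ y ^ 2)⁻¹ * δ.μ i y v) x :=
      ((ht.pow 2).inv (pow_ne_zero 2 (δ.ne_zero φ x hx))).mul
        ((δ.detFrame i).differentiableAt hx v)
    refine h1.congr_of_eventuallyEq ?_
    filter_upwards [(O.isOpen_V i).mem_nhds hx] with y hy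
    rw [hνeq y hy, AlternatingMap.smul_apply, smul_eq_mul,
      inv_mul_cancel_left₀ (pow_ne_zero 2 (δ.ne_zero φ y hy))]
  obtain ⟨u, hu⟩ := (δ.detFrame i).exists_apply_ne_zero hx
  have hνu : ν x u ≠ 0 := by
    intro h; apply hu; rw [hνeq x hx]; simp [h]
  have h1 := lieForm_eq_divP δ hq hx u
  rw [lieForm_congr (O.isOpen_V i) hνeq hx, lieForm_mul hνs ht2,
    lieForm_pullback (O.isOpen_V i) (O.isOpen_V j) φ.smooth φ.mapsTo (δ.μ_smooth j)
      (fun y _ v => hν y v) (contDiffOn_toC_hamVF Ω hf i) (contDiffOn_toC_hamVF Ω hf j)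
      (fun y hy => by rw [extC_toC, hamVF_naturality Ω hf φ hy]) hx,
    lieForm_eq_divP δ hq (φ.mapsTo hx), ← hν, hνeq x hx, cderiv_toC] at h1
  have h2 : fderiv ℝ (fun y => δ.trans φ y ^ 2) x (hamVF Ω f i x) =
      2 * δ.trans φ x * fderiv ℝ (δ.trans φ) x (hamVF Ω f i x) := by
    have : HasFDerivAt (fun y => δ.trans φ y ^ 2) _ x := ht.hasFDerivAt.pow 2
    rw [this.fderiv]; simp
  rw [h2, AlternatingMap.smul_apply, smul_eq_mul] at h1
  apply mul_right_cancel₀ (mul_ne_zero (δ.ne_zero φ x hx) hνu)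
  linear_combination -h1

/-! ### The corrected operator in frames and under change of chart. -/

lemma contDiffOn_A_apply (L : PrequantumBundle Ω hbar) {i : O.ι} {W : Set (RV (2 * n))}
    (hW : W ⊆ O.V i) {u : RV (2 * n) → RV (2 * n)} (hu : ContDiffOn ℝ ∞ u W) :
    ContDiffOn ℝ ∞ (fun x => L.A i x (u x)) W :=
  ((L.A_smooth i).mono hW).clm_apply hu

lemma contDiffOn_ofReal {E : Type*} [NormedAddCommGroup E] [NormedSpace ℝ E] {W : Set E}
    {g : E → ℝ} (hg : ContDiffOn ℝ ∞ g W) : ContDiffOn ℝ ∞ (fun x => (g x : ℂ)) W :=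
  Complex.ofRealCLM.contDiff.comp_contDiffOn hg

lemma cov_toC (L : PrequantumBundle Ω hbar) (i : O.ι) (s : RV (2 * n) → ℂ) (x u : RV (2 * n)) :
    L.cov i s x (toC u) = fderiv ℝ s x u - Complex.I * (L.A i x u : ℂ) * s x := by
  simp [PrequantumBundle.cov]

lemma contDiffOn_Qmeta (L : PrequantumBundle Ω hbar) (δ : HalfFormBundle P)
    (hf : OrbSmooth O f) (hq : Quantizable P f) {s : O.ι → RV (2 * n) → ℂ} {i : O.ι}
    (hs : ContDiffOn ℝ ∞ (s i) (O.V i)) :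
    ContDiffOn ℝ ∞ (Qmeta L δ f s i) (O.V i) := by
  have hV := O.isOpen_V i
  have h1 : ContDiffOn ℝ ∞ (fun x => L.cov i (s i) x (toC (hamVF Ω f i x))) (O.V i) := by
    simp only [cov_toC]
    exact (contDiffOn_fderiv_apply hV hs (contDiffOn_hamVF Ω hf i)).sub
      ((contDiffOn_const.mul (contDiffOn_ofReal (contDiffOn_A_apply L subset_rfl
        (contDiffOn_hamVF Ω hf i)))).mul hs)
  exact ((contDiffOn_const.mul h1).add ((contDiffOn_ofReal (hf i)).mul hs)).sub
    ((contDiffOn_const.mul (contDiffOn_divP δ hf hq i)).mul hs)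

/-- The derivative of the transition function of `L` is absorbed by the change of the connection
form, and that of `δ` by the change of the divergence: the factor `½` in the operator matches the
factor `2` in `divP_naturality`. -/
lemma IsSection.Qmeta {L : PrequantumBundle Ω hbar} {δ : HalfFormBundle P}
    (hf : OrbSmooth O f) (hq : Quantizable P f) {s : O.ι → RV (2 * n) → ℂ}
    (hs : IsSection L δ s) : IsSection L δ (GeomQuant.Qmeta L δ f s) where
  smooth i := contDiffOn_Qmeta L δ hf hq (hs.smooth i)
  compatible i j φ x hx := by
    have hV := O.isOpen_V i
    have hL := ContDiffOn.differentiableAt' hV (L.smooth φ) hx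
    have hδ := ContDiffOn.differentiableAt' hV (δ.smooth φ) hx
    have hsd := ContDiffOn.differentiableAt' hV (hs.smooth i) hx
    have h1 := fderiv_comp_chartEmb φ (F := s j) (hs.compatible i j φ) hx
      (ContDiffOn.differentiableAt' (O.isOpen_V j) (hs.smooth j) (φ.mapsTo hx)) (hamVF Ω f i x)
    have h2 : HasFDerivAt (fun y => L.trans φ y * δ.trans φ y * s i y) _ x :=
      (hL.hasFDerivAt.mul hδ.hasFDerivAt).mul hsd.hasFDerivAt
    rw [h2.fderiv, hamVF_naturality Ω hf φ hx] at h1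
    have h3 := L.A_compatible φ x hx (hamVF Ω f i x)
    rw [hamVF_naturality Ω hf φ hx] at h3
    simp only [_root_.add_apply, _root_.smul_apply, smul_eq_mul, h3, Pi.mul_apply] at h1
    have h4 := divP_naturality δ hf hq φ hx
    simp only [GeomQuant.Qmeta, Qpre, cov_toC, ← h1, hs.compatible i j φ x hx, φ.π_comp x hx]
    push_cast
    linear_combination (Complex.I * hbar / 2 * L.trans φ x * s i x) * h4

end Sections

end GeomQuant

namespace GeomQuant

/-! ## The corrected operator preserves polarized sections -/

section Polarized

variable {X : Type*} [TopologicalSpace X] {n : ℕ} {O : Orbifold X (2 * n)} {Ω : SymplecticForm O}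
  {P : Polarization Ω} {hbar : ℝ} {f : X → ℝ}

lemma cderiv_ofReal {m : ℕ} {g : RV m → ℝ} {x : RV m} (hg : DifferentiableAt ℝ g x) (ξ : CV m) :
    cderiv (fun y => (g y : ℂ)) x ξ =
      (fderiv ℝ g x (reV ξ) : ℂ) + Complex.I * (fderiv ℝ g x (imV ξ) : ℂ) := by
  have h : fderiv ℝ (fun y => (g y : ℂ)) x = Complex.ofRealCLM.comp (fderiv ℝ g x) :=
    (Complex.ofRealCLM.hasFDerivAt.comp x hg.hasFDerivAt).fderiv
  simp [cderiv, h]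

/-- The complex-linear extension of the connection form. -/
noncomputable def PrequantumBundle.theta (L : PrequantumBundle Ω hbar) (i : O.ι) (x : RV (2 * n))
    (ζ : CV (2 * n)) : ℂ :=
  (L.A i x (reV ζ) : ℂ) + Complex.I * (L.A i x (imV ζ) : ℂ)

lemma cov_eq (L : PrequantumBundle Ω hbar) (i : O.ι) (s : RV (2 * n) → ℂ) (x : RV (2 * n))
    (ζ : CV (2 * n)) : L.cov i s x ζ = cderiv s x ζ - Complex.I * L.theta i x ζ * s x := rfl

lemma theta_sub (L : PrequantumBundle Ω hbar) (i : O.ι) (x : RV (2 * n)) (ζ η : CV (2 * n)) :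
    L.theta i x (ζ - η) = L.theta i x ζ - L.theta i x η := by
  have h1 : reV (ζ - η) = reV ζ - reV η := rfl
  have h2 : imV (ζ - η) = imV ζ - imV η := rfl
  simp only [PrequantumBundle.theta, h1, h2, map_sub]
  push_cast
  ring

lemma contDiffOn_theta (L : PrequantumBundle Ω hbar) {i : O.ι} {W : Set (RV (2 * n))}
    (hW : W ⊆ O.V i) {ξ : RV (2 * n) → CV (2 * n)} (hξ : ContDiffOn ℝ ∞ ξ W) :
    ContDiffOn ℝ ∞ (fun y => L.theta i y (ξ y)) W :=
  (contDiffOn_ofReal (contDiffOn_A_apply L hW (contDiff_reV.comp_contDiffOn hξ))).add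
    (contDiffOn_const.mul
      (contDiffOn_ofReal (contDiffOn_A_apply L hW (contDiff_imV.comp_contDiffOn hξ))))

lemma fderiv_A_apply (L : PrequantumBundle Ω hbar) {i : O.ι} {x : RV (2 * n)} (hx : x ∈ O.V i)
    {Y : RV (2 * n) → RV (2 * n)} (hY : DifferentiableAt ℝ Y x) (u : RV (2 * n)) :
    fderiv ℝ (fun y => L.A i y (Y y)) x u =
      fderiv ℝ (L.A i) x u (Y x) + L.A i x (fderiv ℝ Y x u) := by
  have hA := ContDiffOn.differentiableAt' (O.isOpen_V i) (L.A_smooth i) hx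
  rw [fderiv_clm_apply hA hY]
  simp [add_comm]

lemma fderiv_reV {m : ℕ} {ξ : RV m → CV m} {x : RV m} (hξ : DifferentiableAt ℝ ξ x) :
    DifferentiableAt ℝ (fun y => reV (ξ y)) x ∧
      ∀ u, fderiv ℝ (fun y => reV (ξ y)) x u = reV (fderiv ℝ ξ x u) := by
  let T : CV m →L[ℝ] RV m := ContinuousLinearMap.pi fun a =>
    Complex.reCLM.comp (ContinuousLinearMap.proj a)
  have h : HasFDerivAt (fun y => T (ξ y)) (T.comp (fderiv ℝ ξ x)) x :=
    T.hasFDerivAt.comp x hξ.hasFDerivAt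
  exact ⟨h.differentiableAt, fun u => congrArg (fun S => S u) h.fderiv⟩

lemma fderiv_imV {m : ℕ} {ξ : RV m → CV m} {x : RV m} (hξ : DifferentiableAt ℝ ξ x) :
    DifferentiableAt ℝ (fun y => imV (ξ y)) x ∧
      ∀ u, fderiv ℝ (fun y => imV (ξ y)) x u = imV (fderiv ℝ ξ x u) := by
  let T : CV m →L[ℝ] RV m := ContinuousLinearMap.pi fun a =>
    Complex.imCLM.comp (ContinuousLinearMap.proj a)
  have h : HasFDerivAt (fun y => T (ξ y)) (T.comp (fderiv ℝ ξ x)) x :=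
    T.hasFDerivAt.comp x hξ.hasFDerivAt
  exact ⟨h.differentiableAt, fun u => congrArg (fun S => S u) h.fderiv⟩

lemma fderiv_theta (L : PrequantumBundle Ω hbar) {i : O.ι} {x : RV (2 * n)} (hx : x ∈ O.V i)
    {ξ : RV (2 * n) → CV (2 * n)} (hξ : DifferentiableAt ℝ ξ x) (u : RV (2 * n)) :
    cderiv (fun y => L.theta i y (ξ y)) x (toC u) =
      ((fderiv ℝ (L.A i) x u (reV (ξ x)) : ℂ) +
        Complex.I * (fderiv ℝ (L.A i) x u (imV (ξ x)) : ℂ)) +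
        L.theta i x (cderiv ξ x (toC u)) := by
  have hA := ContDiffOn.differentiableAt' (O.isOpen_V i) (L.A_smooth i) hx
  obtain ⟨hr, hr'⟩ := fderiv_reV hξ
  obtain ⟨hm, hm'⟩ := fderiv_imV hξ
  have h1 : DifferentiableAt ℝ (fun y => L.A i y (reV (ξ y))) x := hA.clm_apply hr
  have h2 : DifferentiableAt ℝ (fun y => L.A i y (imV (ξ y))) x := hA.clm_apply hm
  have h1' : DifferentiableAt ℝ (fun y => (L.A i y (reV (ξ y)) : ℂ)) x :=
    Complex.ofRealCLM.differentiableAt.comp x h1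
  have h2' : DifferentiableAt ℝ (fun y => (L.A i y (imV (ξ y)) : ℂ)) x :=
    Complex.ofRealCLM.differentiableAt.comp x h2
  have h3 : cderiv (fun y => L.theta i y (ξ y)) x (toC u) =
      cderiv (fun y => (L.A i y (reV (ξ y)) : ℂ)) x (toC u) +
      cderiv (fun y => Complex.I * (L.A i y (imV (ξ y)) : ℂ)) x (toC u) :=
    cderiv_add h1' (h2'.const_mul _) _
  have hr0 : reV (0 : CV (2 * n)) = 0 := rfl
  have hm0 : imV (0 : CV (2 * n)) = 0 := rfl
  rw [h3, cderiv_const_mul h2', cderiv_ofReal h1, cderiv_ofReal h2]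
  simp only [reV_toC, imV_toC, map_zero, fderiv_A_apply L hx hr, fderiv_A_apply L hx hm, hr', hm',
    PrequantumBundle.theta, cderiv_toC, hr0, hm0, _root_.zero_apply]
  push_cast
  ring

lemma cderiv_A_apply (L : PrequantumBundle Ω hbar) {i : O.ι} {x : RV (2 * n)} (hx : x ∈ O.V i)
    {Y : RV (2 * n) → RV (2 * n)} (hY : DifferentiableAt ℝ Y x) (ξ : CV (2 * n)) :
    cderiv (fun y => (L.A i y (Y y) : ℂ)) x ξ =
      ((fderiv ℝ (L.A i) x (reV ξ) (Y x) : ℂ) +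
        Complex.I * (fderiv ℝ (L.A i) x (imV ξ) (Y x) : ℂ)) +
        L.theta i x (cderiv (fun y => toC (Y y)) x ξ) := by
  have hA := ContDiffOn.differentiableAt' (O.isOpen_V i) (L.A_smooth i) hx
  have h := toC_reV_imV_extC (fderiv ℝ Y x) ξ
  rw [cderiv_ofReal (hA.clm_apply hY), ← extC_fderiv hY, PrequantumBundle.theta, h.1, h.2,
    fderiv_A_apply L hx hY, fderiv_A_apply L hx hY]
  push_cast
  ring

lemma curvature_real (L : PrequantumBundle Ω hbar) {i : O.ι} {x : RV (2 * n)} (hx : x ∈ O.V i)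
    (u v : RV (2 * n)) :
    fderiv ℝ (L.A i) x u v - fderiv ℝ (L.A i) x v u = Ω.form i x ![u, v] / hbar := by
  have h := L.curvature i x hx u v
  have h2 : ((fderiv ℝ (L.A i) x u v - fderiv ℝ (L.A i) x v u : ℝ) : ℂ) =
      ((Ω.form i x ![u, v] / hbar : ℝ) : ℂ) := by
    apply mul_left_cancel₀ Complex.I_ne_zero
    rw [Complex.ofReal_div]
    linear_combination -h
  exact_mod_cast h2

/-- With `D = ∇ + ½ div`, the cocycle identity gives `[D_X, D_ξ] = D_[X,ξ] + F_∇(X, ξ)`, where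
`F_∇(X, ξ) = -(i/ħ) Ω(X, ξ) = (i/ħ) df(ξ)`. Hence `D_ξ Q s = Q D_ξ s + iħ D_[X,ξ] s`, the curvature
cancelling the derivative of `f`. Both terms vanish, the second because quantizability makes `[X,
ξ]` a section of `P`. -/
lemma IsPolarized.Qmeta {L : PrequantumBundle Ω hbar} {δ : HalfFormBundle P} (hb : hbar ≠ 0)
    (hf : OrbSmooth O f) (hq : Quantizable P f) {s : O.ι → RV (2 * n) → ℂ}
    (hs : IsSection L δ s) (hp : IsPolarized L δ s) :
    IsPolarized L δ (GeomQuant.Qmeta L δ f s) := by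
  intro i W hW hWo ξ hξ x hx
  have hxV := hW hx
  have hD := (δ.detFrame i).mono hWo hW
  have hXs : ContDiffOn ℝ ∞ (fun y => toC (hamVF Ω f i y)) W :=
    (contDiffOn_toC_hamVF Ω hf i).mono hW
  have hX : DifferentiableAt ℝ (hamVF Ω f i) x :=
    ContDiffOn.differentiableAt' hWo ((contDiffOn_hamVF Ω hf i).mono hW) hx
  have hXc := ContDiffOn.differentiableAt' hWo hXs hx
  have hξd := ContDiffOn.differentiableAt' hWo hξ.1 hx
  have hss : ContDiffOn ℝ ∞ (s i) W := (hs.smooth i).mono hW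
  have hsd := ContDiffOn.differentiableAt' hWo hss hx
  have hPX := (hq.preservesSections i).mono hW
  have hPξ := P.preservesSections hW hξ
  have hb' := ContDiffOn.differentiableAt' hWo (hD.contDiffOn_divCoeff hξ.1 hPξ) hx
  have ha' := ContDiffOn.differentiableAt' hWo (hD.contDiffOn_divCoeff hXs hPX) hx
  set Xc := fun y => toC (hamVF Ω f i y) with hXc_def
  set a := fun y => divCoeff Xc (δ.μ i) y with ha
  set b := fun y => divCoeff ξ (δ.μ i) y with hb_def
  -- the derivative of the equation `∇_ξ s = 0` along `X`
  have e1 : cderiv (fun y => (cderiv (s i) y (ξ y) - Complex.I * (L.theta i y (ξ y) * s i y)) +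
      (1 / 2) * (b y * s i y)) x (Xc x) = 0 := by
    rw [cderiv_congr_of_isOpen hWo hx (G := fun _ => 0), cderiv_const]
    intro y hy
    have := hp i W hW hWo ξ hξ y hy
    rw [cov_eq] at this
    linear_combination this
  have hth := ContDiffOn.differentiableAt' hWo (contDiffOn_theta L hW hξ.1) hx
  have hcd := ContDiffOn.differentiableAt' hWo (contDiffOn_cderiv hWo hss hξ.1) hx
  rw [cderiv_add (hcd.fun_sub ((hth.fun_mul hsd).const_mul _)) ((hb'.fun_mul hsd).const_mul _),
    cderiv_sub hcd ((hth.fun_mul hsd).const_mul _), cderiv_const_mul (hth.fun_mul hsd),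
    cderiv_const_mul (hb'.fun_mul hsd), cderiv_mul hth hsd, cderiv_mul hb' hsd,
    cderiv_cderiv hWo hss hx hξd, fderiv_theta L hxV hξd] at e1
  -- the equation for the bracket
  have hbr : IsSmoothSection (P.P i) W (cbracket Xc ξ) :=
    ⟨(contDiffOn_cderiv hWo hξ.1 hXs).sub (contDiffOn_cderiv hWo hXs hξ.1),
      fun y hy => hPX W subset_rfl hWo ξ hξ y hy⟩
  have e2 := hp i W hW hWo _ hbr x hx
  rw [← hD.cderiv_divCoeff_sub hXs hξ.1 hPX hPξ hx, cov_eq, cbracket, theta_sub,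
    cderiv_sub_right] at e2
  -- the equation for `ξ`
  have e3 := hp i W hW hWo ξ hξ x hx
  rw [cov_eq] at e3
  -- curvature
  have e4 := curvature_real L hxV (hamVF Ω f i x) (reV (ξ x))
  have e5 := curvature_real L hxV (hamVF Ω f i x) (imV (ξ x))
  rw [hamVF_spec Ω f i hxV] at e4 e5
  have e4' : hbar * (fderiv ℝ (L.A i) x (hamVF Ω f i x) (reV (ξ x)) -
      fderiv ℝ (L.A i) x (reV (ξ x)) (hamVF Ω f i x)) =
      -fderiv ℝ (fun y => f (O.π i y)) x (reV (ξ x)) := by rw [e4]; field_simp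
  have e5' : hbar * (fderiv ℝ (L.A i) x (hamVF Ω f i x) (imV (ξ x)) -
      fderiv ℝ (L.A i) x (imV (ξ x)) (hamVF Ω f i x)) =
      -fderiv ℝ (fun y => f (O.π i y)) x (imV (ξ x)) := by rw [e5]; field_simp
  have e4c := congrArg (fun r : ℝ => (r : ℂ)) e4'
  have e5c := congrArg (fun r : ℝ => (r : ℂ)) e5'
  push_cast at e4c e5c
  -- the derivative of `Q s`
  have hA : DifferentiableAt ℝ (fun y => (L.A i y (hamVF Ω f i y) : ℂ)) x :=
    ContDiffOn.differentiableAt' hWo (contDiffOn_ofReal (contDiffOn_A_apply L hW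
      ((contDiffOn_hamVF Ω hf i).mono hW))) hx
  have hfr : DifferentiableAt ℝ (fun y => f (O.π i y)) x :=
    ContDiffOn.differentiableAt' hWo ((hf i).mono hW) hx
  have hfd : DifferentiableAt ℝ (fun y => (f (O.π i y) : ℂ)) x :=
    Complex.ofRealCLM.differentiableAt.comp x hfr
  have hcX := ContDiffOn.differentiableAt' hWo (contDiffOn_cderiv hWo hss hXs) hx
  have hQ : GeomQuant.Qmeta L δ f s i = fun y =>
      ((-Complex.I * hbar) * (cderiv (s i) y (Xc y) -
        Complex.I * ((L.A i y (hamVF Ω f i y) : ℂ) * s i y)) + (f (O.π i y) : ℂ) * s i y) -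
        (Complex.I * hbar / 2) * (a y * s i y) := by
    ext y
    simp only [GeomQuant.Qmeta, Qpre, cov_toC, divP, hXc_def, cderiv_toC, ha]
    ring
  have e6 := cderiv_sub
    ((((hcX.fun_sub ((hA.fun_mul hsd).const_mul Complex.I)).const_mul (-Complex.I * hbar)).fun_add
      (hfd.fun_mul hsd))) ((ha'.fun_mul hsd).const_mul (Complex.I * hbar / 2)) (ξ x)
  rw [← hQ] at e6
  rw [cderiv_add ((hcX.fun_sub ((hA.fun_mul hsd).const_mul _)).const_mul _) (hfd.fun_mul hsd),
    cderiv_const_mul (hcX.fun_sub ((hA.fun_mul hsd).const_mul _)),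
    cderiv_sub hcX ((hA.fun_mul hsd).const_mul _), cderiv_const_mul (hA.fun_mul hsd),
    cderiv_const_mul (ha'.fun_mul hsd), cderiv_mul hA hsd, cderiv_mul hfd hsd, cderiv_mul ha' hsd,
    cderiv_cderiv hWo hss hx hXc, cderiv_A_apply L hxV hX, cderiv_ofReal hfr] at e6
  rw [cov_eq, e6, hQ]
  have hsym := cderiv₂_comm hWo hss hx (Xc x) (ξ x)
  rw [hsym] at e1
  simp only [hb_def, ha, hXc_def] at e1 e2 e6 ⊢
  have hI3 : Complex.I ^ 3 = -Complex.I := by rw [pow_succ, Complex.I_sq]; ring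
  -- `e1` with weight `-iħ` is the differential part of `Q` applied to `D_ξ s = 0`, and the
  -- coefficient of `e3` is the zero-order part of `Q`. `e2` is the equation for the bracket; `e4c`
  -- and `e5c` exchange curvature for `df` on the real and imaginary parts of `ξ`.
  linear_combination (norm := (ring_nf; simp only [Complex.I_sq, hI3]; ring_nf))
    (-Complex.I * hbar) * e1 + (Complex.I * hbar) * e2 +
    (f (O.π i x) - Complex.I * hbar / 2 * divCoeff (fun y => toC (hamVF Ω f i y)) (δ.μ i) x -
      hbar * (L.A i x (hamVF Ω f i x) : ℂ)) * e3 +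
    s i x * e4c + Complex.I * s i x * e5c

/-- The operator is local: over the complement of the closure `s` vanishes near every chart point,
so its value and its derivative there are zero. -/
lemma nonzeroSet_Qmeta_subset (L : PrequantumBundle Ω hbar) (δ : HalfFormBundle P) (f : X → ℝ)
    (s : O.ι → RV (2 * n) → ℂ) :
    nonzeroSet O (Qmeta L δ f s) ⊆ closure (nonzeroSet O s) := by
  rintro p ⟨i, x, hx, rfl, hne⟩
  by_contra hp
  apply hne
  have h0 : s i =ᶠ[nhds x] fun _ => 0 := by
    have hc := ((O.π_continuous i).continuousAt ((O.isOpen_V i).mem_nhds hx)).preimage_mem_nhds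
      (isClosed_closure.isOpen_compl.mem_nhds hp)
    filter_upwards [hc, (O.isOpen_V i).mem_nhds hx] with y hy hyV
    by_contra h
    exact hy (subset_closure ⟨i, y, hyV, rfl, h⟩)
  have h1 : s i x = 0 := h0.self_of_nhds
  have h2 : fderiv ℝ (s i) x = 0 := by rw [h0.fderiv_eq]; simp
  simp [Qmeta, Qpre, cov_toC, h1, h2]

lemma KahlerDomain.Qmeta {L : PrequantumBundle Ω hbar} {δ : HalfFormBundle P} (hb : hbar ≠ 0)
    (hf : OrbSmooth O f) (hq : Quantizable P f) {s : O.ι → RV (2 * n) → ℂ}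
    (hs : KahlerDomain L δ s) : KahlerDomain L δ (GeomQuant.Qmeta L δ f s) :=
  ⟨hs.1.Qmeta hf hq, hs.2.1.Qmeta hb hf hq hs.1,
    hs.2.2.of_isClosed_subset isClosed_closure
      (closure_minimal (nonzeroSet_Qmeta_subset L δ f s) isClosed_closure)⟩

lemma continuous_leafOf (P : Polarization Ω) : Continuous (leafOf P) :=
  continuous_quotient_mk'

lemma RealDomain.Qmeta {L : PrequantumBundle Ω hbar} {δ : HalfFormBundle P} (hb : hbar ≠ 0)
    (hf : OrbSmooth O f) (hq : Quantizable P f) {s : O.ι → RV (2 * n) → ℂ}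
    (hs : RealDomain L δ s) : RealDomain L δ (GeomQuant.Qmeta L δ f s) :=
  ⟨hs.1.Qmeta hf hq, hs.2.1.Qmeta hb hf hq hs.1,
    hs.2.2.of_isClosed_subset isClosed_closure
      (closure_minimal ((Set.image_mono (nonzeroSet_Qmeta_subset L δ f s)).trans
        (image_closure_subset_closure_image (continuous_leafOf P))) isClosed_closure)⟩

end Polarized

end GeomQuant

namespace GeomQuant

/-! ## Descent to the underlying space -/

section Descent

variable {X : Type*} [TopologicalSpace X] {m : ℕ}

/-- Two chart points over the same point of `X` are images of one point of a common smaller chart up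
to local group elements, and these are themselves chart embeddings by `ChartEmb.ofGroup`. -/
lemma eq_of_π_eq {Z : Type*} (O : Orbifold X m) {g : O.ι → RV m → Z}
    (hg : ∀ i j (φ : ChartEmb O.toOrbifoldCharts i j), ∀ x ∈ O.V i, g j (φ x) = g i x)
    {i j : O.ι} {x y : RV m} (hx : x ∈ O.V i) (hy : y ∈ O.V j) (h : O.π i x = O.π j y) :
    g i x = g j y := by
  obtain ⟨k, ⟨z, hz, hzp⟩, ⟨φ⟩, ⟨ψ⟩⟩ := O.compatible i j (O.π i x) ⟨⟨x, hx, rfl⟩, ⟨y, hy, h.symm⟩⟩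
  have key : ∀ {l : O.ι} (χ : ChartEmb O.toOrbifoldCharts k l) {w : RV m}, w ∈ O.V l →
      O.π l w = O.π k z → g l w = g k z := by
    intro l χ w hw hwz
    rw [← χ.π_comp z hz] at hwz
    obtain ⟨a, ha⟩ := (O.π_fiber l w hw _ (χ.mapsTo hz)).1 hwz
    rw [← hg k l χ z hz, ← ha]
    exact (hg l l (ChartEmb.ofGroup O.toOrbifoldCharts l a) w hw).symm
  rw [key φ hx hzp.symm, key ψ hy (h.symm.trans hzp.symm)]

/-- The chart projections are open, so neighbourhoods in the chart project to neighbourhoods in `X`.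
-/
lemma continuousAt_of_chart {Z : Type*} [TopologicalSpace Z] (O : Orbifold X m) {F : X → Z}
    {i : O.ι} {x : RV m} (hx : x ∈ O.V i) (h : ContinuousAt (fun y => F (O.π i y)) x) :
    ContinuousAt F (O.π i x) := by
  intro N hN
  have h1 := Filter.inter_mem (h.preimage_mem_nhds hN) ((O.isOpen_V i).mem_nhds hx)
  obtain ⟨U, hU, hUo, hxU⟩ := mem_nhds_iff.1 h1
  rw [Filter.mem_map]
  refine Filter.mem_of_superset ((O.π_open i U (fun y hy => (hU hy).2) hUo).mem_nhds
    ⟨x, hxU, rfl⟩) ?_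
  rintro _ ⟨y, hy, rfl⟩
  exact (hU hy).1

end Descent

/-! ## The infinitesimal symmetry of the corrected operator -/

section Pairing

variable {X : Type*} [TopologicalSpace X] {n : ℕ} {O : Orbifold X (2 * n)} {Ω : SymplecticForm O}
  {P : Polarization Ω} {hbar : ℝ} {f : X → ℝ}

lemma fderiv_conj_mul {m : ℕ} {s t : RV m → ℂ} {x : RV m} (hs : DifferentiableAt ℝ s x)
    (ht : DifferentiableAt ℝ t x) (u : RV m) :
    fderiv ℝ (fun y => (starRingEnd ℂ) (s y) * t y) x u =
      (starRingEnd ℂ) (fderiv ℝ s x u) * t x + (starRingEnd ℂ) (s x) * fderiv ℝ t x u := by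
  have h1 : HasFDerivAt (fun y => (starRingEnd ℂ) (s y))
      ((Complex.conjCLE : ℂ →L[ℝ] ℂ).comp (fderiv ℝ s x)) x :=
    (Complex.conjCLE : ℂ →L[ℝ] ℂ).hasFDerivAt.comp x hs.hasFDerivAt
  have h2 : HasFDerivAt (fun y => (starRingEnd ℂ) (s y) * t y) _ x := h1.mul ht.hasFDerivAt
  rw [h2.fderiv]
  simp
  ring

lemma differentiableAt_conj {m : ℕ} {s : RV m → ℂ} {x : RV m} (hs : DifferentiableAt ℝ s x) :
    DifferentiableAt ℝ (fun y => (starRingEnd ℂ) (s y)) x :=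
  ((Complex.conjCLE : ℂ →L[ℝ] ℂ).differentiableAt).comp x hs

lemma contDiffOn_conj {E : Type*} [NormedAddCommGroup E] [NormedSpace ℝ E] {W : Set E} {s : E → ℂ}
    (hs : ContDiffOn ℝ ∞ s W) : ContDiffOn ℝ ∞ (fun y => (starRingEnd ℂ) (s y)) W :=
  ((Complex.conjCLE : ℂ →L[ℝ] ℂ).contDiff).comp_contDiffOn hs

/-- The function `f`, the connection term `-ħ A(X)` and the contribution of the imaginary part of
the divergence are multiplications by real functions and cancel. What is left is the derivative of
`conj(s) t` and the real part of the divergence. -/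
lemma conj_Qmeta_mul_sub (L : PrequantumBundle Ω hbar) (δ : HalfFormBundle P) (f : X → ℝ)
    {s t : O.ι → RV (2 * n) → ℂ} {i : O.ι} {x : RV (2 * n)} (hs : DifferentiableAt ℝ (s i) x)
    (ht : DifferentiableAt ℝ (t i) x) :
    (starRingEnd ℂ) (Qmeta L δ f s i x) * t i x - (starRingEnd ℂ) (s i x) * Qmeta L δ f t i x =
      Complex.I * hbar * (fderiv ℝ (fun y => (starRingEnd ℂ) (s i y) * t i y) x (hamVF Ω f i x) +
        ((divP δ f i x).re : ℂ) * ((starRingEnd ℂ) (s i x) * t i x)) := by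
  have hre : (2 : ℂ) * ((divP δ f i x).re : ℂ) = divP δ f i x + (starRingEnd ℂ) (divP δ f i x) := by
    rw [Complex.add_conj]; push_cast; ring
  rw [fderiv_conj_mul hs ht]
  simp only [Qmeta, Qpre, cov_toC, map_add, map_sub, map_mul, map_neg, map_div₀, Complex.conj_I,
    Complex.conj_ofReal, map_ofNat]
  linear_combination (-Complex.I * hbar / 2 * ((starRingEnd ℂ) (s i x) * t i x)) * hre

end Pairing

/-! ## Transverse densities of a real polarization -/

section Real

variable {X : Type*} [TopologicalSpace X] {n : ℕ} {O : Orbifold X (2 * n)} {Ω : SymplecticForm O}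
  {P : Polarization Ω} {hbar : ℝ} {f : X → ℝ}

/-- Real and imaginary parts are complex combinations of a vector and its conjugate. -/
lemma Polarization.IsReal.toC_reV_mem (hR : P.IsReal) {i : O.ι} {x : RV (2 * n)} (hx : x ∈ O.V i)
    {ζ : CV (2 * n)} (hζ : ζ ∈ P.P i x) : toC (reV ζ) ∈ P.P i x ∧ toC (imV ζ) ∈ P.P i x := by
  have h1 := (hR i x hx ζ).1 hζ
  have e1 : toC (reV ζ) = (1 / 2 : ℂ) • (ζ + conjV ζ) := by
    ext a
    simp only [toC, reV, conjV, Pi.smul_apply, Pi.add_apply, Complex.add_conj, smul_eq_mul]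
    push_cast; ring
  have e2 : toC (imV ζ) = (-Complex.I / 2) • (ζ - conjV ζ) := by
    ext a
    simp only [toC, imV, conjV, Pi.smul_apply, Pi.sub_apply, Complex.sub_conj, smul_eq_mul]
    push_cast
    linear_combination ((ζ a).im : ℂ) * Complex.I_sq
  rw [e1, e2]
  exact ⟨Submodule.smul_mem _ _ (Submodule.add_mem _ hζ h1),
    Submodule.smul_mem _ _ (Submodule.sub_mem _ hζ h1)⟩

lemma isTransverse_of_ne_zero (δ : HalfFormBundle P) {i : O.ι} {x : RV (2 * n)}
    (hx : x ∈ O.V i) {u : Fin n → RV (2 * n)} (hu : δ.μ i x (fun k => toC (u k)) ≠ 0) :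
    IsTransverse P i x u := by
  intro c hc
  have hli := form_linearIndependent_mkQ _ _ ((δ.detFrame i).vanish x hx) hu
  rw [Fintype.linearIndependent_iff] at hli
  have h := hli (fun k => (c k : ℂ)) (by
    rw [toC_sum] at hc
    simp only [toC_smul] at hc
    rw [← Submodule.Quotient.mk_eq_zero, ← Submodule.mkQ_apply, map_sum] at hc
    simpa using hc)
  ext k
  exact_mod_cast h k

lemma exists_isTransverse (δ : HalfFormBundle P) {i : O.ι} {x : RV (2 * n)} (hx : x ∈ O.V i) :
    ∃ u : Fin n → RV (2 * n), δ.μ i x (fun k => toC (u k)) ≠ 0 := by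
  obtain ⟨a, ha⟩ := exists_single_ne_zero (δ.μ_ne_zero i x hx)
  exact ⟨fun k => Pi.single (a k) 1, by simpa only [toC_single] using ha⟩

/-- Real vectors decompose along a transverse frame and the real distribution. -/
lemma exists_real_decomposition (hR : P.IsReal) (δ : HalfFormBundle P) {i : O.ι}
    {x : RV (2 * n)} (hx : x ∈ O.V i) {u₀ : Fin n → RV (2 * n)}
    (hu : δ.μ i x (fun k => toC (u₀ k)) ≠ 0) (u : Fin n → RV (2 * n)) :
    ∃ (B : Matrix (Fin n) (Fin n) ℝ) (w : Fin n → RV (2 * n)), (∀ k, toC (w k) ∈ P.P i x) ∧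
      u = (fun k => ∑ l, B k l • u₀ l) + w := by
  choose c hc using fun k => form_decompose _ _ (P.finrank_eq i hx)
    ((δ.detFrame i).vanish x hx) hu (toC (u k))
  refine ⟨Matrix.of fun k l => (c k l).re, fun k => reV (toC (u k) - ∑ l, c k l • toC (u₀ l)),
    fun k => (hR.toC_reV_mem hx (hc k)).1, ?_⟩
  ext k a
  simp [reV, toC]

lemma norm_form_decomposition (δ : HalfFormBundle P) {i : O.ι}
    {x : RV (2 * n)} (hx : x ∈ O.V i) (u₀ w : Fin n → RV (2 * n)) (B : Matrix (Fin n) (Fin n) ℝ)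
    (hw : ∀ k, toC (w k) ∈ P.P i x) :
    ‖δ.μ i x (fun k => toC (((fun k => ∑ l, B k l • u₀ l) + w) k))‖ =
      |B.det| * ‖δ.μ i x (fun k => toC (u₀ k))‖ := by
  have e : (fun k => toC (((fun k => ∑ l, B k l • u₀ l) + w) k)) =
      (fun k => ∑ l, (fun k l => (B k l : ℂ)) k l • toC (u₀ l)) + fun k => toC (w k) := by
    ext1 k
    simp only [Pi.add_apply, toC_add, toC_sum, toC_smul]
  rw [e, form_shift _ _ ((δ.detFrame i).vanish x hx) _ _ hw, form_scale, norm_mul]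
  have : (Matrix.of fun k l => (B k l : ℂ)).det = ((B.det : ℝ) : ℂ) := by
    have := (RingHom.map_det (algebraMap ℝ ℂ) B)
    exact this.symm
  rw [this, Complex.norm_real, Real.norm_eq_abs]

/-- If `μ` vanished on `u`, the matrix expressing `u` through a frame `u₀` modulo `P` would be
singular; a left null vector of it gives a nontrivial combination of the `u_k` inside `P`. -/
lemma form_ne_zero_of_isTransverse (hR : P.IsReal) (δ : HalfFormBundle P) {i : O.ι}
    {x : RV (2 * n)} (hx : x ∈ O.V i) {u : Fin n → RV (2 * n)} (hu : IsTransverse P i x u) :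
    δ.μ i x (fun k => toC (u k)) ≠ 0 := by
  obtain ⟨u₀, hu₀⟩ := exists_isTransverse δ hx
  obtain ⟨B, w, hw, rfl⟩ := exists_real_decomposition hR δ hx hu₀ u
  intro h0
  have h1 := norm_form_decomposition δ hx u₀ w B hw
  rw [h0, norm_zero] at h1
  have hB : B.det = 0 := by
    rcases mul_eq_zero.1 h1.symm with h | h
    · exact abs_eq_zero.1 h
    · exact absurd (norm_eq_zero.1 h) hu₀
  obtain ⟨c, hc, hcB⟩ := Matrix.exists_vecMul_eq_zero_iff.2 hB
  apply hc
  apply hu c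
  have e : ∑ k, c k • ((fun k => ∑ l, B k l • u₀ l) + w) k = ∑ k, c k • w k := by
    simp only [Pi.add_apply, smul_add, Finset.sum_add_distrib, Finset.smul_sum, smul_smul]
    rw [Finset.sum_comm]
    simp only [← Finset.sum_smul]
    have h2 : ∀ l, ∑ k, c k * B k l = 0 := fun l => congrFun hcB l
    simp [h2]
  rw [e, toC_sum]
  refine Submodule.sum_mem _ fun k _ => ?_
  rw [toC_smul]
  exact Submodule.smul_mem _ _ (hw k)

/-- The coefficient of a transverse density with respect to `|μ|`. -/
noncomputable def densityCoeff (δ : HalfFormBundle P)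
    (κ : O.ι → RV (2 * n) → (Fin n → RV (2 * n)) → ℂ) (i : O.ι) (x : RV (2 * n)) : ℂ :=
  Classical.epsilon fun r : ℂ => ∀ u, κ i x u = r * (‖δ.μ i x (fun k => toC (u k))‖ : ℂ)

/-- Densities on the quotient by `P` form a line: `shift` and `scale` determine them from the value
on one frame, and `|μ|` obeys the same two rules. -/
lemma IsTransverseDensity.apply_eq (hR : P.IsReal) (δ : HalfFormBundle P)
    {κ : O.ι → RV (2 * n) → (Fin n → RV (2 * n)) → ℂ} (hκ : IsTransverseDensity P κ)
    {i : O.ι} {x : RV (2 * n)} (hx : x ∈ O.V i) {u₀ : Fin n → RV (2 * n)}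
    (hu : δ.μ i x (fun k => toC (u₀ k)) ≠ 0) (u : Fin n → RV (2 * n)) :
    κ i x u = κ i x u₀ / (‖δ.μ i x (fun k => toC (u₀ k))‖ : ℂ) *
      (‖δ.μ i x (fun k => toC (u k))‖ : ℂ) := by
  obtain ⟨B, w, hw, rfl⟩ := exists_real_decomposition hR δ hx hu u
  have hne : (‖δ.μ i x (fun k => toC (u₀ k))‖ : ℂ) ≠ 0 := by simpa using hu
  rw [hκ.shift i x hx _ _ hw, hκ.scale i x hx, norm_form_decomposition δ hx u₀ w B hw]
  push_cast
  field_simp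

lemma IsTransverseDensity.eq_densityCoeff (hR : P.IsReal) (δ : HalfFormBundle P)
    {κ : O.ι → RV (2 * n) → (Fin n → RV (2 * n)) → ℂ} (hκ : IsTransverseDensity P κ)
    {i : O.ι} {x : RV (2 * n)} (hx : x ∈ O.V i) (u : Fin n → RV (2 * n)) :
    κ i x u = densityCoeff δ κ i x * (‖δ.μ i x (fun k => toC (u k))‖ : ℂ) := by
  obtain ⟨u₀, hu₀⟩ := exists_isTransverse δ hx
  exact Classical.epsilon_spec
    (p := fun r : ℂ => ∀ u, κ i x u = r * (‖δ.μ i x (fun k => toC (u k))‖ : ℂ))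
    ⟨_, hκ.apply_eq hR δ hx hu₀⟩ u

lemma contDiffOn_norm {E : Type*} [NormedAddCommGroup E] [NormedSpace ℝ E] {W : Set E} {g : E → ℂ}
    (hg : ContDiffOn ℝ ∞ g W) (h0 : ∀ x ∈ W, g x ≠ 0) :
    ContDiffOn ℝ ∞ (fun x => (‖g x‖ : ℂ)) W :=
  contDiffOn_ofReal (hg.norm ℝ h0)

/-- A tuple on which `μ` does not vanish at `x` stays transverse nearby, which is exactly where the
smoothness of `κ` is available. -/
lemma IsTransverseDensity.contDiffOn_densityCoeff (hR : P.IsReal) (δ : HalfFormBundle P)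
    {κ : O.ι → RV (2 * n) → (Fin n → RV (2 * n)) → ℂ} (hκ : IsTransverseDensity P κ) (i : O.ι) :
    ContDiffOn ℝ ∞ (densityCoeff δ κ i) (O.V i) := by
  intro x hx
  obtain ⟨u, hu⟩ := exists_isTransverse δ hx
  have hμ := δ.μ_smooth i (fun k => toC (u k))
  have hnhds : {y | y ∈ O.V i ∧ IsTransverse P i y u} ∈ nhds x := by
    filter_upwards [(O.isOpen_V i).mem_nhds hx,
      (((δ.detFrame i).differentiableAt hx _).continuousAt).eventually_ne hu] with y hy hyu
    exact ⟨hy, isTransverse_of_ne_zero δ hy hyu⟩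
  have h1 : ContDiffAt ℝ ∞ (fun y => κ i y u) x := (hκ.smooth i u).contDiffAt hnhds
  have h2 : ContDiffAt ℝ ∞ (fun y => (‖δ.μ i y (fun k => toC (u k))‖ : ℂ)) x :=
    Complex.ofRealCLM.contDiff.contDiffAt.comp x
      ((hμ.contDiffAt ((O.isOpen_V i).mem_nhds hx)).norm ℝ hu)
  have hne : (‖δ.μ i x (fun k => toC (u k))‖ : ℂ) ≠ 0 := by simpa using hu
  refine ((h1.mul (h2.inv hne)).congr_of_eventuallyEq ?_).contDiffWithinAt
  filter_upwards [hnhds] with y hy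
  have hyu : (‖δ.μ i y (fun k => toC (u k))‖ : ℂ) ≠ 0 := by
    simpa using form_ne_zero_of_isTransverse hR δ hy.1 hy.2
  rw [hκ.eq_densityCoeff hR δ hy.1 u]
  exact (mul_inv_cancel_right₀ hyu _).symm

/-- The Lie derivative of the density `r |μ|`. -/
lemma hasDerivAt_add_smul {E : Type*} [NormedAddCommGroup E] [NormedSpace ℝ E] (p q : E) :
    HasDerivAt (fun t : ℝ => p + t • q) q 0 := by
  simpa using ((hasDerivAt_id (0 : ℝ)).smul_const q).const_add p

/-- The product rule along the first-order flow reproduces `lieForm`: the moving point gives its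
first term and each moving argument one summand. -/
lemma HalfFormBundle.hasDerivAt_flow (δ : HalfFormBundle P) {i : O.ι} {W : Set (RV (2 * n))}
    (hW : W ⊆ O.V i) (hWo : IsOpen W) {Y : RV (2 * n) → RV (2 * n)} (hY : ContDiffOn ℝ ∞ Y W)
    (hPY : PreservesSections (P.P i) W (fun y => toC (Y y))) {x : RV (2 * n)} (hx : x ∈ W)
    (u : Fin n → RV (2 * n)) :
    HasDerivAt (fun t : ℝ => δ.μ i (x + t • Y x) (fun k => toC (u k + t • fderiv ℝ Y x (u k))))
      (divCoeff (fun y => toC (Y y)) (δ.μ i) x * δ.μ i x (fun k => toC (u k))) 0 := by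
  have hD := (δ.detFrame i).mono hWo hW
  have hYd := ContDiffOn.differentiableAt' hWo hY hx
  have hlie := hD.lieForm_eq hPY hx (fun k => toC (u k))
  have ha := (hasDerivAt_add_smul x (Y x)).hasFDerivAt
  have hw : ∀ k, HasFDerivAt (fun t : ℝ => toC (u k + t • fderiv ℝ Y x (u k)))
      (ContinuousLinearMap.toSpanSingleton ℝ (toC (fderiv ℝ Y x (u k)))) 0 := by
    intro k
    have h := hasDerivAt_add_smul (toC (u k)) (toC (fderiv ℝ Y x (u k)))
    refine (h.congr_of_eventuallyEq (Filter.Eventually.of_forall fun t => ?_)).hasFDerivAt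
    simp only [toC_add, toC_smul]
    congr 1
  have hx0 : x + (0 : ℝ) • Y x = x := by simp
  obtain ⟨D, hDz, hD'⟩ := exists_hasFDerivAt_form (μ := δ.μ i) (x := (0 : ℝ))
    (a := fun t : ℝ => x + t • Y x)
    (fun v => by rw [hx0]; exact hD.differentiableAt hx v) ha hw
  have h1 := hDz.hasDerivAt
  rw [hD' 1] at h1
  convert h1 using 1
  rw [← hlie]
  simp [lieForm, ContinuousLinearMap.toSpanSingleton_apply, cderiv_toC_comp hYd]

/-- The pulled-back value `z` of `μ` satisfies `z' = η z`, with `η` the divergence, hence `|z|' =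
Re(η) |z|`; the product rule with `r` does the rest. -/
lemma lieDensity_eq (δ : HalfFormBundle P) {i : O.ι} {W : Set (RV (2 * n))} (hW : W ⊆ O.V i)
    (hWo : IsOpen W) {Y : RV (2 * n) → RV (2 * n)} (hY : ContDiffOn ℝ ∞ Y W)
    (hPY : PreservesSections (P.P i) W (fun y => toC (Y y)))
    {κ : RV (2 * n) → (Fin n → RV (2 * n)) → ℂ} {r : RV (2 * n) → ℂ}
    (hκ : ∀ y ∈ W, ∀ u, κ y u = r y * (‖δ.μ i y (fun k => toC (u k))‖ : ℂ))
    {x : RV (2 * n)} (hx : x ∈ W) (hr : DifferentiableAt ℝ r x) {u : Fin n → RV (2 * n)}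
    (hu : δ.μ i x (fun k => toC (u k)) ≠ 0) :
    lieDensity Y κ x u = (fderiv ℝ r x (Y x) +
      ((divCoeff (fun y => toC (Y y)) (δ.μ i) x).re : ℂ) * r x) *
        (‖δ.μ i x (fun k => toC (u k))‖ : ℂ) := by
  set η := divCoeff (fun y => toC (Y y)) (δ.μ i) x with hη
  have hx0 : x + (0 : ℝ) • Y x = x := by simp
  have hline := hasDerivAt_add_smul x (Y x)
  set z : ℝ → ℂ := fun t => δ.μ i (x + t • Y x) (fun k => toC (u k + t • fderiv ℝ Y x (u k)))
    with hz
  have hz0 : z 0 = δ.μ i x (fun k => toC (u k)) := by simp [hz]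
  have hzd : HasDerivAt z (η * z 0) 0 := by
    rw [hz0]
    exact δ.hasDerivAt_flow hW hWo hY hPY hx u
  have hz0' : z 0 ≠ 0 := by rw [hz0]; exact hu
  -- The norm is differentiated as the square root of its square, which is smooth here since `z 0 ≠
  -- 0`.
  have hnorm : HasDerivAt (fun t => ‖z t‖) (η.re * ‖z 0‖) 0 := by
    have h1 := (hzd.norm_sq).sqrt (by positivity)
    have h2 : (fun t => √(‖z t‖ ^ 2)) = fun t => ‖z t‖ := by
      ext t; exact Real.sqrt_sq (norm_nonneg _)
    rw [h2] at h1
    convert h1 using 1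
    have h3 : inner ℝ (z 0) (η * z 0) = η.re * ‖z 0‖ ^ 2 := by
      rw [Complex.inner, ← Complex.normSq_eq_norm_sq, mul_assoc, Complex.mul_conj]
      simp
    rw [h3, Real.sqrt_sq (norm_nonneg _)]
    have : ‖z 0‖ ≠ 0 := by simpa using hz0'
    field_simp
  have hrd : HasDerivAt (fun t : ℝ => r (x + t • Y x)) (fderiv ℝ r x (Y x)) 0 := by
    have h1 : HasFDerivAt r (fderiv ℝ r x) (x + (0 : ℝ) • Y x) := by
      rw [hx0]; exact hr.hasFDerivAt
    exact h1.comp_hasDerivAt (0 : ℝ) hline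
  have hfin : HasDerivAt (fun t : ℝ => r (x + t • Y x) * (‖z t‖ : ℂ))
      (fderiv ℝ r x (Y x) * (‖z 0‖ : ℂ) + r x * ((η.re * ‖z 0‖ : ℝ) : ℂ)) 0 := by
    have h1 : HasDerivAt (fun t : ℝ => r (x + t • Y x) * (‖z t‖ : ℂ)) _ 0 :=
      hrd.mul hnorm.ofReal_comp
    simpa using h1
  have hev : (fun t : ℝ => κ (x + t • Y x) (fun k => u k + t • fderiv ℝ Y x (u k))) =ᶠ[nhds 0]
      fun t : ℝ => r (x + t • Y x) * (‖z t‖ : ℂ) := by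
    have hc : ContinuousAt (fun t : ℝ => x + t • Y x) 0 := hline.continuousAt
    have := hc.preimage_mem_nhds (by rw [hx0]; exact hWo.mem_nhds hx)
    filter_upwards [this] with t ht
    exact hκ _ ht _
  rw [lieDensity, hev.deriv_eq, hfin.deriv, hz0]
  push_cast
  ring

lemma IsPolarized.fderiv_eq {L : PrequantumBundle Ω hbar} {δ : HalfFormBundle P}
    {s : O.ι → RV (2 * n) → ℂ} (hp : IsPolarized L δ s) {i : O.ι} {W : Set (RV (2 * n))}
    (hW : W ⊆ O.V i) (hWo : IsOpen W) {Y : RV (2 * n) → RV (2 * n)}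
    (hY : IsSmoothSection (P.P i) W (fun y => toC (Y y))) {x : RV (2 * n)} (hx : x ∈ W) :
    fderiv ℝ (s i) x (Y x) = Complex.I * (L.A i x (Y x) : ℂ) * s i x -
      (1 / 2) * divCoeff (fun y => toC (Y y)) (δ.μ i) x * s i x := by
  have h := hp i W hW hWo _ hY x hx
  rw [cov_toC] at h
  linear_combination h

/-- Unitarity of the transition functions of `L`, together with `|t²| = conj(t) t` for those of `δ`,
gives independence of the frames. Polarization gives `Y(conj(s) t) = -Re(η) conj(s) t` along the
leaves, which exactly cancels the Lie derivative of `|μ|`; this is why the pairing descends to the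
leaf space. -/
lemma isTransverseDensity_pairingDensity (hR : P.IsReal) {L : PrequantumBundle Ω hbar}
    {δ : HalfFormBundle P} {s t : O.ι → RV (2 * n) → ℂ} (hs : IsSection L δ s)
    (ht : IsSection L δ t) (hps : IsPolarized L δ s) (hpt : IsPolarized L δ t) :
    IsTransverseDensity P (pairingDensity δ s t) where
  shift i x hx u w hw := by
    have e : (fun k => toC ((u + w) k)) = (fun k => toC (u k)) + fun k => toC (w k) := by
      ext1 k; simp [toC_add]
    simp only [pairingDensity]
    rw [e, form_shift _ _ ((δ.detFrame i).vanish x hx) _ _ hw]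
  scale i x hx u B := by
    have h := norm_form_decomposition δ hx u 0 B (fun k => by
      have : toC ((0 : Fin n → RV (2 * n)) k) = 0 := by ext a; simp [toC]
      rw [this]; exact Submodule.zero_mem _)
    simp only [add_zero] at h
    simp only [pairingDensity, h]
    push_cast
    ring
  smooth i u := by
    have hsub : {x | x ∈ O.V i ∧ IsTransverse P i x u} ⊆ O.V i := fun x hx => hx.1
    exact ((contDiffOn_conj ((hs.smooth i).mono hsub)).mul ((ht.smooth i).mono hsub)).mul
      (contDiffOn_norm ((δ.μ_smooth i _).mono hsub)
        fun x hx => form_ne_zero_of_isTransverse hR δ hx.1 hx.2)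
  compatible i j φ x hx u := by
    simp only [pairingDensity, hs.compatible i j φ x hx, ht.compatible i j φ x hx,
      δ.μ_compatible φ x hx, extC_toC, norm_mul, norm_pow, map_mul]
    have hL : (starRingEnd ℂ) (L.trans φ x) * L.trans φ x = 1 := by
      rw [mul_comm, Complex.mul_conj', L.unitary φ x hx]; norm_num
    have hδ : (starRingEnd ℂ) (δ.trans φ x) * δ.trans φ x = (‖δ.trans φ x‖ : ℂ) ^ 2 := by
      rw [mul_comm, Complex.mul_conj']
    push_cast
    rw [← hδ]
    linear_combination ((starRingEnd ℂ) (δ.trans φ x) * δ.trans φ x * (starRingEnd ℂ) (s i x) *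
      t i x * (‖δ.μ j (φ x) fun k => toC (fderiv ℝ φ x (u k))‖ : ℂ)) * hL
  basic i W hW hWo Y hY hYP x hx u hu := by
    have hYs : IsSmoothSection (P.P i) W (fun y => toC (Y y)) :=
      ⟨contDiff_toC.comp_contDiffOn hY, hYP⟩
    have hsd := ContDiffOn.differentiableAt' (O.isOpen_V i) (hs.smooth i) (hW hx)
    have htd := ContDiffOn.differentiableAt' (O.isOpen_V i) (ht.smooth i) (hW hx)
    rw [lieDensity_eq δ hW hWo hY (P.preservesSections hW hYs)
      (κ := pairingDensity δ s t i) (r := fun y => (starRingEnd ℂ) (s i y) * t i y) (fun y _ u => rfl) hx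
      ((differentiableAt_conj hsd).mul htd)
      (form_ne_zero_of_isTransverse hR δ (hW hx) hu), fderiv_conj_mul hsd htd,
      hps.fderiv_eq hW hWo hYs hx, hpt.fderiv_eq hW hWo hYs hx]
    set η := divCoeff (fun y => toC (Y y)) (δ.μ i) x
    have hre : (2 : ℂ) * (η.re : ℂ) = η + (starRingEnd ℂ) η := by
      rw [Complex.add_conj]; push_cast; ring
    simp only [map_sub, map_mul, map_div₀, map_one, map_ofNat, Complex.conj_I,
      Complex.conj_ofReal]
    linear_combination (1 / 2 * ((starRingEnd ℂ) (s i x) * t i x) *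
      (‖δ.μ i x fun k => toC (u k)‖ : ℂ)) * hre

end Real

end GeomQuant

namespace GeomQuant

/-! ## Integration of transverse densities over the leaf space -/

section LeafSpaceIntegral

variable {X : Type*} [TopologicalSpace X] {n : ℕ} {O : Orbifold X (2 * n)} {Ω : SymplecticForm O}
  {P : Polarization Ω} {hbar : ℝ} {f : X → ℝ}

lemma SmoothLeafMeasure.densityCoeff_ne_zero (hR : P.IsReal) (δ : HalfFormBundle P)
    (M : SmoothLeafMeasure P) {i : O.ι} {x : RV (2 * n)} (hx : x ∈ O.V i) :
    densityCoeff δ (fun i x u => (M.τ i x u : ℂ)) i x ≠ 0 := by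
  intro h
  obtain ⟨u, hu⟩ := exists_isTransverse δ hx
  have h1 := M.density.eq_densityCoeff hR δ hx u
  rw [h, zero_mul] at h1
  exact (M.positive i x hx u (isTransverse_of_ne_zero δ hx hu)).ne' (by exact_mod_cast h1)

/-- The quotient of a transverse density by the density of a measure on the leaf space. -/
noncomputable def quotCoeff (δ : HalfFormBundle P) (M : SmoothLeafMeasure P)
    (κ : O.ι → RV (2 * n) → (Fin n → RV (2 * n)) → ℂ) (i : O.ι) (x : RV (2 * n)) : ℂ :=
  densityCoeff δ κ i x / densityCoeff δ (fun i x u => (M.τ i x u : ℂ)) i x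

variable {κ : O.ι → RV (2 * n) → (Fin n → RV (2 * n)) → ℂ}

lemma IsTransverseDensity.eq_quotCoeff (hR : P.IsReal) (δ : HalfFormBundle P)
    (M : SmoothLeafMeasure P) (hκ : IsTransverseDensity P κ) {i : O.ι} {x : RV (2 * n)}
    (hx : x ∈ O.V i) (u : Fin n → RV (2 * n)) :
    κ i x u = quotCoeff δ M κ i x * (M.τ i x u : ℂ) := by
  have h := M.densityCoeff_ne_zero hR δ hx
  have h2 := M.density.eq_densityCoeff hR δ hx u
  rw [hκ.eq_densityCoeff hR δ hx u, h2, quotCoeff, ← mul_assoc, div_mul_cancel₀ _ h]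

lemma IsTransverseDensity.contDiffOn_quotCoeff (hR : P.IsReal) (δ : HalfFormBundle P)
    (M : SmoothLeafMeasure P) (hκ : IsTransverseDensity P κ) (i : O.ι) :
    ContDiffOn ℝ ∞ (quotCoeff δ M κ i) (O.V i) :=
  (hκ.contDiffOn_densityCoeff hR δ i).mul ((M.density.contDiffOn_densityCoeff hR δ i).inv
    fun _ hx => M.densityCoeff_ne_zero hR δ hx)

lemma IsTransverseDensity.quotCoeff_naturality (hR : P.IsReal) (δ : HalfFormBundle P)
    (M : SmoothLeafMeasure P) (hκ : IsTransverseDensity P κ) (i j : O.ι)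
    (φ : ChartEmb O.toOrbifoldCharts i j) (x : RV (2 * n)) (hx : x ∈ O.V i) :
    quotCoeff δ M κ j (φ x) = quotCoeff δ M κ i x := by
  obtain ⟨u, hu⟩ := exists_isTransverse δ hx
  have hτ : (M.τ i x u : ℂ) ≠ 0 := by
    exact_mod_cast (M.positive i x hx u (isTransverse_of_ne_zero δ hx hu)).ne'
  have h1 := hκ.eq_quotCoeff hR δ M (φ.mapsTo hx) (fun k => fderiv ℝ φ x (u k))
  have h2 := M.density.compatible i j φ x hx u
  rw [hκ.compatible i j φ x hx, h2, hκ.eq_quotCoeff hR δ M hx u] at h1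
  exact (mul_right_cancel₀ hτ h1).symm

lemma exists_real_local_section (hR : P.IsReal) {i : O.ι} {x v : RV (2 * n)} (hx : x ∈ O.V i)
    (hv : toC v ∈ P.P i x) : ∃ W ⊆ O.V i, IsOpen W ∧ x ∈ W ∧ ∃ Y : RV (2 * n) → RV (2 * n),
      ContDiffOn ℝ ∞ Y W ∧ (∀ y ∈ W, toC (Y y) ∈ P.P i y) ∧ Y x = v := by
  obtain ⟨W, hW, hWo, hxW, ζ, hζ, hp⟩ := P.hasLocalSections i x hx _ hv
  exact ⟨W, hW, hWo, hxW, fun y => reV (ζ y), contDiff_reV.comp_contDiffOn hζ.1,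
    fun y hy => (hR.toC_reV_mem (hW hy) (hζ.2 y hy)).1, by simp only [hp]; rfl⟩

/-- The condition `basic` becomes a linear first-order equation along the leaves whose coefficient
does not depend on `κ`. -/
lemma IsTransverseDensity.fderiv_densityCoeff (hR : P.IsReal) (δ : HalfFormBundle P)
    (hκ : IsTransverseDensity P κ) {i : O.ι} {W : Set (RV (2 * n))} (hW : W ⊆ O.V i)
    (hWo : IsOpen W) {Y : RV (2 * n) → RV (2 * n)} (hY : ContDiffOn ℝ ∞ Y W)
    (hYP : ∀ y ∈ W, toC (Y y) ∈ P.P i y) {x : RV (2 * n)} (hx : x ∈ W) :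
    fderiv ℝ (densityCoeff δ κ i) x (Y x) +
      ((divCoeff (fun y => toC (Y y)) (δ.μ i) x).re : ℂ) * densityCoeff δ κ i x = 0 := by
  obtain ⟨u, hu⟩ := exists_isTransverse δ (hW hx)
  have h1 := hκ.basic i W hW hWo Y hY hYP x hx u (isTransverse_of_ne_zero δ (hW hx) hu)
  rw [lieDensity_eq δ hW hWo hY
    (P.preservesSections hW ⟨contDiff_toC.comp_contDiffOn hY, hYP⟩)
    (fun y hy u => hκ.eq_densityCoeff hR δ (hW hy) u) hx
    (ContDiffOn.differentiableAt' (O.isOpen_V i) (hκ.contDiffOn_densityCoeff hR δ i) (hW hx))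
    hu] at h1
  exact (mul_eq_zero.1 h1).resolve_right (by simpa using hu)

/-- The coefficients of `κ` and of `τ` solve the same linear equation along the leaves, so their
quotient has zero derivative there. -/
lemma IsTransverseDensity.fderiv_quotCoeff (hR : P.IsReal) (δ : HalfFormBundle P)
    (M : SmoothLeafMeasure P) (hκ : IsTransverseDensity P κ) {i : O.ι} {x v : RV (2 * n)}
    (hx : x ∈ O.V i) (hv : toC v ∈ P.P i x) : fderiv ℝ (quotCoeff δ M κ i) x v = 0 := by
  obtain ⟨W, hW, hWo, hxW, Y, hY, hYP, rfl⟩ := exists_real_local_section hR hx hv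
  have h1 := hκ.fderiv_densityCoeff hR δ hW hWo hY hYP hxW
  have h2 := M.density.fderiv_densityCoeff hR δ hW hWo hY hYP hxW
  have hne := M.densityCoeff_ne_zero hR δ hx
  have hq := ContDiffOn.differentiableAt' (O.isOpen_V i) (hκ.contDiffOn_quotCoeff hR δ M i) hx
  have hr := ContDiffOn.differentiableAt' (O.isOpen_V i)
    (M.density.contDiffOn_densityCoeff hR δ i) hx
  have heq : densityCoeff δ κ i =ᶠ[nhds x] fun y =>
      quotCoeff δ M κ i y * densityCoeff δ (fun i x u => (M.τ i x u : ℂ)) i y := by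
    filter_upwards [(O.isOpen_V i).mem_nhds hx] with y hy
    rw [quotCoeff, div_mul_cancel₀ _ (M.densityCoeff_ne_zero hR δ hy)]
  rw [heq.self_of_nhds, heq.fderiv_eq, fderiv_fun_mul hq hr] at h1
  simp only [_root_.add_apply, _root_.smul_apply, smul_eq_mul] at h1
  apply mul_right_cancel₀ hne
  linear_combination h1 - quotCoeff δ M κ i x * h2

lemma IsTransverseDensity.quotCoeff_joined (hR : P.IsReal) (δ : HalfFormBundle P)
    (M : SmoothLeafMeasure P) (hκ : IsTransverseDensity P κ) {i : O.ι} {γ : ℝ → RV (2 * n)}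
    (hγ : ContDiff ℝ ∞ γ)
    (h : ∀ t ∈ Set.Icc (0 : ℝ) 1, γ t ∈ O.V i ∧ toC (deriv γ t) ∈ P.P i (γ t)) :
    quotCoeff δ M κ i (γ 0) = quotCoeff δ M κ i (γ 1) := by
  have hd : ∀ t ∈ Set.Icc (0 : ℝ) 1, HasDerivAt (fun t => quotCoeff δ M κ i (γ t)) 0 t := by
    intro t ht
    have hq := ContDiffOn.differentiableAt' (O.isOpen_V i) (hκ.contDiffOn_quotCoeff hR δ M i)
      (h t ht).1
    have hg : HasDerivAt γ (deriv γ t) t := (hγ.differentiable (by simp) t).hasDerivAt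
    have := hq.hasFDerivAt.comp_hasDerivAt t hg
    rwa [hκ.fderiv_quotCoeff hR δ M (h t ht).1 (h t ht).2] at this
  exact (constant_of_has_deriv_right_zero (fun t ht => (hd t ht).continuousAt.continuousWithinAt)
    (fun t ht => (hd t (Set.Ico_subset_Icc_self ht)).hasDerivWithinAt) 1 (by simp)).symm

lemma IsTransverseDensity.quotCoeff_eq_of_leafOf_eq (hR : P.IsReal) (δ : HalfFormBundle P)
    (M : SmoothLeafMeasure P) (hκ : IsTransverseDensity P κ) {i j : O.ι} {x y : RV (2 * n)}
    (hx : x ∈ O.V i) (hy : y ∈ O.V j) (h : leafOf P (O.π i x) = leafOf P (O.π j y)) :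
    quotCoeff δ M κ i x = quotCoeff δ M κ j y := by
  have hnat := hκ.quotCoeff_naturality hR δ M
  -- The claim is quantified over all chart points above `p` and `q`, because the intermediate point
  -- of a chain carries no preferred chart.
  have hgen : ∀ p q : X, Relation.EqvGen (JoinedInLeaf P) p q →
      ∀ i j x y, x ∈ O.V i → y ∈ O.V j → O.π i x = p → O.π j y = q →
        quotCoeff δ M κ i x = quotCoeff δ M κ j y := by
    intro p q hpq
    induction hpq with
    | rel p q hpq =>
      intro i j x y hx hy hxp hyq
      obtain ⟨k, γ, hγ, hγP, h0, h1⟩ := hpq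
      rw [eq_of_π_eq O hnat hx (hγP 0 (by simp)).1 (hxp.trans h0.symm),
        eq_of_π_eq O hnat hy (hγP 1 (by simp)).1 (hyq.trans h1.symm)]
      exact hκ.quotCoeff_joined hR δ M hγ hγP
    | refl p =>
      intro i j x y hx hy hxp hyq
      exact eq_of_π_eq O hnat hx hy (hxp.trans hyq.symm)
    | symm p q _ ih =>
      intro i j x y hx hy hxp hyq
      exact (ih j i y x hy hx hyq hxp).symm
    | trans p q r _ _ ih1 ih2 =>
      intro i j x y hx hy hxp hyr
      obtain ⟨k, z, hz, hzq⟩ := O.covers q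
      rw [ih1 i k x z hx hz hxp hzq, ih2 k j z y hz hy hzq hyr]
  exact hgen _ _ (Quotient.exact h) i j x y hx hy rfl rfl

lemma exists_leafOf_eq (ℓ : LeafSpace P) : ∃ i, ∃ x ∈ O.V i, leafOf P (O.π i x) = ℓ := by
  induction ℓ using Quotient.inductionOn with
  | h p =>
    obtain ⟨i, x, hx, hp⟩ := O.covers p
    exact ⟨i, x, hx, by simp only [hp]; rfl⟩

/-- Every leaf has a point with a transverse frame, on which `τ` is positive; this forces the value
chosen by `Classical.epsilon`. The half-form bundle serves only to produce the frame. -/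
lemma SmoothLeafMeasure.quot_eq_of (δ : HalfFormBundle P) (M : SmoothLeafMeasure P)
    {κ : O.ι → RV (2 * n) → (Fin n → RV (2 * n)) → ℂ} {ℓ : LeafSpace P} {c : ℂ}
    (hc : ∀ i, ∀ x ∈ O.V i, leafOf P (O.π i x) = ℓ → ∀ u, IsTransverse P i x u →
      κ i x u = c * (M.τ i x u : ℂ)) : M.quot κ ℓ = c := by
  have h := Classical.epsilon_spec (p := fun c : ℂ => ∀ i, ∀ x ∈ O.V i,
    leafOf P (O.π i x) = ℓ → ∀ u, IsTransverse P i x u → κ i x u = c * (M.τ i x u : ℂ)) ⟨c, hc⟩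
  obtain ⟨i, x, hx, hℓ⟩ := exists_leafOf_eq ℓ
  obtain ⟨u, hu⟩ := exists_isTransverse δ hx
  have hu' := isTransverse_of_ne_zero δ hx hu
  have h1 := (h i x hx hℓ u hu').symm.trans (hc i x hx hℓ u hu')
  exact mul_right_cancel₀ (by exact_mod_cast (M.positive i x hx u hu').ne') h1

lemma IsTransverseDensity.quot_leafOf (hR : P.IsReal) (δ : HalfFormBundle P)
    (M : SmoothLeafMeasure P) (hκ : IsTransverseDensity P κ) {i : O.ι} {x : RV (2 * n)}
    (hx : x ∈ O.V i) : M.quot κ (leafOf P (O.π i x)) = quotCoeff δ M κ i x := by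
  refine M.quot_eq_of δ fun j y hy hℓ u _ => ?_
  rw [hκ.quotCoeff_eq_of_leafOf_eq hR δ M hx hy hℓ.symm]
  exact hκ.eq_quotCoeff hR δ M hy u

/-- `leafOf` is a quotient map, so continuity may be checked on `X` and then in charts, where the
function is the smooth `quotCoeff`. -/
lemma IsTransverseDensity.continuous_quot (hR : P.IsReal) (δ : HalfFormBundle P)
    (M : SmoothLeafMeasure P) (hκ : IsTransverseDensity P κ) : Continuous (M.quot κ) := by
  have hq : Topology.IsQuotientMap (leafOf P) := isQuotientMap_quotient_mk'
  rw [hq.continuous_iff, continuous_iff_continuousAt]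
  intro p
  obtain ⟨i, x, hx, rfl⟩ := O.covers p
  apply continuousAt_of_chart O hx
  have h := ContDiffOn.differentiableAt' (O.isOpen_V i) (hκ.contDiffOn_quotCoeff hR δ M i) hx
  refine h.continuousAt.congr ?_
  filter_upwards [(O.isOpen_V i).mem_nhds hx] with y hy
  exact (hκ.quot_leafOf hR δ M hy).symm

/-- The quotient is continuous and supported in a compact closed set of finite measure, where it is
bounded. -/
lemma IsTransverseDensity.integrable_quot (hR : P.IsReal) (δ : HalfFormBundle P)
    (M : SmoothLeafMeasure P) (hκ : IsTransverseDensity P κ)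
    (hc : IsCompact (closure (leafNonzeroSet P κ))) :
    MeasureTheory.Integrable (M.quot κ) M.m := by
  have hcont := hκ.continuous_quot hR δ M
  have hsupp : Function.support (M.quot κ) ⊆ closure (leafNonzeroSet P κ) := by
    intro ℓ hℓ
    obtain ⟨i, x, hx, rfl⟩ := exists_leafOf_eq ℓ
    obtain ⟨u, hu⟩ := exists_isTransverse δ hx
    refine subset_closure ⟨i, x, hx, rfl, u, ?_⟩
    rw [hκ.eq_quotCoeff hR δ M hx u, ← hκ.quot_leafOf hR δ M hx]
    refine mul_ne_zero hℓ ?_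
    exact_mod_cast (M.positive i x hx u (isTransverse_of_ne_zero δ hx hu)).ne'
  rw [← MeasureTheory.integrableOn_iff_integrable_of_support_subset hsupp]
  obtain ⟨B, hB⟩ := hc.exists_bound_of_continuousOn hcont.continuousOn
  exact MeasureTheory.Measure.integrableOn_of_bounded (M.finite_on_compacts _ hc).ne
    hcont.aestronglyMeasurable
    (MeasureTheory.ae_restrict_of_forall_mem isClosed_closure.measurableSet hB)

lemma isCompact_leafNonzeroSet_pairingDensity (δ : HalfFormBundle P)
    {s t : O.ι → RV (2 * n) → ℂ} (hs : IsCompact (closure (leafOf P '' nonzeroSet O s))) :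
    IsCompact (closure (leafNonzeroSet P (pairingDensity δ s t))) := by
  refine hs.of_isClosed_subset isClosed_closure (closure_mono ?_)
  rintro _ ⟨i, x, hx, rfl, u, hu⟩
  refine ⟨_, ⟨i, x, hx, rfl, fun h => hu ?_⟩, rfl⟩
  simp [pairingDensity, h]

/-- The Lie derivative of the pairing density along the Hamiltonian vector field. -/
lemma lieDensity_pairingDensity {L : PrequantumBundle Ω hbar} {δ : HalfFormBundle P}
    (hf : OrbSmooth O f) (hq : Quantizable P f) {s t : O.ι → RV (2 * n) → ℂ}
    (hs : IsSection L δ s) (ht : IsSection L δ t) {i : O.ι} {x : RV (2 * n)} (hx : x ∈ O.V i)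
    {u : Fin n → RV (2 * n)} (hu : δ.μ i x (fun k => toC (u k)) ≠ 0) :
    Complex.I * hbar * lieDensity (hamVF Ω f i) (pairingDensity δ s t i) x u =
      pairingDensity δ (Qmeta L δ f s) t i x u - pairingDensity δ s (Qmeta L δ f t) i x u := by
  have hsd := ContDiffOn.differentiableAt' (O.isOpen_V i) (hs.smooth i) hx
  have htd := ContDiffOn.differentiableAt' (O.isOpen_V i) (ht.smooth i) hx
  rw [lieDensity_eq δ subset_rfl (O.isOpen_V i) (contDiffOn_hamVF Ω hf i) (hq.preservesSections i)
    (κ := pairingDensity δ s t i) (r := fun y => (starRingEnd ℂ) (s i y) * t i y)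
    (fun y _ u => rfl) hx ((differentiableAt_conj hsd).mul htd) hu]
  have h := conj_Qmeta_mul_sub L δ f hsd htd
  simp only [divP] at h
  simp only [pairingDensity]
  linear_combination (-(‖δ.μ i x fun k => toC (u k)‖ : ℂ)) * h

/-- The difference of the two pairing densities is `iħ` times the Lie derivative of the basic
density `⟨s, t⟩`, whose integral vanishes by hypothesis. Integrability is needed to split the
integral of the difference. -/
theorem realPairing_Qmeta {L : PrequantumBundle Ω hbar} {δ : HalfFormBundle P} (hb : hbar ≠ 0)
    (hf : OrbSmooth O f) (hq : Quantizable P f) (hR : P.IsReal) (M : SmoothLeafMeasure P)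
    (hM : M.IntegrationByParts f) {s t : O.ι → RV (2 * n) → ℂ} (hs : RealDomain L δ s)
    (ht : RealDomain L δ t) :
    realPairing δ M (Qmeta L δ f s) t = realPairing δ M s (Qmeta L δ f t) := by
  have hQs := hs.Qmeta hb hf hq
  have hQt := ht.Qmeta hb hf hq
  have hκ := isTransverseDensity_pairingDensity hR hs.1 ht.1 hs.2.1 ht.2.1
  have hκ₁ := isTransverseDensity_pairingDensity hR hQs.1 ht.1 hQs.2.1 ht.2.1
  have hκ₂ := isTransverseDensity_pairingDensity hR hs.1 hQt.1 hs.2.1 hQt.2.1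
  have hint := hM _ hκ (isCompact_leafNonzeroSet_pairingDensity δ hs.2.2)
  have hi₁ := hκ₁.integrable_quot hR δ M (isCompact_leafNonzeroSet_pairingDensity δ hQs.2.2)
  have hi₂ := hκ₂.integrable_quot hR δ M (isCompact_leafNonzeroSet_pairingDensity δ hs.2.2)
  have hIh : Complex.I * (hbar : ℂ) ≠ 0 :=
    mul_ne_zero Complex.I_ne_zero (by exact_mod_cast hb)
  -- That the Lie derivative is itself a transverse density is not needed: its quotient by `τ` is
  -- computed from those of the two densities of which it is a multiple of the difference.
  have hquot : ∀ ℓ, M.quot (fun i => lieDensity (hamVF Ω f i) (pairingDensity δ s t i)) ℓ =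
      (Complex.I * hbar)⁻¹ * (M.quot (pairingDensity δ (Qmeta L δ f s) t) ℓ -
        M.quot (pairingDensity δ s (Qmeta L δ f t)) ℓ) := by
    intro ℓ
    refine M.quot_eq_of δ fun i x hx hℓ u hu => ?_
    have h := lieDensity_pairingDensity hf hq hs.1 ht.1 hx
      (form_ne_zero_of_isTransverse hR δ hx hu)
    rw [← hℓ, hκ₁.quot_leafOf hR δ M hx, hκ₂.quot_leafOf hR δ M hx, mul_assoc, sub_mul,
      ← hκ₁.eq_quotCoeff hR δ M hx, ← hκ₂.eq_quotCoeff hR δ M hx, ← h, inv_mul_cancel_left₀ hIh]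
  rw [SmoothLeafMeasure.integral, MeasureTheory.integral_congr_ae (Filter.Eventually.of_forall hquot),
    MeasureTheory.integral_const_mul, MeasureTheory.integral_sub hi₁ hi₂] at hint
  exact sub_eq_zero.1 ((mul_eq_zero.1 hint).resolve_left (inv_ne_zero hIh))

end LeafSpaceIntegral

end GeomQuant

namespace GeomQuant

/-! ## Matrices of bilinear forms and norms of forms -/

section MetricAlgebra

variable {m n : ℕ}

/-- The matrix of a bilinear form. -/
noncomputable def bilinMatrix (B : RV m →L[ℝ] RV m →L[ℝ] ℝ) : Matrix (Fin m) (Fin m) ℝ :=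
  Matrix.of fun a b => B (Pi.single a 1) (Pi.single b 1)

/-- The matrix of an endomorphism. -/
noncomputable def endMatrix (T : RV m →L[ℝ] RV m) : Matrix (Fin m) (Fin m) ℝ :=
  Matrix.of fun a b => T (Pi.single b 1) a

lemma endMatrix_eq (T : RV m →L[ℝ] RV m) : endMatrix T = LinearMap.toMatrix' T.toLinearMap := by
  ext a b
  simp [endMatrix, LinearMap.toMatrix'_apply]

lemma det_endMatrix (T : RV m →L[ℝ] RV m) : (endMatrix T).det = T.det := by
  rw [endMatrix_eq, LinearMap.det_toMatrix']

lemma sum_smul_single_real (v : RV m) : v = ∑ a, v a • (Pi.single a 1 : RV m) := by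
  ext b
  simp [Finset.sum_apply, Pi.single_apply]

lemma bilin_eq_sum (B : RV m →L[ℝ] RV m →L[ℝ] ℝ) (u v : RV m) :
    B u v = ∑ a, ∑ b, u a * bilinMatrix B a b * v b := by
  conv_lhs => rw [sum_smul_single_real u, sum_smul_single_real v]
  simp only [map_sum, map_smul, _root_.sum_apply, _root_.smul_apply, smul_eq_mul, bilinMatrix,
    Matrix.of_apply]
  rw [Finset.sum_comm]
  refine Finset.sum_congr rfl fun a _ => ?_
  rw [Finset.mul_sum]
  exact Finset.sum_congr rfl fun b _ => by ring

lemma matrix_bilin_comp (B : RV m →L[ℝ] RV m →L[ℝ] ℝ) (S T : RV m →L[ℝ] RV m) :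
    (Matrix.of fun a b => B (S (Pi.single a 1)) (T (Pi.single b 1))) =
      (endMatrix S).transpose * bilinMatrix B * endMatrix T := by
  ext a b
  rw [Matrix.of_apply, bilin_eq_sum, Finset.sum_comm]
  simp only [Matrix.mul_apply, Matrix.transpose_apply, Finset.sum_mul]
  rfl

/-- The Hermitian form on families of coefficients of `n`-forms induced by a matrix. -/
noncomputable def formSum (H : Matrix (Fin m) (Fin m) ℝ) (c : (Fin n → Fin m) → ℂ) : ℂ :=
  ∑ a : Fin n → Fin m, ∑ b : Fin n → Fin m,
    ((∏ k, H (a k) (b k) : ℝ) : ℂ) * c a * (starRingEnd ℂ) (c b)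

/-- Distributivity writes the product over the slots of entries of `M H Mᵀ` as a sum over tuples of
intermediate indices, so a change of basis of the coefficients can be moved into the matrix. -/
lemma formSum_map (H M : Matrix (Fin m) (Fin m) ℝ) {c c' : (Fin n → Fin m) → ℂ}
    (hc : ∀ a, c' a = ∑ d : Fin n → Fin m, ((∏ k, M (d k) (a k) : ℝ) : ℂ) * c d) :
    formSum H c' = formSum (M * H * M.transpose) c := by
  have h1 : ∀ d e : Fin n → Fin m, ∏ k, (M * H * M.transpose) (d k) (e k) =
      ∑ b : Fin n → Fin m, ∑ a : Fin n → Fin m,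
        (∏ k, M (d k) (a k)) * (∏ k, H (a k) (b k)) * ∏ k, M (e k) (b k) := by
    intro d e
    simp only [Matrix.mul_apply, Matrix.transpose_apply]
    rw [Finset.prod_univ_sum, Fintype.piFinset_univ]
    refine Finset.sum_congr rfl fun b _ => ?_
    rw [Finset.prod_mul_distrib, Finset.prod_univ_sum, Fintype.piFinset_univ, Finset.sum_mul]
    exact Finset.sum_congr rfl fun a _ => by rw [Finset.prod_mul_distrib]
  simp only [formSum, h1, hc, map_sum, map_mul, Complex.conj_ofReal]
  push_cast
  simp only [Finset.sum_mul, Finset.mul_sum]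
  -- Both sides are now fourfold sums with equal terms; what follows only reorders the summations.
  rw [Finset.sum_comm]
  conv_lhs =>
    enter [2, b]
    rw [Finset.sum_comm' (t' := Finset.univ) (s' := fun _ => Finset.univ) (by simp)]
  conv_lhs =>
    enter [2, b, 2, e]
    rw [Finset.sum_comm]
  conv_lhs =>
    enter [2, b]
    rw [Finset.sum_comm]
  rw [Finset.sum_comm]
  refine Finset.sum_congr rfl fun d _ => ?_
  rw [Finset.sum_comm]
  refine Finset.sum_congr rfl fun e _ => ?_
  refine Finset.sum_congr rfl fun b _ => ?_
  refine Finset.sum_congr rfl fun a _ => ?_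
  ring

lemma formSum_smul (H : Matrix (Fin m) (Fin m) ℝ) (z : ℂ) (c : (Fin n → Fin m) → ℂ) :
    formSum H (fun a => z * c a) = ((‖z‖ ^ 2 : ℝ) : ℂ) * formSum H c := by
  have hz : ((‖z‖ ^ 2 : ℝ) : ℂ) = z * (starRingEnd ℂ) z := by
    rw [Complex.mul_conj, Complex.normSq_eq_norm_sq]
  simp only [formSum, hz, Finset.mul_sum, map_mul]
  exact Finset.sum_congr rfl fun a _ => Finset.sum_congr rfl fun b _ => by ring

lemma form_extC (β : CV m [⋀^Fin n]→ₗ[ℂ] ℂ) (T : RV m →L[ℝ] RV m) (a : Fin n → Fin m) :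
    β (fun k => extC T (Pi.single (a k) 1)) = ∑ d : Fin n → Fin m,
      ((∏ k, endMatrix T (d k) (a k) : ℝ) : ℂ) * β (fun k => Pi.single (d k) 1) := by
  rw [form_expand]
  refine Finset.sum_congr rfl fun d _ => ?_
  congr 1
  push_cast
  refine Finset.prod_congr rfl fun k _ => ?_
  rw [← toC_single, extC_toC]
  rfl

/-- The coefficients of a form. -/
noncomputable def formCoeff (β : CV m [⋀^Fin n]→ₗ[ℂ] ℂ) (a : Fin n → Fin m) : ℂ :=
  β fun k => Pi.single (a k) 1

/-- Invariance of the norm under pullback: the inverse metric transforms with the inverse of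
`endMatrix T`, which cancels the change of the coefficients. -/
lemma formSum_extC (B : RV m →L[ℝ] RV m →L[ℝ] ℝ) {T : RV m →L[ℝ] RV m} (hT : T.det ≠ 0)
    (β : CV m [⋀^Fin n]→ₗ[ℂ] ℂ) :
    formSum (Matrix.of fun a b => B (T (Pi.single a 1)) (T (Pi.single b 1)))⁻¹
        (fun a => β (fun k => extC T (Pi.single (a k) 1))) =
      formSum (bilinMatrix B)⁻¹ (formCoeff β) := by
  rw [formSum_map _ (endMatrix T) (form_extC β T), matrix_bilin_comp]
  have hu : IsUnit (endMatrix T).det := by rw [det_endMatrix]; exact hT.isUnit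
  have hu' : IsUnit (endMatrix T).transpose.det := by rwa [Matrix.det_transpose]
  rw [Matrix.mul_inv_rev, Matrix.mul_inv_rev, ← Matrix.mul_assoc, Matrix.mul_nonsing_inv _ hu,
    Matrix.one_mul, Matrix.mul_assoc, Matrix.nonsing_inv_mul _ hu', Matrix.mul_one]
  rfl

lemma formSum_one (c : (Fin n → Fin m) → ℂ) :
    formSum (1 : Matrix (Fin m) (Fin m) ℝ) c = ((∑ a, ‖c a‖ ^ 2 : ℝ) : ℂ) := by
  have h : ∀ a b : Fin n → Fin m, ∏ k, (1 : Matrix (Fin m) (Fin m) ℝ) (a k) (b k) =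
      if a = b then 1 else 0 := by
    intro a b
    simp only [Matrix.one_apply]
    rw [Finset.prod_ite_zero]
    simp [funext_iff]
  simp only [formSum, h]
  push_cast
  refine Finset.sum_congr rfl fun a _ => ?_
  rw [Finset.sum_eq_single a (fun b _ hb => by simp [Ne.symm hb]) (by simp)]
  simp only [if_true, Complex.ofReal_one, one_mul]
  rw [Complex.mul_conj, Complex.normSq_eq_norm_sq]
  push_cast
  rfl

-- Writing `G⁻¹ = B Bᵀ` with `B` invertible turns the sum into `∑ |c'|²`, where `c'` are the
-- coefficients of the pullback of `β` under `B`. They cannot all vanish, since `B` is invertible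
-- and `β ≠ 0`.
open scoped MatrixOrder Matrix.Norms.L2Operator in
lemma formSum_pos {G : Matrix (Fin m) (Fin m) ℝ} (hG : G.PosDef) {β : CV m [⋀^Fin n]→ₗ[ℂ] ℂ}
    (hβ : β ≠ 0) : ∃ r : ℝ, 0 < r ∧ formSum G⁻¹ (formCoeff β) = (r : ℂ) := by
  obtain ⟨B, hB, hBG⟩ : ∃ B : Matrix (Fin m) (Fin m) ℝ, IsUnit B.det ∧
      G⁻¹ = B * 1 * B.transpose := by
    obtain ⟨C, hC⟩ := CStarAlgebra.nonneg_iff_eq_star_mul_self.mp hG.inv.posSemidef.nonneg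
    refine ⟨C.transpose, ?_, by rw [hC]; simp [Matrix.star_eq_conjTranspose]⟩
    have h := hG.inv.det_pos
    rw [hC, Matrix.det_mul] at h
    rw [Matrix.det_transpose]
    refine isUnit_iff_ne_zero.2 fun h0 => ?_
    simp [h0] at h
  set T : RV m →L[ℝ] RV m := LinearMap.toContinuousLinearMap (Matrix.toLin' B) with hT
  have hTB : endMatrix T = B := by
    rw [endMatrix_eq, hT]
    simp
  refine ⟨_, ?_, by
    rw [hBG, ← hTB]
    exact (formSum_map 1 _ (form_extC β T)).symm.trans (formSum_one _)⟩
  by_contra hcon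
  have h0 : ∀ a : Fin n → Fin m, β (fun k => extC T (Pi.single (a k) 1)) = 0 := by
    intro a
    have h1 := le_antisymm (not_lt.1 hcon) (Finset.sum_nonneg fun a _ => by positivity)
    have h2 := (Finset.sum_eq_zero_iff_of_nonneg (fun a _ => by positivity)).1 h1 a
      (Finset.mem_univ a)
    simpa using h2
  obtain ⟨a, ha⟩ := exists_single_ne_zero hβ
  apply ha
  set S : RV m →L[ℝ] RV m := LinearMap.toContinuousLinearMap (Matrix.toLin' B⁻¹) with hS
  have hTS : ∀ u, T (S u) = u := by
    intro u
    simp [hT, hS, Matrix.mulVec_mulVec, Matrix.mul_nonsing_inv _ hB]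
  have h3 := form_expand (β.compLinearMap (extCL T)) (fun k => toC (S (Pi.single (a k) 1)))
  simp only [AlternatingMap.compLinearMap_apply] at h3
  have h4 : ∀ u, extCL T (toC (S u)) = toC u := fun u => by
    change extC T _ = _
    rw [extC_toC, hTS]
  simp only [h4, toC_single] at h3
  rw [h3]
  exact Finset.sum_eq_zero fun d _ => mul_eq_zero_of_right _ (h0 d)

end MetricAlgebra

end GeomQuant

namespace GeomQuant

/-! ## Calculus of determinants and inverse matrices -/

section MatrixCalculus

variable {m n : ℕ} {E : Type*} [NormedAddCommGroup E] [NormedSpace ℝ E]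

lemma contDiffOn_det {W : Set E} {A : E → Matrix (Fin m) (Fin m) ℝ}
    (hA : ∀ a b, ContDiffOn ℝ ∞ (fun y => A y a b) W) :
    ContDiffOn ℝ ∞ (fun y => (A y).det) W := by
  simp only [Matrix.det_apply']
  exact ContDiffOn.sum fun σ _ => contDiffOn_const.mul (contDiffOn_prod fun k _ => hA _ _)

/-- Cramer's rule, by which statements about entries of the inverse become statements about
determinants. -/
lemma inv_apply_eq (A : Matrix (Fin m) (Fin m) ℝ) (a b : Fin m) :
    A⁻¹ a b = A.det⁻¹ * (A.updateRow b (Pi.single a 1)).det := by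
  rw [Matrix.inv_def, Ring.inverse_eq_inv', Matrix.smul_apply, Matrix.adjugate_apply, smul_eq_mul]

lemma contDiffOn_inv_apply {W : Set E} {A : E → Matrix (Fin m) (Fin m) ℝ}
    (hA : ∀ a b, ContDiffOn ℝ ∞ (fun y => A y a b) W) (h0 : ∀ y ∈ W, (A y).det ≠ 0)
    (a b : Fin m) : ContDiffOn ℝ ∞ (fun y => (A y)⁻¹ a b) W := by
  simp only [inv_apply_eq]
  refine ((contDiffOn_det hA).inv h0).mul (contDiffOn_det fun c d => ?_)
  by_cases h : c = b
  · subst h; simpa using contDiffOn_const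
  · simpa [Matrix.updateRow_ne h] using hA c d

/-- In this and the next two lemmas derivative zero suffices: in the applications the matrix of `Ω`
or of the metric is stationary to first order along the flow. -/
lemma hasDerivAt_prod_zero {ι : Type*} (s : Finset ι) {g : ι → ℝ → ℝ} {t : ℝ}
    (hg : ∀ k ∈ s, HasDerivAt (g k) 0 t) : HasDerivAt (fun y => ∏ k ∈ s, g k y) 0 t := by
  classical
  simpa using HasDerivAt.fun_finsetProd hg

lemma hasDerivAt_det_zero {A : ℝ → Matrix (Fin m) (Fin m) ℝ} {t : ℝ}
    (hA : ∀ a b, HasDerivAt (fun y => A y a b) 0 t) : HasDerivAt (fun y => (A y).det) 0 t := by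
  simp only [Matrix.det_apply']
  have h := HasDerivAt.fun_sum (u := Finset.univ) (x := t) fun (σ : Equiv.Perm (Fin m)) _ =>
    (hasDerivAt_prod_zero Finset.univ fun k _ => hA (σ k) k).const_mul
      ((σ.sign : ℤ) : ℝ)
  simpa using h

lemma hasDerivAt_inv_apply_zero {A : ℝ → Matrix (Fin m) (Fin m) ℝ} {t : ℝ}
    (hA : ∀ a b, HasDerivAt (fun y => A y a b) 0 t) (h0 : (A t).det ≠ 0) (a b : Fin m) :
    HasDerivAt (fun y => (A y)⁻¹ a b) 0 t := by
  simp only [inv_apply_eq]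
  have h1 : HasDerivAt (fun y => ((A y).updateRow b (Pi.single a 1)).det) 0 t := by
    refine hasDerivAt_det_zero fun c d => ?_
    by_cases h : c = b
    · subst h; simpa using hasDerivAt_const t _
    · simpa [Matrix.updateRow_ne h] using hA c d
  simpa using ((hasDerivAt_det_zero hA).fun_inv h0).fun_mul h1

/-- The matrix is stationary and the coefficients change at the rate `D`, so the Hermitian
expression changes at the rate `D + conj(D)`. -/
lemma hasDerivAt_formSum {H : ℝ → Matrix (Fin m) (Fin m) ℝ} {c : ℝ → (Fin n → Fin m) → ℂ} {t : ℝ}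
    {D : ℂ} (hH : ∀ a b, HasDerivAt (fun y => H y a b) 0 t)
    (hc : ∀ a, HasDerivAt (fun y => c y a) (D * c t a) t) :
    HasDerivAt (fun y => formSum (H y) (c y)) (((2 * D.re : ℝ) : ℂ) * formSum (H t) (c t)) t := by
  have hD : ((2 * D.re : ℝ) : ℂ) = D + (starRingEnd ℂ) D := by
    rw [Complex.add_conj]
  rw [hD]
  simp only [formSum, Finset.mul_sum]
  refine HasDerivAt.fun_sum fun a _ => HasDerivAt.fun_sum fun b _ => ?_
  have h1 := ((hasDerivAt_prod_zero Finset.univ fun k _ => hH (a k) (b k)).ofReal_comp.fun_mul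
    (hc a)).fun_mul (hc b).star
  refine h1.congr_deriv ?_
  simp only [Complex.ofReal_zero, zero_mul, zero_add, star_mul', RCLike.star_def]
  ring

lemma det_one_add_smul_hasDerivAt (M : Matrix (Fin m) (Fin m) ℝ) :
    HasDerivAt (fun t : ℝ => (1 + t • M).det) M.trace 0 := by
  rw [funext fun t : ℝ => Matrix.det_one_add_smul t M]
  have h1 : ∀ p : Polynomial ℝ, HasDerivAt (fun t : ℝ => p.eval t * t ^ 2) 0 0 := fun p => by
    simpa using (p.hasDerivAt 0).fun_mul (hasDerivAt_pow 2 (0 : ℝ))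
  simpa using (((hasDerivAt_id (0 : ℝ)).const_mul M.trace).const_add 1).fun_add (h1 _)

/-- Every matrix on the segment from the identity to `A` is invertible: pairing a null vector `v`
with its image leaves `(1 - s)|v|²`, because `A` is skew. So the determinant cannot change sign
along the segment. -/
lemma det_pos_of_skew {A : Matrix (Fin m) (Fin m) ℝ} (hs : ∀ v : RV m, v ⬝ᵥ A.mulVec v = 0)
    (h0 : A.det ≠ 0) : 0 < A.det := by
  have hne : ∀ s ∈ Set.Icc (0 : ℝ) 1,
      ((1 - s) • (1 : Matrix (Fin m) (Fin m) ℝ) + s • A).det ≠ 0 := by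
    intro s hs' h
    obtain ⟨v, hv, hv0⟩ := Matrix.exists_mulVec_eq_zero_iff.2 h
    rw [Matrix.add_mulVec, Matrix.smul_mulVec, Matrix.smul_mulVec, Matrix.one_mulVec] at hv0
    have h1 := congrArg (fun w => v ⬝ᵥ w) hv0
    simp only [dotProduct_add, dotProduct_smul, hs, mul_zero, add_zero, dotProduct_zero,
      smul_eq_mul, mul_eq_zero] at h1
    rcases h1 with h1 | h1
    · rw [h1, zero_smul, zero_add, show s = 1 by linarith, one_smul] at hv0
      exact h0 (Matrix.exists_mulVec_eq_zero_iff.1 ⟨v, hv, hv0⟩)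
    · exact hv (dotProduct_self_eq_zero.1 h1)
  have hc : Continuous fun s : ℝ => ((1 - s) • (1 : Matrix (Fin m) (Fin m) ℝ) + s • A).det := by
    refine Continuous.matrix_det ?_
    fun_prop
  by_contra hcon
  have h1 := intermediate_value_Icc' (zero_le_one' ℝ) hc.continuousOn
  obtain ⟨s, hs1, hs2⟩ := h1 (show (0 : ℝ) ∈ _ by simpa using not_lt.1 hcon)
  exact hne s hs1 hs2

end MatrixCalculus

end GeomQuant

namespace GeomQuant

/-! ## The Liouville density -/

section Liouville

variable {X : Type*} [TopologicalSpace X] {n : ℕ} {O : Orbifold X (2 * n)} (Ω : SymplecticForm O)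
  {P : Polarization Ω} {hbar : ℝ} {f : X → ℝ}

lemma liouvilleDensity_eq (i : O.ι) (x : RV (2 * n)) :
    liouvilleDensity Ω i x = Real.sqrt (bilinMatrix (flat (Ω.form i x))).det := rfl

lemma det_form_pos (i : O.ι) {x : RV (2 * n)} (hx : x ∈ O.V i) :
    0 < (bilinMatrix (flat (Ω.form i x))).det := by
  have key : ∀ u v : RV (2 * n), u ⬝ᵥ (bilinMatrix (flat (Ω.form i x))).mulVec v =
      Ω.form i x ![u, v] := by
    intro u v
    rw [← flat_apply, bilin_eq_sum]
    simp only [dotProduct, Matrix.mulVec, Finset.mul_sum, mul_assoc]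
  refine det_pos_of_skew (fun v => ?_) fun h => ?_
  · have := form2_swap (Ω.form i x) v v
    rw [key]; linarith
  · obtain ⟨v, hv, hv0⟩ := Matrix.exists_mulVec_eq_zero_iff.2 h
    obtain ⟨w, hw⟩ := Ω.nondegenerate i x hx v hv
    apply hw
    rw [form2_swap, ← key, hv0, dotProduct_zero, neg_zero]

lemma contDiffOn_bilinMatrix_flat (i : O.ι) (a b : Fin (2 * n)) :
    ContDiffOn ℝ ∞ (fun y => bilinMatrix (flat (Ω.form i y)) a b) (O.V i) :=
  ((contDiffOn_flat (Ω.smooth i)).clm_apply contDiffOn_const).clm_apply contDiffOn_const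

lemma contDiffOn_liouvilleDensity (i : O.ι) :
    ContDiffOn ℝ ∞ (liouvilleDensity Ω i) (O.V i) :=
  (contDiffOn_det (contDiffOn_bilinMatrix_flat Ω i)).sqrt fun _ hx => (det_form_pos Ω i hx).ne'

lemma liouvilleDensity_naturality {i j : O.ι} (φ : ChartEmb O.toOrbifoldCharts i j)
    {x : RV (2 * n)} (hx : x ∈ O.V i) :
    liouvilleDensity Ω i x = |(fderiv ℝ φ x).det| * liouvilleDensity Ω j (φ x) := by
  have h : bilinMatrix (flat (Ω.form i x)) = (endMatrix (fderiv ℝ φ x)).transpose *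
      bilinMatrix (flat (Ω.form j (φ x))) * endMatrix (fderiv ℝ φ x) := by
    rw [← matrix_bilin_comp]
    ext a b
    simp only [bilinMatrix, Matrix.of_apply, flat_apply]
    exact (Ω.invariant i j φ x hx _ _).symm
  rw [liouvilleDensity_eq, h, Matrix.det_mul, Matrix.det_mul, Matrix.det_transpose, det_endMatrix,
    liouvilleDensity_eq, ← Real.sqrt_sq_eq_abs, ← Real.sqrt_mul (sq_nonneg _)]
  congr 1
  ring

/-- The endomorphisms `1 + t DX`, the first-order flow of a vector field on tangent vectors. -/
noncomputable def flowT (D : RV (2 * n) →L[ℝ] RV (2 * n)) (t : ℝ) : RV (2 * n) →L[ℝ] RV (2 * n) :=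
  ContinuousLinearMap.id ℝ _ + t • D

lemma flowT_apply (D : RV (2 * n) →L[ℝ] RV (2 * n)) (t : ℝ) (u : RV (2 * n)) :
    flowT D t u = u + t • D u := rfl

lemma endMatrix_flowT (D : RV (2 * n) →L[ℝ] RV (2 * n)) (t : ℝ) :
    endMatrix (flowT D t) = 1 + t • endMatrix D := by
  ext a b
  simp [endMatrix, flowT_apply, Matrix.one_apply, Pi.single_apply]

lemma hasDerivAt_det_flowT (D : RV (2 * n) →L[ℝ] RV (2 * n)) :
    HasDerivAt (fun t => (flowT D t).det) (endMatrix D).trace 0 := by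
  simp only [← det_endMatrix, endMatrix_flowT]
  exact det_one_add_smul_hasDerivAt _

lemma det_flowT_zero (D : RV (2 * n) →L[ℝ] RV (2 * n)) : (flowT D 0).det = 1 := by
  rw [← det_endMatrix, endMatrix_flowT]
  simp

lemma hasDerivAt_comp_add_smul {F : Type*} [NormedAddCommGroup F] [NormedSpace ℝ F]
    {g : RV (2 * n) → F} {x : RV (2 * n)} (hg : DifferentiableAt ℝ g x) (v : RV (2 * n)) :
    HasDerivAt (fun t : ℝ => g (x + t • v)) (fderiv ℝ g x v) 0 := by
  have h1 : HasFDerivAt g (fderiv ℝ g x) (x + (0 : ℝ) • v) := by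
    simpa using hg.hasFDerivAt
  exact h1.comp_hasDerivAt (0 : ℝ) (hasDerivAt_add_smul x v)

lemma hasDerivAt_flow_form (hf : OrbSmooth O f) (i : O.ι) {x : RV (2 * n)} (hx : x ∈ O.V i)
    (u v : RV (2 * n)) :
    HasDerivAt (fun t : ℝ => flat (Ω.form i (x + t • hamVF Ω f i x))
      (flowT (fderiv ℝ (hamVF Ω f i) x) t u) (flowT (fderiv ℝ (hamVF Ω f i) x) t v)) 0 0 := by
  have hd := ContDiffOn.differentiableAt' (O.isOpen_V i) (contDiffOn_flat (Ω.smooth i)) hx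
  have h := ((hasDerivAt_comp_add_smul hd (hamVF Ω f i x)).clm_apply
    (hasDerivAt_add_smul u (fderiv ℝ (hamVF Ω f i) x u))).clm_apply
    (hasDerivAt_add_smul v (fderiv ℝ (hamVF Ω f i) x v))
  refine h.congr_deriv ?_
  have h2 := lie_hamVF_form Ω hf i hx u v
  simp only [← flat_apply] at h2
  simp only [zero_smul, add_zero, _root_.add_apply]
  exact h2

/-- Liouville's theorem. The first-order flow leaves the matrix of `Ω` stationary, hence also
`det(flowT)²` times its determinant `d`; differentiating gives `d' + 2 tr(DX) d = 0`, and the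
density is `√d`. -/
lemma fderiv_liouvilleDensity (hf : OrbSmooth O f) (i : O.ι) {x : RV (2 * n)} (hx : x ∈ O.V i) :
    fderiv ℝ (liouvilleDensity Ω i) x (hamVF Ω f i x) +
      (endMatrix (fderiv ℝ (hamVF Ω f i) x)).trace * liouvilleDensity Ω i x = 0 := by
  set D := fderiv ℝ (hamVF Ω f i) x with hD
  set d : RV (2 * n) → ℝ := fun y => (bilinMatrix (flat (Ω.form i y))).det with hd
  have hdd : DifferentiableAt ℝ d x := ContDiffOn.differentiableAt' (O.isOpen_V i)
    (contDiffOn_det (contDiffOn_bilinMatrix_flat Ω i)) hx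
  have hpos : 0 < d x := det_form_pos Ω i hx
  have h1 : HasDerivAt (fun t : ℝ => (flowT D t).det ^ 2 * d (x + t • hamVF Ω f i x)) 0 0 := by
    have h2 := hasDerivAt_det_zero (A := fun t : ℝ => Matrix.of fun a b =>
      flat (Ω.form i (x + t • hamVF Ω f i x)) (flowT D t (Pi.single a 1))
        (flowT D t (Pi.single b 1))) (t := 0) (fun a b => hasDerivAt_flow_form Ω hf i hx _ _)
    refine h2.congr_of_eventuallyEq (Filter.Eventually.of_forall fun t => ?_)
    simp only [matrix_bilin_comp, Matrix.det_mul, Matrix.det_transpose, det_endMatrix, hd]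
    ring
  have h2 := (((hasDerivAt_det_flowT D).fun_pow 2).fun_mul
    (hasDerivAt_comp_add_smul hdd (hamVF Ω f i x))).unique h1
  simp only [det_flowT_zero, zero_smul, add_zero] at h2
  have h3 : fderiv ℝ (liouvilleDensity Ω i) x = _ := (hdd.hasFDerivAt.sqrt hpos.ne').fderiv
  rw [h3, liouvilleDensity_eq, _root_.smul_apply, smul_eq_mul]
  change _ + _ * √(d x) = 0
  have h4 : √(d x) ≠ 0 := (Real.sqrt_pos.2 hpos).ne'
  have h5 := Real.sq_sqrt hpos.le
  field_simp
  rw [h5]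
  push_cast at h2
  linarith

end Liouville

/-! ## Kähler geometry of quantizable flows -/

section Kahler

variable {X : Type*} [TopologicalSpace X] {n : ℕ} {O : Orbifold X (2 * n)} {Ω : SymplecticForm O}
  {P : Polarization Ω} {hbar : ℝ} {f : X → ℝ}

/-- The Kähler metric as a bilinear form. -/
noncomputable def KahlerStructure.bilin (K : KahlerStructure P) (i : O.ι) (x : RV (2 * n)) :
    RV (2 * n) →L[ℝ] RV (2 * n) →L[ℝ] ℝ :=
  ((flat (Ω.form i x)).flip.comp (K.J i x)).flip

lemma KahlerStructure.bilin_apply (K : KahlerStructure P) (i : O.ι) (x u v : RV (2 * n)) :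
    K.bilin i x u v = flat (Ω.form i x) u (K.J i x v) := rfl

lemma KahlerStructure.metric_eq (K : KahlerStructure P) (i : O.ι) (x : RV (2 * n)) :
    K.metric i x = bilinMatrix (K.bilin i x) := rfl

/-- Symmetry comes from `Ω(u, Jv) = Ω(Ju, JJv) = -Ω(Ju, v) = Ω(v, Ju)`. -/
lemma KahlerStructure.metric_posDef (K : KahlerStructure P) (i : O.ι) {x : RV (2 * n)}
    (hx : x ∈ O.V i) : (K.metric i x).PosDef := by
  refine Matrix.PosDef.of_dotProduct_mulVec_pos ?_ fun u hu => ?_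
  · ext a b
    simp only [Matrix.conjTranspose_apply, KahlerStructure.metric, Matrix.of_apply, star_trivial]
    rw [← K.type_one_one i x hx, K.J_J i x hx, form2_swap (Ω.form i x)]
    have h := form2_smul_left (Ω.form i x) (-1) (Pi.single a 1) (K.J i x (Pi.single b 1))
    simp only [neg_smul, one_smul, neg_mul, one_mul] at h
    rw [h, neg_neg]
  · have h := K.positive i x hx u hu
    rw [← flat_apply, ← K.bilin_apply, bilin_eq_sum, ← K.metric_eq] at h
    simpa only [star_trivial, dotProduct, Matrix.mulVec, Finset.mul_sum, mul_assoc] using h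

lemma contDiffOn_metric (K : KahlerStructure P) (i : O.ι) (a b : Fin (2 * n)) :
    ContDiffOn ℝ ∞ (fun y => K.metric i y a b) (O.V i) :=
  ((contDiffOn_flat (Ω.smooth i)).clm_apply contDiffOn_const).clm_apply
    ((K.smooth i).clm_apply contDiffOn_const)

/-- The squared norm of the `n`-form of a half-form frame. -/
noncomputable def KahlerStructure.normSq (K : KahlerStructure P) (δ : HalfFormBundle P) (i : O.ι)
    (x : RV (2 * n)) : ℝ :=
  ((n.factorial : ℂ)⁻¹ * formSum (K.metric i x)⁻¹ (formCoeff (δ.μ i x))).re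

lemma KahlerStructure.formNorm_eq (K : KahlerStructure P) (δ : HalfFormBundle P) (i : O.ι)
    (x : RV (2 * n)) : K.formNorm i x (δ.μ i x) = √(K.normSq δ i x) := rfl

lemma KahlerStructure.normSq_pos (K : KahlerStructure P) (δ : HalfFormBundle P) (i : O.ι)
    {x : RV (2 * n)} (hx : x ∈ O.V i) : 0 < K.normSq δ i x := by
  obtain ⟨r, hr, h⟩ := formSum_pos (K.metric_posDef i hx) (δ.μ_ne_zero i x hx)
  rw [KahlerStructure.normSq, h]
  have : ((n.factorial : ℂ)⁻¹ * (r : ℂ)).re = (n.factorial : ℝ)⁻¹ * r := by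
    rw [show ((n.factorial : ℂ)⁻¹ * (r : ℂ)) = (((n.factorial : ℝ)⁻¹ * r : ℝ) : ℂ) by push_cast; rfl,
      Complex.ofReal_re]
  rw [this]
  positivity

lemma contDiffOn_normSq (K : KahlerStructure P) (δ : HalfFormBundle P) (i : O.ι) :
    ContDiffOn ℝ ∞ (K.normSq δ i) (O.V i) := by
  refine Complex.reCLM.contDiff.comp_contDiffOn (contDiffOn_const.mul ?_)
  refine ContDiffOn.sum fun a _ => ContDiffOn.sum fun b _ => ContDiffOn.mul (ContDiffOn.mul ?_ ?_) ?_
  · exact contDiffOn_ofReal (contDiffOn_prod fun k _ =>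
      contDiffOn_inv_apply (contDiffOn_metric K i)
        (fun y hy => (K.metric_posDef i hy).det_pos.ne') _ _)
  · exact δ.μ_smooth i _
  · exact contDiffOn_conj (δ.μ_smooth i _)

/-- This says `L_X J = 0`. For constant real `u` the field `u + iJu` is a section of `T^{0,1}`, so
by quantizability its bracket with `X` is one as well; the real part of the condition for membership
in `T^{0,1}` is the asserted identity. -/
lemma KahlerStructure.fderiv_J (K : KahlerStructure P) (hf : OrbSmooth O f) (hq : Quantizable P f)
    (i : O.ι) {x : RV (2 * n)} (hx : x ∈ O.V i) (u : RV (2 * n)) :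
    fderiv ℝ (K.J i) x (hamVF Ω f i x) u =
      fderiv ℝ (hamVF Ω f i) x (K.J i x u) - K.J i x (fderiv ℝ (hamVF Ω f i) x u) := by
  have hJu : ContDiffOn ℝ ∞ (fun y => K.J i y u) (O.V i) :=
    (K.smooth i).clm_apply contDiffOn_const
  have hXd := ContDiffOn.differentiableAt' (O.isOpen_V i) (contDiffOn_hamVF Ω hf i) hx
  have hJd := ContDiffOn.differentiableAt' (O.isOpen_V i) (K.smooth i) hx
  have hJud := ContDiffOn.differentiableAt' (O.isOpen_V i) hJu hx
  have hsec : IsSmoothSection (P.P i) (O.V i)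
      (fun y => toC u + Complex.I • toC (K.J i y u)) := by
    refine ⟨contDiffOn_const.add ((contDiff_toC.comp_contDiffOn hJu).const_smul Complex.I),
      fun y hy => ?_⟩
    rw [K.mem_iff i y hy, extC_eq]
    have h1 : reV (toC u + Complex.I • toC (K.J i y u)) = u := by
      ext a; simp [reV, toC]
    have h2 : imV (toC u + Complex.I • toC (K.J i y u)) = K.J i y u := by
      ext a; simp [imV, toC]
    rw [h1, h2, K.J_J i y hy, toC_neg]
    ext a
    simp only [Pi.add_apply, Pi.smul_apply, Pi.neg_apply, smul_eq_mul]
    linear_combination (norm := (ring_nf; simp only [Complex.I_sq]; ring_nf))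
  have h := hq i (O.V i) subset_rfl (O.isOpen_V i) _ hsec x hx
  rw [K.mem_iff i x hx] at h
  have hb : cbracket (fun y => toC (hamVF Ω f i y)) (fun y => toC u + Complex.I • toC (K.J i y u)) x
      = toC (-fderiv ℝ (hamVF Ω f i) x u) + Complex.I • toC (fderiv ℝ (K.J i) x (hamVF Ω f i x) u -
        fderiv ℝ (hamVF Ω f i) x (K.J i x u)) := by
    have e1 : cderiv (fun y => toC u + Complex.I • toC (K.J i y u)) x (toC (hamVF Ω f i x)) =
        Complex.I • toC (fderiv ℝ (K.J i) x (hamVF Ω f i x) u) := by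
      rw [cderiv_toC, fderiv_const_add]
      have hd : DifferentiableAt ℝ (fun y => toC (K.J i y u)) x :=
        (contDiff_toC (N := 1)).differentiable (by simp) |>.differentiableAt.comp x hJud
      have e2 : fderiv ℝ (fun y => K.J i y u) x (hamVF Ω f i x) =
          fderiv ℝ (K.J i) x (hamVF Ω f i x) u := by
        rw [fderiv_clm_apply hJd (differentiableAt_const u)]
        simp
      rw [← e2, ← cderiv_toC_comp hJud, fderiv_fun_const_smul hd]
      rfl
    rw [cbracket, e1, cderiv_add_right, cderiv_smul_right, cderiv_toC, cderiv_toC,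
      cderiv_toC_comp hXd, cderiv_toC_comp hXd, toC_neg, sub_eq_add_neg (fderiv ℝ (K.J i) x _ u),
      toC_add, toC_neg]
    module
  rw [hb, extC_eq] at h
  set p := fderiv ℝ (hamVF Ω f i) x u
  set q := fderiv ℝ (K.J i) x (hamVF Ω f i x) u - fderiv ℝ (hamVF Ω f i) x (K.J i x u) with hqq
  have h1 : reV (toC (-p) + Complex.I • toC q) = -p := by ext a; simp [reV, toC]
  have h2 : imV (toC (-p) + Complex.I • toC q) = q := by ext a; simp [imV, toC]
  rw [h1, h2] at h
  have h3 := congrArg reV h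
  have h4 : reV (toC (K.J i x (-p)) + Complex.I • toC (K.J i x q)) = K.J i x (-p) := by
    ext a; simp [reV, toC]
  have h5 : reV (-Complex.I • (toC (-p) + Complex.I • toC q)) = q := by
    ext a; simp [reV, toC]
  rw [h4, h5, map_neg] at h3
  have h6 := eq_sub_iff_add_eq.1 (h3.trans hqq)
  rw [← h6]
  abel

/-- The metric is built from `Ω` and `J`, both of which are preserved to first order. -/
lemma hasDerivAt_flow_metric (K : KahlerStructure P) (hf : OrbSmooth O f) (hq : Quantizable P f)
    (i : O.ι) {x : RV (2 * n)} (hx : x ∈ O.V i) (u v : RV (2 * n)) :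
    HasDerivAt (fun t : ℝ => K.bilin i (x + t • hamVF Ω f i x)
      (flowT (fderiv ℝ (hamVF Ω f i) x) t u) (flowT (fderiv ℝ (hamVF Ω f i) x) t v)) 0 0 := by
  have hd := ContDiffOn.differentiableAt' (O.isOpen_V i) (contDiffOn_flat (Ω.smooth i)) hx
  have hJd := ContDiffOn.differentiableAt' (O.isOpen_V i) (K.smooth i) hx
  have h := ((hasDerivAt_comp_add_smul hd (hamVF Ω f i x)).clm_apply
    (hasDerivAt_add_smul u (fderiv ℝ (hamVF Ω f i) x u))).clm_apply
    ((hasDerivAt_comp_add_smul hJd (hamVF Ω f i x)).clm_apply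
    (hasDerivAt_add_smul v (fderiv ℝ (hamVF Ω f i) x v)))
  refine h.congr_deriv ?_
  have h2 := lie_hamVF_form Ω hf i hx u (K.J i x v)
  simp only [← flat_apply] at h2
  simp only [zero_smul, add_zero, K.fderiv_J hf hq i hx, sub_add_cancel, _root_.add_apply]
  exact h2

/-- By invariance of the norm, `normSq` along the line `x + tX` can be computed from the pulled-back
metric and the pulled-back form. The former is stationary and the latter changes at the rate `div_P
X`, which gives twice its real part. -/
lemma fderiv_normSq (K : KahlerStructure P) (δ : HalfFormBundle P) (hf : OrbSmooth O f)
    (hq : Quantizable P f) (i : O.ι) {x : RV (2 * n)} (hx : x ∈ O.V i) :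
    fderiv ℝ (K.normSq δ i) x (hamVF Ω f i x) = 2 * (divP δ f i x).re * K.normSq δ i x := by
  set D := fderiv ℝ (hamVF Ω f i) x with hD
  have hx0 : x + (0 : ℝ) • hamVF Ω f i x = x := by simp
  have hdet : (Matrix.of fun a b => K.bilin i (x + (0 : ℝ) • hamVF Ω f i x)
      (flowT D 0 (Pi.single a 1)) (flowT D 0 (Pi.single b 1))).det ≠ 0 := by
    rw [matrix_bilin_comp, Matrix.det_mul, Matrix.det_mul, Matrix.det_transpose,
      det_endMatrix, det_flowT_zero, hx0, ← K.metric_eq]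
    simpa using (K.metric_posDef i hx).det_pos.ne'
  have h1 := hasDerivAt_formSum (t := 0) (D := divP δ f i x)
    (H := fun t : ℝ => (Matrix.of fun a b => K.bilin i (x + t • hamVF Ω f i x)
      (flowT D t (Pi.single a 1)) (flowT D t (Pi.single b 1)))⁻¹)
    (c := fun t a => δ.μ i (x + t • hamVF Ω f i x)
      (fun k => extC (flowT D t) (Pi.single (a k) 1)))
    (fun a b => hasDerivAt_inv_apply_zero
      (fun a b => hasDerivAt_flow_metric K hf hq i hx _ _) hdet a b)
    (fun a => by
      have h := δ.hasDerivAt_flow subset_rfl (O.isOpen_V i) (contDiffOn_hamVF Ω hf i)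
        (hq.preservesSections i) hx (fun k => Pi.single (a k) 1)
      simp only [← toC_single, extC_toC]
      refine h.congr_deriv ?_
      simp only [flowT_apply, zero_smul, add_zero]
      rfl)
  -- `formSum_extC` requires an invertible endomorphism, which `flowT D t` is for small `t`.
  have hev : ∀ᶠ t : ℝ in nhds 0, (flowT D t).det ≠ 0 :=
    (hasDerivAt_det_flowT D).continuousAt.eventually_ne (by simp [det_flowT_zero])
  have h2 : HasDerivAt (fun t : ℝ => K.normSq δ i (x + t • hamVF Ω f i x))
      (2 * (divP δ f i x).re * K.normSq δ i x) 0 := by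
    have h3 := (Complex.reCLM.hasFDerivAt.comp_hasDerivAt (0 : ℝ)
      (h1.const_mul (n.factorial : ℂ)⁻¹))
    refine (h3.congr_of_eventuallyEq ?_).congr_deriv ?_
    · filter_upwards [hev] with t ht
      simp only [Function.comp, formSum_extC _ ht]
      rfl
    · rw [formSum_extC _ (by simp [det_flowT_zero]), hx0, mul_left_comm, Complex.reCLM_apply,
        Complex.re_ofReal_mul]
      rfl
  exact (hasDerivAt_comp_add_smul (ContDiffOn.differentiableAt' (O.isOpen_V i)
    (contDiffOn_normSq K δ i) hx) _).unique h2

/-- The norm is invariant under pullback, and the factor `t²` between the frames contributes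
`|t²|²`. -/
lemma normSq_naturality (K : KahlerStructure P) (δ : HalfFormBundle P) {i j : O.ι}
    (φ : ChartEmb O.toOrbifoldCharts i j) {x : RV (2 * n)} (hx : x ∈ O.V i) :
    K.normSq δ i x = (‖δ.trans φ x‖ ^ 2) ^ 2 * K.normSq δ j (φ x) := by
  have hdet : (fderiv ℝ φ x).det ≠ 0 := by
    have h := (LinearEquiv.ofBijective (fderiv ℝ φ x).toLinearMap
      (φ.bijective_fderiv x hx)).isUnit_det'
    exact h.ne_zero
  have h1 : K.metric i x = Matrix.of fun a b => K.bilin j (φ x) (fderiv ℝ φ x (Pi.single a 1))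
      (fderiv ℝ φ x (Pi.single b 1)) := by
    ext a b
    simp only [KahlerStructure.metric, Matrix.of_apply, K.bilin_apply, K.compatible i j φ x hx,
      flat_apply, Ω.invariant i j φ x hx]
  have h2 : formCoeff (δ.μ i x) = fun a => δ.trans φ x ^ 2 *
      δ.μ j (φ x) (fun k => extC (fderiv ℝ φ x) (Pi.single (a k) 1)) :=
    funext fun a => δ.μ_compatible φ x hx _
  rw [KahlerStructure.normSq, h1, h2, formSum_smul, formSum_extC _ hdet, mul_left_comm,
    Complex.re_ofReal_mul, norm_pow]
  rfl

lemma contDiffOn_formNorm (K : KahlerStructure P) (δ : HalfFormBundle P) (i : O.ι) :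
    ContDiffOn ℝ ∞ (fun x => K.formNorm i x (δ.μ i x)) (O.V i) :=
  (contDiffOn_normSq K δ i).sqrt fun _ hx => (K.normSq_pos δ i hx).ne'

lemma formNorm_naturality (K : KahlerStructure P) (δ : HalfFormBundle P) {i j : O.ι}
    (φ : ChartEmb O.toOrbifoldCharts i j) {x : RV (2 * n)} (hx : x ∈ O.V i) :
    K.formNorm i x (δ.μ i x) =
      ‖δ.trans φ x‖ ^ 2 * K.formNorm j (φ x) (δ.μ j (φ x)) := by
  rw [K.formNorm_eq, K.formNorm_eq, normSq_naturality K δ φ hx, Real.sqrt_mul (sq_nonneg _),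
    Real.sqrt_sq (sq_nonneg _)]

lemma fderiv_formNorm (K : KahlerStructure P) (δ : HalfFormBundle P) (hf : OrbSmooth O f)
    (hq : Quantizable P f) (i : O.ι) {x : RV (2 * n)} (hx : x ∈ O.V i) :
    fderiv ℝ (fun y => K.formNorm i y (δ.μ i y)) x (hamVF Ω f i x) =
      (divP δ f i x).re * K.formNorm i x (δ.μ i x) := by
  have hpos := K.normSq_pos δ i hx
  have hd := ContDiffOn.differentiableAt' (O.isOpen_V i) (contDiffOn_normSq K δ i) hx
  have h3 : fderiv ℝ (fun y => K.formNorm i y (δ.μ i y)) x = _ :=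
    (hd.hasFDerivAt.sqrt hpos.ne').fderiv
  rw [h3, K.formNorm_eq, _root_.smul_apply, fderiv_normSq K δ hf hq i hx, smul_eq_mul]
  have h4 : √(K.normSq δ i x) ≠ 0 := (Real.sqrt_pos.2 hpos).ne'
  have h5 := Real.sq_sqrt hpos.le
  field_simp
  rw [h5]
  ring

/-! ### The pointwise pairing in the Kähler case. -/

/-- The fibre inner product of two sections of `L ⊗ δ_P`. -/
noncomputable def KahlerStructure.pair (K : KahlerStructure P) (δ : HalfFormBundle P)
    (s t : O.ι → RV (2 * n) → ℂ) (i : O.ι) (x : RV (2 * n)) : ℂ :=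
  (starRingEnd ℂ) (s i x) * t i x * (K.formNorm i x (δ.μ i x) : ℂ)

lemma contDiffOn_pair (K : KahlerStructure P) {L : PrequantumBundle Ω hbar}
    {δ : HalfFormBundle P} {s t : O.ι → RV (2 * n) → ℂ} (hs : IsSection L δ s)
    (ht : IsSection L δ t) (i : O.ι) : ContDiffOn ℝ ∞ (K.pair δ s t i) (O.V i) :=
  ((contDiffOn_conj (hs.smooth i)).mul (ht.smooth i)).mul
    (contDiffOn_ofReal (contDiffOn_formNorm K δ i))

lemma pair_naturality (K : KahlerStructure P) {L : PrequantumBundle Ω hbar}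
    {δ : HalfFormBundle P} {s t : O.ι → RV (2 * n) → ℂ} (hs : IsSection L δ s)
    (ht : IsSection L δ t) (i j : O.ι) (φ : ChartEmb O.toOrbifoldCharts i j) (x : RV (2 * n))
    (hx : x ∈ O.V i) : K.pair δ s t j (φ x) = K.pair δ s t i x := by
  simp only [KahlerStructure.pair]
  rw [hs.compatible i j φ x hx, ht.compatible i j φ x hx, formNorm_naturality K δ φ hx]
  have h1 : (starRingEnd ℂ) (L.trans φ x) * L.trans φ x = 1 := by
    rw [mul_comm, Complex.mul_conj, Complex.normSq_eq_norm_sq, L.unitary φ x hx]; simp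
  have h2 : (starRingEnd ℂ) (δ.trans φ x) * δ.trans φ x = ((‖δ.trans φ x‖ ^ 2 : ℝ) : ℂ) := by
    rw [mul_comm, Complex.mul_conj, Complex.normSq_eq_norm_sq]
  rw [Complex.ofReal_mul, ← h2]
  simp only [map_mul]
  linear_combination ((starRingEnd ℂ) (δ.trans φ x) * δ.trans φ x * (starRingEnd ℂ) (s i x) *
    t i x * (K.formNorm j (φ x) (δ.μ j (φ x)) : ℂ)) * h1

/-- The term with `Re(div_P X)` in `conj_Qmeta_mul_sub` is exactly the derivative of the norm of
`μ`, so the defect is a total derivative of the fibre inner product. -/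
lemma pair_Qmeta_sub (K : KahlerStructure P) {L : PrequantumBundle Ω hbar}
    {δ : HalfFormBundle P} (hf : OrbSmooth O f) (hq : Quantizable P f)
    {s t : O.ι → RV (2 * n) → ℂ} (hs : IsSection L δ s)
    (ht : IsSection L δ t) {i : O.ι} {x : RV (2 * n)} (hx : x ∈ O.V i) :
    K.pair δ (Qmeta L δ f s) t i x - K.pair δ s (Qmeta L δ f t) i x =
      Complex.I * hbar * fderiv ℝ (K.pair δ s t i) x (hamVF Ω f i x) := by
  have hsd := ContDiffOn.differentiableAt' (O.isOpen_V i) (hs.smooth i) hx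
  have htd := ContDiffOn.differentiableAt' (O.isOpen_V i) (ht.smooth i) hx
  have hNd := ContDiffOn.differentiableAt' (O.isOpen_V i) (contDiffOn_formNorm K δ i) hx
  have h1 := conj_Qmeta_mul_sub L δ f hsd htd
  have hN : HasFDerivAt (fun y => (K.formNorm i y (δ.μ i y) : ℂ)) _ x :=
    Complex.ofRealCLM.hasFDerivAt.comp x hNd.hasFDerivAt
  have h2 : fderiv ℝ (K.pair δ s t i) x = _ :=
    ((((differentiableAt_conj hsd).fun_mul htd).hasFDerivAt).fun_mul hN).fderiv
  rw [h2]
  simp only [_root_.add_apply, _root_.smul_apply, ContinuousLinearMap.comp_apply,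
    fderiv_formNorm K δ hf hq i hx, smul_eq_mul, Complex.ofRealCLM_apply, Complex.ofReal_mul]
  simp only [KahlerStructure.pair]
  linear_combination (K.formNorm i x (δ.μ i x) : ℂ) * h1

end Kahler

end GeomQuant

namespace GeomQuant

/-! ## Local groups and chart embeddings -/

section OrbifoldGeometry

variable {X : Type*} [TopologicalSpace X] {m : ℕ}

/-- Composition of chart embeddings. -/
def ChartEmb.comp {O : OrbifoldCharts X m} {i j k : O.ι} (ψ : ChartEmb O j k)
    (φ : ChartEmb O i j) : ChartEmb O i k where
  toFun x := ψ (φ x)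
  hom := ψ.hom.comp φ.hom
  hom_injective := ψ.hom_injective.comp φ.hom_injective
  mapsTo x hx := ψ.mapsTo (φ.mapsTo hx)
  smooth := ψ.smooth.comp φ.smooth φ.mapsTo
  injOn x hx y hy h := φ.injOn hx hy (ψ.injOn (φ.mapsTo hx) (φ.mapsTo hy) h)
  bijective_fderiv x hx := by
    have h := fderiv_comp x (ψ.differentiableAt (φ.mapsTo hx)) (φ.differentiableAt hx)
    change Function.Bijective (fderiv ℝ (ψ.toFun ∘ φ.toFun) x)
    rw [h]
    exact (ψ.bijective_fderiv _ (φ.mapsTo hx)).comp (φ.bijective_fderiv x hx)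
  equivariant g x hx := by
    rw [φ.equivariant g x hx, ψ.equivariant _ _ (φ.mapsTo hx)]
    rfl
  π_comp x hx := by rw [ψ.π_comp _ (φ.mapsTo hx), φ.π_comp x hx]

lemma act_inv_act (O : OrbifoldCharts X m) (i : O.ι) (g : O.G i) {x : RV m} (hx : x ∈ O.V i) :
    O.act i g⁻¹ (O.act i g x) = x := by
  rw [← O.act_mul i _ _ x hx, inv_mul_cancel, O.act_one i x hx]

lemma π_act (O : OrbifoldCharts X m) (i : O.ι) (g : O.G i) {x : RV m} (hx : x ∈ O.V i) :
    O.π i (O.act i g x) = O.π i x := (ChartEmb.ofGroup O i g).π_comp x hx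

lemma ChartEmb.exists_fderivEquiv {O : OrbifoldCharts X m} {i j : O.ι} (φ : ChartEmb O i j)
    {x : RV m} (hx : x ∈ O.V i) :
    ∃ e : RV m ≃L[ℝ] RV m, HasFDerivAt φ (e : RV m →L[ℝ] RV m) x := by
  refine ⟨(LinearEquiv.ofBijective (fderiv ℝ φ x).toLinearMap
    (φ.bijective_fderiv x hx)).toContinuousLinearEquiv, ?_⟩
  convert (φ.differentiableAt hx).hasFDerivAt using 1
  ext v
  rfl

lemma ChartEmb.contDiffAt {O : OrbifoldCharts X m} {i j : O.ι} (φ : ChartEmb O i j)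
    {x : RV m} (hx : x ∈ O.V i) : ContDiffAt ℝ ∞ φ x :=
  φ.smooth.contDiffAt ((O.isOpen_V i).mem_nhds hx)

lemma ChartEmb.isOpen_image {O : OrbifoldCharts X m} {i j : O.ι} (φ : ChartEmb O i j)
    {W : Set (RV m)} (hW : W ⊆ O.V i) (hWo : IsOpen W) : IsOpen (φ '' W) := by
  rw [isOpen_iff_mem_nhds]
  rintro _ ⟨x, hx, rfl⟩
  obtain ⟨e, he⟩ := φ.exists_fderivEquiv (hW hx)
  have h := ((φ.contDiffAt (hW hx)).hasStrictFDerivAt' he (by simp)).map_nhds_eq_of_equiv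
  rw [← h]
  exact Filter.image_mem_map (hWo.mem_nhds hx)

/-- Two points of charts over the same point of `X` come from a point of a common smaller chart. -/
lemma exists_common_chart (O : Orbifold X m) {i j : O.ι} {x y : RV m} (hx : x ∈ O.V i)
    (hy : y ∈ O.V j) (h : O.π i x = O.π j y) :
    ∃ k, ∃ z ∈ O.V k, ∃ (φ : ChartEmb O.toOrbifoldCharts k i)
      (ψ : ChartEmb O.toOrbifoldCharts k j), φ z = x ∧ ψ z = y := by
  obtain ⟨k, ⟨z, hz, hzp⟩, ⟨φ⟩, ⟨ψ⟩⟩ := O.compatible i j (O.π i x)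
    ⟨⟨x, hx, rfl⟩, ⟨y, hy, h.symm⟩⟩
  obtain ⟨g, hg⟩ := (O.π_fiber i _ (φ.mapsTo hz) x hx).1 (by rw [φ.π_comp z hz, hzp])
  obtain ⟨g', hg'⟩ := (O.π_fiber j _ (ψ.mapsTo hz) y hy).1 (by rw [ψ.π_comp z hz, hzp, h])
  exact ⟨k, z, hz, (ChartEmb.ofGroup O.toOrbifoldCharts i g).comp φ,
    (ChartEmb.ofGroup O.toOrbifoldCharts j g').comp ψ, hg, hg'⟩

/-- Both lifts are compared through a common smaller chart, whose embedding into the second chart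
has a smooth local inverse. -/
lemma contDiffAt_of_chart {F : Type*} [NormedAddCommGroup F] [NormedSpace ℝ F] (O : Orbifold X m)
    {u : X → F} {i j : O.ι} {x y : RV m} (hx : x ∈ O.V i) (hy : y ∈ O.V j)
    (h : O.π i x = O.π j y) (hu : ContDiffAt ℝ ∞ (fun z => u (O.π i z)) x) :
    ContDiffAt ℝ ∞ (fun z => u (O.π j z)) y := by
  obtain ⟨k, z, hz, φ, ψ, rfl, rfl⟩ := exists_common_chart O hx hy h
  have h1 : ContDiffAt ℝ ∞ (fun z => u (O.π k z)) z := by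
    have h2 : ContDiffAt ℝ ∞ (fun z => u (O.π i (φ z))) z := hu.comp z (φ.contDiffAt hz)
    refine h2.congr_of_eventuallyEq ?_
    filter_upwards [(O.isOpen_V k).mem_nhds hz] with w hw
    rw [φ.π_comp w hw]
  obtain ⟨e, he⟩ := ψ.exists_fderivEquiv hz
  have hs : HasStrictFDerivAt ψ (e : RV m →L[ℝ] RV m) z :=
    (ψ.contDiffAt hz).hasStrictFDerivAt' he (by simp)
  have hinv := (ψ.contDiffAt hz).to_localInverse he (by simp)
  have h3 : ContDiffAt ℝ ∞ (fun w => u (O.π k ((ψ.contDiffAt hz).localInverse he (by simp) w)))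
      (ψ z) := by
    refine ContDiffAt.comp (ψ z) (g := fun w => u (O.π k w)) ?_ hinv
    rw [ContDiffAt.localInverse_apply_image]
    exact h1
  refine h3.congr_of_eventuallyEq ?_
  have h4 := hs.eventually_right_inverse
  have h5 : ∀ᶠ w in nhds (ψ z), (ψ.contDiffAt hz).localInverse he (by simp) w ∈ O.V k := by
    refine hinv.continuousAt.eventually_mem ?_
    rw [ContDiffAt.localInverse_apply_image]
    exact (O.isOpen_V k).mem_nhds hz
  filter_upwards [h4, h5] with w hw hw'
  rw [← ψ.π_comp _ hw']
  congr 2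
  exact hw.symm

/-! ### Fixed points -/

/-- All powers of `g` fix the open set `A` pointwise, so by continuity they fix `x` and have
identity derivative there. The average `r` of the powers also has identity derivative at `x`, hence
is injective near `x`; since `r ∘ g = r`, the element `g` fixes all nearby points. -/
lemma act_fixed_nhds (O : OrbifoldCharts X m) (i : O.ι) (g : O.G i) {A : Set (RV m)}
    (hA : A ⊆ O.V i) (hAo : IsOpen A) (hfix : ∀ y ∈ A, O.act i g y = y) {x : RV m}
    (hx : x ∈ O.V i) (hxA : x ∈ closure A) : ∀ᶠ y in nhds x, O.act i g y = y := by
  have hV := O.isOpen_V i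
  have hpow : ∀ k : ℕ, ∀ y ∈ A, O.act i (g ^ k) y = y := by
    intro k y hy
    induction k with
    | zero => rw [pow_zero, O.act_one i y (hA hy)]
    | succ k ih => rw [pow_succ, O.act_mul i _ _ y (hA hy), hfix y hy, ih]
  have hcl : ∀ {Z : Type} [TopologicalSpace Z] [T2Space Z] (F G : RV m → Z),
      ContinuousOn F (O.V i) → ContinuousOn G (O.V i) → (∀ y ∈ A, F y = G y) → F x = G x := by
    intro Z _ _ F G hF hG h
    have hne : (nhdsWithin x A).NeBot := mem_closure_iff_nhdsWithin_neBot.1 hxA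
    have h1 := ((hF x hx).mono hA).tendsto
    have h2 := ((hG x hx).mono hA).tendsto
    refine tendsto_nhds_unique h1 (h2.congr' ?_)
    filter_upwards [self_mem_nhdsWithin] with y hy using (h y hy).symm
  have hfx : O.act i g x = x := hcl _ _ (O.act_smooth i g).continuousOn continuousOn_id hfix
  have hDx : ∀ k : ℕ, fderiv ℝ (O.act i (g ^ k)) x = ContinuousLinearMap.id ℝ (RV m) := by
    intro k
    refine hcl (fun y => fderiv ℝ (O.act i (g ^ k)) y) (fun _ => ContinuousLinearMap.id ℝ (RV m))
      ((O.act_smooth i _).continuousOn_fderiv_of_isOpen hV (by simp)) continuousOn_const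
      fun y hy => ?_
    rw [← fderiv_id (x := y)]
    apply Filter.EventuallyEq.fderiv_eq
    filter_upwards [hAo.mem_nhds hy] with z hz using hpow k z hz
  set N := orderOf g with hN
  have hNpos : 0 < N := orderOf_pos g
  set r : RV m → RV m := fun y => (N : ℝ)⁻¹ • ∑ k ∈ Finset.range N, O.act i (g ^ k) y with hr
  have hrg : ∀ y ∈ O.V i, r (O.act i g y) = r y := by
    intro y hy
    simp only [hr]
    congr 1
    -- The sums of `g^k y` over `k = 1, …, N` and over `k = 0, …, N - 1` agree because `g^N = 1`.
    have h1 := Finset.sum_range_succ (fun k => O.act i (g ^ k) y) N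
    rw [Finset.sum_range_succ', hN, pow_orderOf_eq_one, pow_zero] at h1
    rw [← add_right_cancel h1]
    refine Finset.sum_congr rfl fun k _ => ?_
    rw [pow_succ, O.act_mul i _ _ y hy]
  have hrs : ContDiffAt ℝ ∞ r x := by
    have h1 : ContDiffAt ℝ ∞ (fun y => ∑ k ∈ Finset.range N, O.act i (g ^ k) y) x :=
      ContDiffAt.sum fun k _ => (O.act_smooth i _).contDiffAt (hV.mem_nhds hx)
    exact h1.const_smul (N : ℝ)⁻¹
  have hrd : HasFDerivAt r ((ContinuousLinearEquiv.refl ℝ (RV m) : RV m ≃L[ℝ] RV m) :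
      RV m →L[ℝ] RV m) x := by
    have h1 : HasFDerivAt (fun y => ∑ k ∈ Finset.range N, O.act i (g ^ k) y)
        (∑ k ∈ Finset.range N, fderiv ℝ (O.act i (g ^ k)) x) x :=
      HasFDerivAt.fun_sum fun k _ => (ContDiffOn.differentiableAt' hV
        (O.act_smooth i _) hx).hasFDerivAt
    refine (h1.const_smul (N : ℝ)⁻¹).congr_fderiv ?_
    simp only [hDx, Finset.sum_const, Finset.card_range]
    ext v a
    simp [hNpos.ne']
  set e := hrs.toOpenPartialHomeomorph r hrd (by simp) with he
  have hes : ∀ᶠ y in nhds x, y ∈ e.source :=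
    e.open_source.mem_nhds (hrs.mem_toOpenPartialHomeomorph_source hrd (by simp))
  have hes' : ∀ᶠ y in nhds x, O.act i g y ∈ e.source := by
    refine (ContDiffOn.differentiableAt' hV (O.act_smooth i g) hx).continuousAt.eventually_mem ?_
    rw [hfx]
    exact hes
  filter_upwards [hes, hes', hV.mem_nhds hx] with y hy hy' hyV
  exact e.injOn hy' hy (hrg y hyV)

/-- Otherwise the interior of the fixed point set is nonempty, and by `act_fixed_nhds` closed in the
connected chart, so `g` acts trivially and effectiveness gives `g = 1`. -/
lemma exists_act_ne (O : OrbifoldCharts X m) (i : O.ι) {g : O.G i} (hg : g ≠ 1) {A : Set (RV m)}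
    (hA : A ⊆ O.V i) (hAo : IsOpen A) (hne : A.Nonempty) : ∃ y ∈ A, O.act i g y ≠ y := by
  by_contra! hcon
  apply hg
  refine O.act_effective i g fun x hx => ?_
  set U := interior {y | y ∈ O.V i ∧ O.act i g y = y} with hU
  have hAU : A ⊆ U := interior_maximal (fun y hy => ⟨hA hy, hcon y hy⟩) hAo
  have h := (O.isConnected_V i).isPreconnected.subset_of_closure_inter_subset isOpen_interior
    (hne.mono fun y hy => ⟨hA hy, hAU hy⟩) (fun y hy => by
      rw [mem_interior_iff_mem_nhds]
      filter_upwards [act_fixed_nhds O i g (A := U) (fun z hz => (interior_subset hz).1)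
        isOpen_interior (fun z hz => (interior_subset hz).2) hy.2 hy.1,
        (O.isOpen_V i).mem_nhds hy.2] with z hz hz' using ⟨hz', hz⟩)
  exact (interior_subset (h hx)).2

/-- Points with trivial stabilizer are dense. -/
lemma exists_free_point (O : OrbifoldCharts X m) (i : O.ι) {A : Set (RV m)}
    (hA : A ⊆ O.V i) (hAo : IsOpen A) (hne : A.Nonempty) :
    ∃ y ∈ A, ∀ g, O.act i g y = y → g = 1 := by
  classical
  have key : ∀ s : Finset (O.G i), ∃ B ⊆ A, IsOpen B ∧ B.Nonempty ∧
      ∀ g ∈ s, ∀ y ∈ B, O.act i g y = y → g = 1 := by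
    intro s
    induction s using Finset.induction_on with
    | empty => exact ⟨A, subset_rfl, hAo, hne, by simp⟩
    | insert g s _ ih =>
      obtain ⟨B, hBA, hBo, hBne, hB⟩ := ih
      by_cases hg : g = 1
      · refine ⟨B, hBA, hBo, hBne, fun g' hg' y hy h => ?_⟩
        rcases Finset.mem_insert.1 hg' with rfl | h'
        · exact hg
        · exact hB g' h' y hy h
      · obtain ⟨y, hy, hne⟩ := exists_act_ne O i hg (hBA.trans hA) hBo hBne
        have hc : ContinuousOn (fun z => (O.act i g z, z)) B :=
          ((O.act_smooth i g).continuousOn.mono (hBA.trans hA)).prodMk continuousOn_id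
        refine ⟨B ∩ (fun z => (O.act i g z, z)) ⁻¹' {q | q.1 ≠ q.2},
          Set.inter_subset_left.trans hBA,
          hc.isOpen_inter_preimage hBo (isOpen_ne_fun continuous_fst continuous_snd),
          ⟨y, hy, hne⟩, fun g' hg' z hz h => ?_⟩
        rcases Finset.mem_insert.1 hg' with rfl | h'
        · exact absurd h hz.2
        · exact hB g' h' z hz.1 h
  have := Fintype.ofFinite (O.G i)
  obtain ⟨B, hBA, -, ⟨y, hy⟩, hB⟩ := key Finset.univ
  exact ⟨y, hBA hy, fun g => hB g (Finset.mem_univ g) y hy⟩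

/-- The open images of `V k` under `φ` and under `g ∘ φ` overlap, so they share a point `z` with
trivial stabilizer. Its preimages `w` and `w'` lie in one orbit of the small group, and freeness at
`z` identifies `g` with the image of the element joining them. -/
lemma ChartEmb.mem_range_hom {O : OrbifoldCharts X m} {k i : O.ι} (φ : ChartEmb O k i)
    {g : O.G i} {y y' : RV m} (hy : y ∈ O.V k) (hy' : y' ∈ O.V k)
    (h : O.act i g (φ y) = φ y') : ∃ a, φ.hom a = g := by
  set ψ := (ChartEmb.ofGroup O i g).comp φ with hψ
  have hopen : IsOpen (ψ '' O.V k ∩ φ '' O.V k) :=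
    (ψ.isOpen_image subset_rfl (O.isOpen_V k)).inter (φ.isOpen_image subset_rfl (O.isOpen_V k))
  obtain ⟨z, ⟨⟨w, hw, hwz⟩, ⟨w', hw', hwz'⟩⟩, hfree⟩ := exists_free_point O i
    (A := ψ '' O.V k ∩ φ '' O.V k)
    (fun z hz => by obtain ⟨w, hw, rfl⟩ := hz.2; exact φ.mapsTo hw) hopen
    ⟨φ y', ⟨y, hy, h⟩, ⟨y', hy', rfl⟩⟩
  obtain ⟨a, ha⟩ := (O.π_fiber k w hw w' hw').1 (by
    rw [← ψ.π_comp w hw, ← φ.π_comp w' hw', hwz, hwz'])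
  have h1 : O.act i g (φ w) = z := hwz
  have h2 : O.act i (φ.hom a) (φ w) = z := by rw [← φ.equivariant a w hw, ha, hwz']
  have hz : φ w = O.act i g⁻¹ z := by rw [← h1, act_inv_act O i g (φ.mapsTo hw)]
  have hzV : z ∈ O.V i := by rw [← hwz']; exact φ.mapsTo hw'
  refine ⟨a, ?_⟩
  have h3 := hfree (φ.hom a * g⁻¹) (by rw [O.act_mul i _ _ z hzV, ← hz, h2])
  exact mul_inv_eq_one.1 h3

/-- Every point over the image of an embedded chart lies in as many translates of that chart as its
group has elements. -/
lemma ChartEmb.ncard_translates {O : OrbifoldCharts X m} {k i : O.ι} (φ : ChartEmb O k i)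
    {z : RV m} (hz : z ∈ O.V i) (hπ : O.π i z ∈ O.π k '' O.V k) :
    {g : O.G i | z ∈ (ChartEmb.ofGroup O i g).comp φ '' O.V k}.ncard = Nat.card (O.G k) := by
  obtain ⟨y, hy, hyz⟩ := hπ
  obtain ⟨g₀, hg₀⟩ := (O.π_fiber i _ (φ.mapsTo hy) z hz).1 (by rw [φ.π_comp y hy, hyz])
  -- The translates through `z` are indexed by the coset `g₀ · φ.hom(G k)`.
  have h : {g : O.G i | z ∈ (ChartEmb.ofGroup O i g).comp φ '' O.V k} =
      Set.range fun a => g₀ * φ.hom a := by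
    ext g
    constructor
    · rintro ⟨w, hw, hwz⟩
      have hwz' : O.act i g (φ w) = z := hwz
      obtain ⟨a, ha⟩ := φ.mem_range_hom (g := g₀⁻¹ * g) hw hy (by
        rw [O.act_mul i _ _ _ (φ.mapsTo hw), hwz', ← hg₀, act_inv_act O i g₀ (φ.mapsTo hy)])
      exact ⟨a, by simp [ha]⟩
    · rintro ⟨a, rfl⟩
      refine ⟨O.act k a⁻¹ y, O.act_mapsTo k _ hy, ?_⟩
      change O.act i (g₀ * φ.hom a) (φ (O.act k a⁻¹ y)) = z
      rw [φ.equivariant _ y hy, ← O.act_mul i _ _ _ (φ.mapsTo hy), map_inv,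
        mul_inv_cancel_right, hg₀]
  have hinj : Function.Injective fun a => g₀ * φ.hom a :=
    (mul_right_injective g₀).comp φ.hom_injective
  rw [h, ← Set.image_univ, Set.ncard_image_of_injective _ hinj, Set.ncard_univ]

/-! ### Compact sets in charts -/

/-- Finitely many compact pieces of the chart project onto a cover of `C`. As fibres are orbits, the
preimage lies in the finite union `Z` of their translates, in which it is closed. -/
lemma isCompact_chart_preimage [T2Space X] (O : OrbifoldCharts X m) (i : O.ι) {C : Set X}
    (hC : IsCompact C) (hCU : C ⊆ O.π i '' O.V i) : IsCompact (O.V i ∩ O.π i ⁻¹' C) := by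
  have hloc : ∀ p ∈ C, ∃ B : Set (RV m), IsCompact B ∧ B ⊆ O.V i ∧
      O.π i '' B ∈ nhds p := by
    intro p hp
    obtain ⟨x, hx, rfl⟩ := hCU hp
    obtain ⟨B, hB, hxB, hBV⟩ := exists_compact_subset (O.isOpen_V i) hx
    refine ⟨B, hB, hBV, Filter.mem_of_superset ((O.π_open i _ (interior_subset.trans hBV)
      isOpen_interior).mem_nhds ⟨x, hxB, rfl⟩) (Set.image_mono interior_subset)⟩
  choose! B hB hBV hBn using hloc
  obtain ⟨t, htC, ht⟩ := hC.elim_nhds_subcover (fun p => O.π i '' B p) hBn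
  set Z : Set (RV m) := ⋃ p ∈ t, ⋃ g : O.G i, O.act i g '' B p with hZ
  have hZc : IsCompact Z := t.finite_toSet.isCompact_biUnion fun p hp =>
    isCompact_iUnion fun g => (hB p (htC p hp)).image_of_continuousOn
      ((O.act_smooth i g).continuousOn.mono (hBV p (htC p hp)))
  have hZV : Z ⊆ O.V i := by
    refine Set.iUnion₂_subset fun p hp => Set.iUnion_subset fun g => ?_
    rintro _ ⟨y, hy, rfl⟩
    exact O.act_mapsTo i g (hBV p (htC p hp) hy)
  have hEq : O.V i ∩ O.π i ⁻¹' C = Z ∩ O.π i ⁻¹' C := by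
    refine Set.Subset.antisymm (fun x hx => ⟨?_, hx.2⟩) (Set.inter_subset_inter_left _ hZV)
    obtain ⟨p, hp, y, hy, hyx⟩ := Set.mem_iUnion₂.1 (ht hx.2)
    obtain ⟨g, hg⟩ := (O.π_fiber i y (hBV p (htC p hp) hy) x hx.1).1 hyx
    exact Set.mem_iUnion₂.2 ⟨p, hp, Set.mem_iUnion.2 ⟨g, y, hy, hg⟩⟩
  rw [hEq]
  exact hZc.of_isClosed_subset (((O.π_continuous i).mono hZV).preimage_isClosed_of_isClosed
    hZc.isClosed hC.isClosed) Set.inter_subset_left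

end OrbifoldGeometry

end GeomQuant

namespace GeomQuant

/-! ## Integration over orbifolds -/

section OrbifoldIntegration

open MeasureTheory

variable {X : Type*} [TopologicalSpace X] {m : ℕ} {O : Orbifold X m}

/-- A smooth density on an orbifold together with a smooth vector field that preserves it. -/
structure IsPreservedDensity (O : Orbifold X m) (lam : O.ι → RV m → ℝ)
    (Y : O.ι → RV m → RV m) : Prop where
  smooth : ∀ i, ContDiffOn ℝ ∞ (lam i) (O.V i)
  naturality : ∀ {i j} (φ : ChartEmb O.toOrbifoldCharts i j), ∀ x ∈ O.V i,
    lam i x = |(fderiv ℝ φ x).det| * lam j (φ x)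
  field_smooth : ∀ i, ContDiffOn ℝ ∞ (Y i) (O.V i)
  field_naturality : ∀ {i j} (φ : ChartEmb O.toOrbifoldCharts i j), ∀ x ∈ O.V i,
    fderiv ℝ φ x (Y i x) = Y j (φ x)
  preserved : ∀ i, ∀ x ∈ O.V i,
    fderiv ℝ (lam i) x (Y i x) + (endMatrix (fderiv ℝ (Y i) x)).trace * lam i x = 0

variable {lam : O.ι → RV m → ℝ} {Y : O.ι → RV m → RV m}

lemma integral_chartEmb (h : IsPreservedDensity O lam Y) {k i : O.ι}
    (φ : ChartEmb O.toOrbifoldCharts k i) (w : RV m → ℂ) :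
    ∫ z in φ '' O.V k, w z * (lam i z : ℂ) = ∫ x in O.V k, w (φ x) * (lam k x : ℂ) := by
  rw [integral_image_eq_integral_abs_det_fderiv_smul volume (O.isOpen_V k).measurableSet
    (fun x hx => (φ.differentiableAt hx).hasFDerivAt.hasFDerivWithinAt) φ.injOn]
  refine setIntegral_congr_fun (O.isOpen_V k).measurableSet fun x hx => ?_
  simp only [h.naturality φ x hx, Complex.real_smul]
  push_cast
  ring

/-- All `|G i|` translates of the small chart carry the same integral, and each point over the small
chart lies in exactly `|G k|` of them. Adding up the integrals over the translates gives `|G i| ∫_{V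
k} = |G k| ∫_{V i}`, which explains the weights. -/
lemma integral_embedded_chart (h : IsPreservedDensity O lam Y) {k i : O.ι}
    (φ : ChartEmb O.toOrbifoldCharts k i) {w : X → ℂ}
    (hint : IntegrableOn (fun z => w (O.π i z) * (lam i z : ℂ)) (O.V i))
    (hw : ∀ p, p ∉ O.π k '' O.V k → w p = 0) :
    ((Nat.card (O.G i) : ℂ))⁻¹ * ∫ z in O.V i, w (O.π i z) * (lam i z : ℂ) =
      ((Nat.card (O.G k) : ℂ))⁻¹ * ∫ x in O.V k, w (O.π k x) * (lam k x : ℂ) := by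
  classical
  have := Fintype.ofFinite (O.G i)
  set ψ := fun g : O.G i => (ChartEmb.ofGroup O.toOrbifoldCharts i g).comp φ with hψ
  set S := fun g : O.G i => ψ g '' O.V k with hS
  have hSo : ∀ g, IsOpen (S g) := fun g => (ψ g).isOpen_image subset_rfl (O.isOpen_V k)
  have hSV : ∀ g, S g ⊆ O.V i := by
    rintro g _ ⟨x, hx, rfl⟩
    exact (ψ g).mapsTo hx
  set F : RV m → ℂ := fun z => w (O.π i z) * (lam i z : ℂ) with hF
  have h1 : ∀ g, ∫ z in O.V i, (S g).indicator F z =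
      ∫ x in O.V k, w (O.π k x) * (lam k x : ℂ) := by
    intro g
    rw [setIntegral_indicator (hSo g).measurableSet, Set.inter_eq_right.2 (hSV g)]
    rw [integral_chartEmb h (ψ g) fun z => w (O.π i z)]
    refine setIntegral_congr_fun (O.isOpen_V k).measurableSet fun x hx => ?_
    simp only [(ψ g).π_comp x hx]
  have h2 : ∫ z in O.V i, ∑ g, (S g).indicator F z =
      ∫ z in O.V i, (Nat.card (O.G k) : ℂ) * F z := by
    refine setIntegral_congr_fun (O.isOpen_V i).measurableSet fun z hz => ?_
    by_cases hp : O.π i z ∈ O.π k '' O.V k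
    · have h3 := φ.ncard_translates hz hp
      simp only [Set.indicator_apply]
      rw [← Finset.sum_filter, Finset.sum_const, nsmul_eq_mul, ← h3, Set.ncard_eq_toFinset_card']
      congr 3
      ext g
      simp [hS, hψ]
    · have h3 : F z = 0 := by simp [hF, hw _ hp]
      simp [Set.indicator_apply, h3]
  rw [integral_finsetSum _ fun g _ => hint.indicator (hSo g).measurableSet] at h2
  simp only [h1, Finset.sum_const, Finset.card_univ, nsmul_eq_mul, integral_const_mul] at h2
  rw [← Nat.card_eq_fintype_card] at h2
  have hi : (Nat.card (O.G i) : ℂ) ≠ 0 := Nat.cast_ne_zero.2 Nat.card_pos.ne'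
  have hk : (Nat.card (O.G k) : ℂ) ≠ 0 := Nat.cast_ne_zero.2 Nat.card_pos.ne'
  field_simp
  rw [mul_comm, ← h2, mul_comm]

lemma integrableOn_chart [T2Space X] (i : O.ι) {F : RV m → ℂ} (hF : ContinuousOn F (O.V i))
    {C : Set X} (hC : IsCompact C) (hCU : C ⊆ O.π i '' O.V i)
    (h0 : ∀ x ∈ O.V i, O.π i x ∉ C → F x = 0) : IntegrableOn F (O.V i) :=
  ((hF.mono Set.inter_subset_left).integrableOn_compact
    (isCompact_chart_preimage O.toOrbifoldCharts i hC hCU)).of_forall_sdiff_eq_zero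
    (O.isOpen_V i).measurableSet fun x hx => h0 x hx.1 fun h => hx.2 ⟨hx.1, h⟩

/-- The open sets `V` and `Zᶜ` cover the space, and the extension by zero vanishes on the second. -/
lemma contDiff_indicator {F : Type*} [NormedAddCommGroup F] [NormedSpace ℝ F] {V Z : Set (RV m)}
    (hV : IsOpen V) (hZ : IsClosed Z) (hZV : Z ⊆ V) {g : RV m → F} (hg : ContDiffOn ℝ ∞ g V)
    (h0 : ∀ x ∈ V, x ∉ Z → g x = 0) : ContDiff ℝ ∞ (V.indicator g) := by
  rw [contDiff_iff_contDiffAt]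
  intro x
  by_cases hx : x ∈ V
  · refine (hg.contDiffAt (hV.mem_nhds hx)).congr_of_eventuallyEq ?_
    filter_upwards [hV.mem_nhds hx] with y hy using Set.indicator_of_mem hy g
  · refine (contDiffAt_const (c := (0 : F))).congr_of_eventuallyEq ?_
    filter_upwards [hZ.isOpen_compl.mem_nhds fun h => hx (hZV h)] with y hy
    by_cases hyV : y ∈ V
    · rw [Set.indicator_of_mem hyV, h0 y hyV hy]
    · exact Set.indicator_of_notMem hyV g

lemma integral_fderiv_eq_zero {g : RV m → ℂ} (hg : ContDiff ℝ ∞ g) (hc : HasCompactSupport g)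
    (v : RV m) : ∫ x, fderiv ℝ g x v = 0 := by
  have h1 : Continuous fun x => fderiv ℝ g x v :=
    (hg.continuous_fderiv (by simp)).clm_apply continuous_const
  have h2 : HasCompactSupport fun x => fderiv ℝ g x v := hc.fderiv_apply ℝ v
  have h := integral_smul_fderiv_eq_neg_fderiv_smul_of_integrable (𝕜 := ℝ) (μ := volume)
    (f := fun _ : RV m => (1 : ℝ)) (g := g) (v := v) (by simp)
    (by simpa using h1.integrable_of_hasCompactSupport h2)
    (by simpa using hg.continuous.integrable_of_hasCompactSupport hc)
    (fun _ _ => differentiableAt_const _) (fun x _ => hg.differentiable (by simp) x)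
  simpa using h

/-- The divergence theorem in a chart for a density-preserving vector field. -/
lemma integral_chart_lieDerivative (h : IsPreservedDensity O lam Y) (i : O.ι) {u : RV m → ℂ}
    (hu : ContDiffOn ℝ ∞ u (O.V i)) {Z : Set (RV m)} (hZ : IsCompact Z) (hZV : Z ⊆ O.V i)
    (h0 : ∀ x ∈ O.V i, x ∉ Z → u x = 0) :
    ∫ x in O.V i, fderiv ℝ u x (Y i x) * (lam i x : ℂ) = 0 := by
  have hV := O.isOpen_V i
  have hYa : ∀ a, ContDiffOn ℝ ∞ (fun x => Y i x a) (O.V i) := fun a =>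
    contDiffOn_pi.1 (h.field_smooth i) a
  -- The components of the field `u λ Y`, with `λ` the density. Since `div(λ Y) = 0`, its divergence
  -- is `λ Y(u)`, the integrand.
  set G : Fin m → RV m → ℂ := fun a x => u x * ((lam i x * Y i x a : ℝ) : ℂ) with hG
  have hGs : ∀ a, ContDiffOn ℝ ∞ (G a) (O.V i) := fun a =>
    hu.mul (contDiffOn_ofReal ((h.smooth i).mul (hYa a)))
  have hG0 : ∀ a, ∀ x ∈ O.V i, x ∉ Z → G a x = 0 := fun a x hx hxZ => by
    simp [hG, h0 x hx hxZ]
  have hI : ∀ a, ContDiff ℝ ∞ ((O.V i).indicator (G a)) := fun a =>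
    contDiff_indicator hV hZ.isClosed hZV (hGs a) (hG0 a)
  have hIc : ∀ a, HasCompactSupport ((O.V i).indicator (G a)) := fun a =>
    HasCompactSupport.intro hZ fun x hx => by
      by_cases hxV : x ∈ O.V i
      · rw [Set.indicator_of_mem hxV, hG0 a x hxV hx]
      · exact Set.indicator_of_notMem hxV _
  have key : ∀ x ∈ O.V i, fderiv ℝ u x (Y i x) * (lam i x : ℂ) =
      ∑ a, fderiv ℝ ((O.V i).indicator (G a)) x (Pi.single a 1) := by
    intro x hx
    have hud := ContDiffOn.differentiableAt' hV hu hx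
    have hld := ContDiffOn.differentiableAt' hV (h.smooth i) hx
    have hYd := ContDiffOn.differentiableAt' hV (h.field_smooth i) hx
    have e1 : ∀ a, fderiv ℝ ((O.V i).indicator (G a)) x = fderiv ℝ (G a) x := fun a => by
      apply Filter.EventuallyEq.fderiv_eq
      filter_upwards [hV.mem_nhds hx] with y hy using Set.indicator_of_mem hy _
    have e2 : ∀ a, fderiv ℝ (G a) x (Pi.single a 1) =
        fderiv ℝ u x (Pi.single a 1) * ((lam i x * Y i x a : ℝ) : ℂ) +
        u x * ((fderiv ℝ (lam i) x (Pi.single a 1) * Y i x a +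
          lam i x * fderiv ℝ (Y i) x (Pi.single a 1) a : ℝ) : ℂ) := by
      intro a
      have hYad : HasFDerivAt (fun y => Y i y a)
          ((ContinuousLinearMap.proj a).comp (fderiv ℝ (Y i) x)) x :=
        (hasFDerivAt_pi'.1 hYd.hasFDerivAt) a
      have h3 : HasFDerivAt (fun y => ((lam i y * Y i y a : ℝ) : ℂ)) _ x :=
        Complex.ofRealCLM.hasFDerivAt.comp x (hld.hasFDerivAt.fun_mul hYad)
      rw [(hud.hasFDerivAt.fun_mul h3).fderiv]
      simp only [_root_.add_apply, _root_.smul_apply, ContinuousLinearMap.comp_apply,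
        Complex.ofRealCLM_apply, smul_eq_mul, ContinuousLinearMap.proj_apply]
      push_cast
      ring
    have hlin : ∀ (F : Type) [NormedAddCommGroup F] [NormedSpace ℝ F] (T : RV m →L[ℝ] F),
        T (Y i x) = ∑ a, Y i x a • T (Pi.single a 1) := by
      intro F _ _ T
      conv_lhs => rw [sum_smul_single_real (Y i x)]
      simp only [map_sum, map_smul]
    have h4 := h.preserved i x hx
    rw [hlin ℝ (fderiv ℝ (lam i) x)] at h4
    simp only [e1, e2, Finset.sum_add_distrib, ← Finset.mul_sum]
    rw [← Complex.ofReal_sum, hlin ℂ (fderiv ℝ u x), Finset.sum_mul]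
    have h5 : ∑ a, (fderiv ℝ (lam i) x (Pi.single a 1) * Y i x a +
          lam i x * fderiv ℝ (Y i) x (Pi.single a 1) a) = 0 := by
      rw [← h4, Finset.sum_add_distrib, Matrix.trace, Finset.sum_mul]
      congr 1
      · exact Finset.sum_congr rfl fun a _ => mul_comm _ _
      · exact Finset.sum_congr rfl fun a _ => mul_comm _ _
    rw [h5]
    simp only [Complex.ofReal_zero, mul_zero, add_zero, Complex.real_smul]
    refine Finset.sum_congr rfl fun a _ => ?_
    push_cast
    ring
  rw [setIntegral_congr_fun hV.measurableSet key]
  have hsupp : ∀ x, x ∉ O.V i →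
      ∑ a, fderiv ℝ ((O.V i).indicator (G a)) x (Pi.single a 1) = 0 := by
    intro x hx
    refine Finset.sum_eq_zero fun a _ => ?_
    have : fderiv ℝ ((O.V i).indicator (G a)) x = fderiv ℝ (fun _ => (0 : ℂ)) x := by
      apply Filter.EventuallyEq.fderiv_eq
      filter_upwards [hZ.isClosed.isOpen_compl.mem_nhds fun h => hx (hZV h)] with y hy
      by_cases hyV : y ∈ O.V i
      · rw [Set.indicator_of_mem hyV, hG0 a y hyV hy]
      · exact Set.indicator_of_notMem hyV _
    simp [this]
  rw [setIntegral_eq_integral_of_forall_compl_eq_zero hsupp, integral_finsetSum]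
  · exact Finset.sum_eq_zero fun a _ => integral_fderiv_eq_zero (hI a) (hIc a) _
  · intro a _
    exact (((hI a).continuous_fderiv (by simp)).clm_apply
      continuous_const).integrable_of_hasCompactSupport ((hIc a).fderiv_apply ℝ _)

end OrbifoldIntegration

end GeomQuant

namespace GeomQuant

/-! ### Global integration and Stokes' theorem on an orbifold. -/

section OrbifoldIntegral

open MeasureTheory

variable {X : Type*} [TopologicalSpace X] {m : ℕ} {O : Orbifold X m}
  {lam : O.ι → RV m → ℝ} {Y : O.ι → RV m → RV m}

/-! ### Functions on an orbifold -/

/-- The function on `X` given by an invariant family of functions on the charts. -/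
noncomputable def descend {Z : Type*} (O : Orbifold X m) (u : O.ι → RV m → Z) (p : X) : Z :=
  u (O.covers p).choose (O.covers p).choose_spec.choose

lemma descend_π {Z : Type*} {u : O.ι → RV m → Z}
    (hu : ∀ i j (φ : ChartEmb O.toOrbifoldCharts i j), ∀ x ∈ O.V i, u j (φ x) = u i x)
    {i : O.ι} {x : RV m} (hx : x ∈ O.V i) : descend O u (O.π i x) = u i x := by
  have h := (O.covers (O.π i x)).choose_spec.choose_spec
  exact eq_of_π_eq O hu h.1 hx h.2

lemma continuous_of_charts {Z : Type*} [TopologicalSpace Z] {F : X → Z}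
    (h : ∀ i, ContinuousOn (fun x => F (O.π i x)) (O.V i)) : Continuous F := by
  rw [continuous_iff_continuousAt]
  intro p
  obtain ⟨i, x, hx, rfl⟩ := O.covers p
  exact continuousAt_of_chart O hx ((h i).continuousAt ((O.isOpen_V i).mem_nhds hx))

/-- A function on `X` with smooth lifts to all charts. -/
def SmoothOn (O : Orbifold X m) {F : Type*} [NormedAddCommGroup F] [NormedSpace ℝ F]
    (u : X → F) : Prop :=
  ∀ i, ContDiffOn ℝ ∞ (fun x => u (O.π i x)) (O.V i)

lemma SmoothOn.continuous {F : Type*} [NormedAddCommGroup F] [NormedSpace ℝ F] {u : X → F}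
    (h : SmoothOn O u) : Continuous u := continuous_of_charts fun i => (h i).continuousOn

/-- The derivative of a function on `X` along a vector field. -/
noncomputable def fieldDeriv (O : Orbifold X m) (Y : O.ι → RV m → RV m) (u : X → ℂ) : X → ℂ :=
  descend O fun i x => fderiv ℝ (fun y => u (O.π i y)) x (Y i x)

lemma fieldDeriv_π (h : IsPreservedDensity O lam Y) {u : X → ℂ} (hu : SmoothOn O u) {i : O.ι}
    {x : RV m} (hx : x ∈ O.V i) :
    fieldDeriv O Y u (O.π i x) = fderiv ℝ (fun y => u (O.π i y)) x (Y i x) := by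
  refine descend_π (u := fun i x => fderiv ℝ (fun y => u (O.π i y)) x (Y i x))
    (fun i j φ x hx => ?_) hx
  rw [fderiv_comp_chartEmb φ (F := fun y => u (O.π j y)) (G := fun y => u (O.π i y))
    (fun y hy => by rw [φ.π_comp y hy]) hx
    (ContDiffOn.differentiableAt' (O.isOpen_V j) (hu j) (φ.mapsTo hx)), h.field_naturality φ x hx]

lemma continuous_fieldDeriv (h : IsPreservedDensity O lam Y) {u : X → ℂ} (hu : SmoothOn O u) :
    Continuous (fieldDeriv O Y u) :=
  continuous_of_charts fun i => ((contDiffOn_fderiv_apply (O.isOpen_V i) (hu i)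
    (h.field_smooth i)).continuousOn).congr fun _ hx => fieldDeriv_π h hu hx

lemma fieldDeriv_eq_zero (h : IsPreservedDensity O lam Y) {u : X → ℂ} (hu : SmoothOn O u)
    {K : Set X} (hK : IsClosed K) (h0 : ∀ p, p ∉ K → u p = 0) {p : X} (hp : p ∉ K) :
    fieldDeriv O Y u p = 0 := by
  obtain ⟨i, x, hx, rfl⟩ := O.covers p
  rw [fieldDeriv_π h hu hx]
  have h1 : (fun y => u (O.π i y)) =ᶠ[nhds x] fun _ => 0 := by
    have h2 := ((O.π_continuous i).continuousAt ((O.isOpen_V i).mem_nhds hx)).eventually_mem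
      (hK.isOpen_compl.mem_nhds hp)
    filter_upwards [h2] with y hy using h0 _ hy
  rw [h1.fderiv_eq]
  simp

lemma fieldDeriv_add (h : IsPreservedDensity O lam Y) {u v : X → ℂ} (hu : SmoothOn O u)
    (hv : SmoothOn O v) (p : X) :
    fieldDeriv O Y (fun q => u q + v q) p = fieldDeriv O Y u p + fieldDeriv O Y v p := by
  obtain ⟨i, x, hx, rfl⟩ := O.covers p
  rw [fieldDeriv_π h hu hx, fieldDeriv_π h hv hx,
    fieldDeriv_π h (u := fun q => u q + v q) (fun i => (hu i).add (hv i)) hx,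
    fderiv_fun_add (ContDiffOn.differentiableAt' (O.isOpen_V i) (hu i) hx)
      (ContDiffOn.differentiableAt' (O.isOpen_V i) (hv i) hx)]
  rfl

/-- Smooth functions supported near a point. -/
lemma exists_orbifold_bump [T2Space X] (O : Orbifold X m) {k : O.ι} {x₀ : RV m}
    (hx₀ : x₀ ∈ O.V k) {N : Set X} (hN : IsOpen N) (hx₀N : O.π k x₀ ∈ N) :
    ∃ (η : X → ℝ) (C : Set X), SmoothOn O η ∧ (∀ p, 0 ≤ η p) ∧ 0 < η (O.π k x₀) ∧
      IsCompact C ∧ C ⊆ N ∧ C ⊆ O.π k '' O.V k ∧ ∀ p, p ∉ C → η p = 0 := by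
  classical
  have := Fintype.ofFinite (O.G k)
  have hWo : IsOpen (O.V k ∩ O.π k ⁻¹' N) := (O.π_continuous k).isOpen_inter_preimage
    (O.isOpen_V k) hN
  obtain ⟨b, hbW, hbc, hbs, hb01, hb1⟩ := exists_contDiff_tsupport_subset (n := ⊤)
    (hWo.mem_nhds ⟨hx₀, hx₀N⟩)
  have hb0 : ∀ x, 0 ≤ b x := fun x => (hb01 ⟨x, rfl⟩).1
  -- Summation over the local group makes the bump invariant, so that it descends to `X`.
  set u : RV m → ℝ := fun x => ∑ g : O.G k, b (O.act k g x) with hu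
  have hinv : ∀ x ∈ O.V k, ∀ y ∈ O.V k, O.π k x = O.π k y → u x = u y := by
    intro x hx y hy hxy
    obtain ⟨g, rfl⟩ := (O.π_fiber k x hx y hy).1 hxy
    simp only [hu, ← O.act_mul k _ _ x hx]
    exact (Equiv.sum_comp (Equiv.mulRight g) fun g' => b (O.act k g' x)).symm
  set η : X → ℝ := fun p => if h : p ∈ O.π k '' O.V k then u h.choose else 0 with hη
  set C : Set X := O.π k '' tsupport b with hC
  have hbV : tsupport b ⊆ O.V k := hbW.trans Set.inter_subset_left
  have hCc : IsCompact C := hbc.isCompact.image_of_continuousOn ((O.π_continuous k).mono hbV)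
  have hηk : ∀ x ∈ O.V k, η (O.π k x) = u x := by
    intro x hx
    have h : O.π k x ∈ O.π k '' O.V k := ⟨x, hx, rfl⟩
    simp only [hη, dif_pos h]
    exact hinv _ h.choose_spec.1 x hx h.choose_spec.2
  have hη0 : ∀ p, p ∉ C → η p = 0 := by
    intro p hp
    by_cases h : p ∈ O.π k '' O.V k
    · obtain ⟨x, hx, rfl⟩ := h
      rw [hηk x hx]
      refine Finset.sum_eq_zero fun g _ => ?_
      refine image_eq_zero_of_notMem_tsupport fun hg => hp ⟨_, hg, ?_⟩
      exact π_act O.toOrbifoldCharts k g hx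
    · simp only [hη, dif_neg h]
  have hus : ContDiffOn ℝ ∞ u (O.V k) := ContDiffOn.sum fun g _ =>
    hbs.comp_contDiffOn (O.act_smooth k g)
  refine ⟨η, C, fun j y hy => ?_, fun p => ?_, ?_, hCc, ?_, Set.image_mono hbV, hη0⟩
  · refine ContDiffAt.contDiffWithinAt ?_
    by_cases h : O.π j y ∈ O.π k '' O.V k
    · obtain ⟨x, hx, hxy⟩ := h
      refine contDiffAt_of_chart O hx hy hxy ?_
      refine (hus.contDiffAt ((O.isOpen_V k).mem_nhds hx)).congr_of_eventuallyEq ?_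
      filter_upwards [(O.isOpen_V k).mem_nhds hx] with z hz using hηk z hz
    · have h1 : O.π j y ∈ Cᶜ := fun h' => h (Set.image_mono hbV h')
      refine (contDiffAt_const (c := (0 : ℝ))).congr_of_eventuallyEq ?_
      filter_upwards [((O.π_continuous j).continuousAt ((O.isOpen_V j).mem_nhds hy)).eventually_mem
        (hCc.isClosed.isOpen_compl.mem_nhds h1)] with z hz using hη0 _ hz
  · by_cases h : p ∈ O.π k '' O.V k
    · obtain ⟨x, hx, rfl⟩ := h
      rw [hηk x hx]
      exact Finset.sum_nonneg fun g _ => hb0 _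
    · simp only [hη, dif_neg h, le_refl]
  · rw [hηk x₀ hx₀]
    refine Finset.sum_pos' (fun g _ => hb0 _) ⟨1, Finset.mem_univ _, ?_⟩
    rw [O.act_one k x₀ hx₀, hb1]
    exact one_pos
  · rintro _ ⟨x, hx, rfl⟩
    exact (hbW hx).2

/-- A chart around a point that embeds into finitely many given charts around that point. -/
lemma exists_chart_embedded (O : Orbifold X m) (p : X) (I : Set O.ι) (hI : I.Finite)
    (hp : ∀ i ∈ I, p ∈ O.π i '' O.V i) : ∃ k, p ∈ O.π k '' O.V k ∧
      ∀ i ∈ I, Nonempty (ChartEmb O.toOrbifoldCharts k i) := by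
  induction I, hI using Set.Finite.induction_on with
  | empty =>
    obtain ⟨k, hk⟩ := O.covers p
    exact ⟨k, hk, by simp⟩
  | insert _ _ ih =>
    obtain ⟨k, hk, hkI⟩ := ih fun i hi => hp i (Set.mem_insert_of_mem _ hi)
    obtain ⟨l, hl, ⟨φ⟩, ⟨ψ⟩⟩ := O.compatible k _ p ⟨hk, hp _ (Set.mem_insert _ _)⟩
    refine ⟨l, hl, fun i hi => ?_⟩
    rcases Set.mem_insert_iff.1 hi with rfl | hi
    · exact ⟨ψ⟩
    · obtain ⟨χ⟩ := hkI i hi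
      exact ⟨χ.comp φ⟩

/-! ### The integral -/

/-- The integral of a function over an orbifold with respect to a density, defined by a partition of
unity. -/
noncomputable def orbInt (O : Orbifold X m) (ρ : PartitionOfUnity O.ι X Set.univ)
    (lam : O.ι → RV m → ℝ) (F : X → ℂ) : ℂ :=
  ∑ᶠ i, ((Nat.card (O.G i) : ℂ))⁻¹ * ∫ x in O.V i,
    (ρ i (O.π i x) : ℂ) * F (O.π i x) * (lam i x : ℂ)

variable {ρ : PartitionOfUnity O.ι X Set.univ}

lemma finite_tsupport_inter {K : Set X} (hK : IsCompact K) :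
    {i | (tsupport (ρ i) ∩ K).Nonempty}.Finite :=
  ρ.locallyFinite.closure.finite_nonempty_inter_compact hK

lemma mul_eq_zero_of_notMem {K : Set X} {F : X → ℂ} (h0 : ∀ p, p ∉ K → F p = 0) {i : O.ι} {p : X}
    (hp : p ∉ tsupport (ρ i) ∩ K) : (ρ i p : ℂ) * F p = 0 := by
  by_cases h : p ∈ K
  · have : ρ i p = 0 := image_eq_zero_of_notMem_tsupport fun h' => hp ⟨h', h⟩
    simp [this]
  · simp [h0 p h]

lemma support_orbInt_subset {K : Set X} {F : X → ℂ} (h0 : ∀ p, p ∉ K → F p = 0) :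
    (Function.support fun i => ((Nat.card (O.G i) : ℂ))⁻¹ * ∫ x in O.V i,
      (ρ i (O.π i x) : ℂ) * F (O.π i x) * (lam i x : ℂ)) ⊆
        {i | (tsupport (ρ i) ∩ K).Nonempty} := by
  intro i hi
  by_contra hcon
  apply hi
  have h1 : ∀ x, (ρ i (O.π i x) : ℂ) * F (O.π i x) * (lam i x : ℂ) = 0 := fun x => by
    rw [mul_eq_zero_of_notMem h0 fun h => hcon ⟨_, h⟩, zero_mul]
  simp only [h1, integral_zero, mul_zero]

lemma integrableOn_orbInt [T2Space X] (hlam : ∀ i, ContinuousOn (lam i) (O.V i))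
    (hρ : ρ.IsSubordinate fun i => O.π i '' O.V i) {K : Set X} (hK : IsCompact K) {F : X → ℂ}
    (hF : Continuous F) (h0 : ∀ p, p ∉ K → F p = 0) (i : O.ι) :
    IntegrableOn (fun x => (ρ i (O.π i x) : ℂ) * F (O.π i x) * (lam i x : ℂ)) (O.V i) := by
  refine integrableOn_chart i ?_ (hK.inter_left (isClosed_tsupport (ρ i)))
    (Set.inter_subset_left.trans (hρ i)) fun x _ hx => by
      rw [mul_eq_zero_of_notMem h0 hx, zero_mul]
  exact ((Complex.continuous_ofReal.comp_continuousOn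
    ((ρ i).continuous.comp_continuousOn (O.π_continuous i))).mul
    (hF.comp_continuousOn (O.π_continuous i))).mul
    (Complex.continuous_ofReal.comp_continuousOn (hlam i))

lemma orbInt_add [T2Space X] (hlam : ∀ i, ContinuousOn (lam i) (O.V i))
    (hρ : ρ.IsSubordinate fun i => O.π i '' O.V i) {K : Set X} (hK : IsCompact K) {F G : X → ℂ}
    (hF : Continuous F) (hF0 : ∀ p, p ∉ K → F p = 0) (hG : Continuous G)
    (hG0 : ∀ p, p ∉ K → G p = 0) :
    orbInt O ρ lam (fun p => F p + G p) = orbInt O ρ lam F + orbInt O ρ lam G := by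
  rw [orbInt, orbInt, orbInt, ← finsum_add_distrib
    ((finite_tsupport_inter hK).subset (support_orbInt_subset hF0))
    ((finite_tsupport_inter hK).subset (support_orbInt_subset hG0))]
  refine finsum_congr fun i => ?_
  rw [← mul_add, ← integral_add (integrableOn_orbInt hlam hρ hK hF hF0 i)
    (integrableOn_orbInt hlam hρ hK hG hG0 i)]
  simp only [mul_add, add_mul]

/-- The integral of a function supported in a small chart. -/
lemma orbInt_eq_chart [T2Space X] (h : IsPreservedDensity O lam Y)
    (hρ : ρ.IsSubordinate fun i => O.π i '' O.V i) {C : Set X} (hC : IsCompact C) {k : O.ι}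
    (hCk : C ⊆ O.π k '' O.V k)
    (hk : ∀ i, (tsupport (ρ i) ∩ C).Nonempty → Nonempty (ChartEmb O.toOrbifoldCharts k i))
    {F : X → ℂ} (hF : Continuous F) (h0 : ∀ p, p ∉ C → F p = 0) :
    orbInt O ρ lam F =
      ((Nat.card (O.G k) : ℂ))⁻¹ * ∫ x in O.V k, F (O.π k x) * (lam k x : ℂ) := by
  have hlam : ∀ i, ContinuousOn (lam i) (O.V i) := fun i => (h.smooth i).continuousOn
  set s := (finite_tsupport_inter (ρ := ρ) hC).toFinset with hs
  rw [orbInt, finsum_eq_sum_of_support_subset (s := s) _ (by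
    rw [hs, Set.Finite.coe_toFinset]; exact support_orbInt_subset h0)]
  -- Each piece `ρ_i F` is moved from its own chart to the chart `k`; there the pieces recombine,
  -- because the `ρ_i` sum to one on `C`.
  have h1 : ∀ i ∈ s, ((Nat.card (O.G i) : ℂ))⁻¹ * ∫ x in O.V i,
      (ρ i (O.π i x) : ℂ) * F (O.π i x) * (lam i x : ℂ) = ((Nat.card (O.G k) : ℂ))⁻¹ *
        ∫ x in O.V k, (ρ i (O.π k x) : ℂ) * F (O.π k x) * (lam k x : ℂ) := by
    intro i hi
    rw [hs, Set.Finite.mem_toFinset] at hi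
    obtain ⟨φ⟩ := hk i hi
    exact integral_embedded_chart h φ (w := fun p => (ρ i p : ℂ) * F p)
      (integrableOn_orbInt hlam hρ hC hF h0 i) fun p hp => by
        rw [h0 p fun hpC => hp (hCk hpC), mul_zero]
  rw [Finset.sum_congr rfl h1, ← Finset.mul_sum, ← integral_finsetSum]
  · congr 1
    refine setIntegral_congr_fun (O.isOpen_V k).measurableSet fun x _ => ?_
    simp only [← Finset.sum_mul]
    by_cases hp : O.π k x ∈ C
    · have h2 : ∑ i ∈ s, ρ i (O.π k x) = 1 := by
        rw [← ρ.sum_eq_one (Set.mem_univ (O.π k x))]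
        symm
        refine finsum_eq_sum_of_support_subset _ fun i hi => ?_
        rw [hs, Set.Finite.coe_toFinset]
        exact ⟨_, subset_tsupport _ hi, hp⟩
      rw [← Complex.ofReal_sum, h2, Complex.ofReal_one, one_mul]
    · simp [h0 _ hp]
  · intro i _
    refine integrableOn_chart k ?_ hC hCk fun x _ hx => by rw [h0 _ hx, mul_zero, zero_mul]
    exact ((Complex.continuous_ofReal.comp_continuousOn
      ((ρ i).continuous.comp_continuousOn (O.π_continuous k))).mul
      (hF.comp_continuousOn (O.π_continuous k))).mul
      (Complex.continuous_ofReal.comp_continuousOn (hlam k))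

/-- The partition of unity is only continuous, so `ρ_i H` cannot be differentiated; a smooth bump
localizes instead. Only finitely many `ρ_i` are active near `p`, a single chart embeds into all of
their charts, and the integral becomes one over that chart, where the divergence theorem applies. -/
lemma exists_bump_orbInt_eq_zero [T2Space X] (h : IsPreservedDensity O lam Y)
    (hρ : ρ.IsSubordinate fun i => O.π i '' O.V i) (p : X) :
    ∃ η : X → ℝ, SmoothOn O η ∧ (∀ q, 0 ≤ η q) ∧ 0 < η p ∧ ∀ G : X → ℂ, SmoothOn O G →
      orbInt O ρ lam (fieldDeriv O Y fun q => (η q : ℂ) * G q) = 0 := by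
  set I : Set O.ι := {i | p ∈ tsupport (ρ i)} with hI
  have hIf : I.Finite := ρ.locallyFinite.closure.point_finite p
  obtain ⟨k, ⟨x₀, hx₀, hx₀p⟩, hk⟩ := exists_chart_embedded O p I hIf fun i hi => hρ i hi
  -- Off the closed supports of all the other `ρ_i`; the union of these is closed by local
  -- finiteness.
  set N : Set X := (⋃ i : {i // p ∉ tsupport (ρ i)}, tsupport (ρ i))ᶜ with hN
  have hNo : IsOpen N := ((ρ.locallyFinite.closure.comp_injective
    Subtype.val_injective).isClosed_iUnion fun i => isClosed_closure).isOpen_compl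
  have hpN : O.π k x₀ ∈ N := by
    rw [hx₀p, hN, Set.mem_compl_iff, Set.mem_iUnion]
    rintro ⟨i, hi⟩
    exact i.2 hi
  obtain ⟨η, C, hη, hη0, hηp, hC, hCN, hCk, hηC⟩ := exists_orbifold_bump O hx₀ hNo hpN
  refine ⟨η, hη, hη0, hx₀p ▸ hηp, fun G hG => ?_⟩
  have hS : SmoothOn O fun q => (η q : ℂ) * G q := fun i =>
    (contDiffOn_ofReal (hη i)).mul (hG i)
  have hS0 : ∀ q, q ∉ C → (η q : ℂ) * G q = 0 := fun q hq => by simp [hηC q hq]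
  rw [orbInt_eq_chart h hρ hC hCk (fun i ⟨q, hq, hqC⟩ => hk i (by
      by_contra hi
      exact hCN hqC (Set.mem_iUnion.2 ⟨⟨i, hi⟩, hq⟩))) (continuous_fieldDeriv h hS)
    fun q hq => fieldDeriv_eq_zero h hS hC.isClosed hS0 hq]
  have h1 := integral_chart_lieDerivative h k (hS k)
    (isCompact_chart_preimage O.toOrbifoldCharts k hC hCk) Set.inter_subset_left
    fun x hx hx' => hS0 _ fun hq => hx' ⟨hx, hq⟩
  have h2 : ∫ x in O.V k, fieldDeriv O Y (fun q => (η q : ℂ) * G q) (O.π k x) * (lam k x : ℂ) = 0 := by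
    rw [← h1]
    exact setIntegral_congr_fun (O.isOpen_V k).measurableSet fun x hx => by
      simp only [fieldDeriv_π h hS hx]
  rw [h2, mul_zero]

/-- The integral of the derivative of a compactly supported function along a density-preserving
vector field vanishes. -/
theorem orbInt_fieldDeriv [T2Space X] (h : IsPreservedDensity O lam Y)
    (hρ : ρ.IsSubordinate fun i => O.π i '' O.V i) {H : X → ℂ} (hH : SmoothOn O H) {K : Set X}
    (hK : IsCompact K) (h0 : ∀ p, p ∉ K → H p = 0) : orbInt O ρ lam (fieldDeriv O Y H) = 0 := by
  classical
  have hlam : ∀ i, ContinuousOn (lam i) (O.V i) := fun i => (h.smooth i).continuousOn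
  choose η hη hη0 hηp hint using exists_bump_orbInt_eq_zero h hρ
  obtain ⟨t, -, ht⟩ := hK.elim_nhds_subcover (fun p => {q | 0 < η p q}) fun p _ =>
    (isOpen_lt continuous_const (hη p).continuous).mem_nhds (hηp p)
  set E : X → ℝ := fun q => ∑ p ∈ t, η p q with hE
  have hEs : SmoothOn O E := fun i => ContDiffOn.sum fun p _ => hη p i
  have hEpos : ∀ q ∈ K, 0 < E q := by
    intro q hq
    obtain ⟨p, hp, hpq⟩ := Set.mem_iUnion₂.1 (ht hq)
    exact Finset.sum_pos' (fun p _ => hη0 p q) ⟨p, hp, hpq⟩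
  -- Division by the total bump makes `H` the sum of the `η_p G`. On `K` the divisor is positive;
  -- off `K` the factor `H` is zero, so a default inverse of zero does no harm.
  set G : X → ℂ := fun q => H q * (E q : ℂ)⁻¹ with hG
  have hG0 : ∀ q, q ∉ K → G q = 0 := fun q hq => by simp [hG, h0 q hq]
  have hGs : SmoothOn O G := by
    intro i x hx
    refine ContDiffAt.contDiffWithinAt ?_
    by_cases hq : O.π i x ∈ K
    · exact ((hH i).contDiffAt ((O.isOpen_V i).mem_nhds hx)).mul
        (((contDiffOn_ofReal (hEs i)).contDiffAt ((O.isOpen_V i).mem_nhds hx)).inv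
          (by exact_mod_cast (hEpos _ hq).ne'))
    · refine (contDiffAt_const (c := (0 : ℂ))).congr_of_eventuallyEq ?_
      filter_upwards [((O.π_continuous i).continuousAt ((O.isOpen_V i).mem_nhds hx)).eventually_mem
        (hK.isClosed.isOpen_compl.mem_nhds hq)] with z hz using hG0 _ hz
  have hterm : ∀ p, SmoothOn O fun q => (η p q : ℂ) * G q := fun p i =>
    (contDiffOn_ofReal (hη p i)).mul (hGs i)
  have key : ∀ s : Finset X, SmoothOn O (fun q => ∑ p ∈ s, (η p q : ℂ) * G q) ∧
      orbInt O ρ lam (fieldDeriv O Y fun q => ∑ p ∈ s, (η p q : ℂ) * G q) = 0 := by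
    intro s
    induction s using Finset.induction_on with
    | empty =>
      refine ⟨fun i => by simpa using contDiffOn_const, ?_⟩
      have h1 : SmoothOn O fun _ : X => (0 : ℂ) := fun i => contDiffOn_const
      have h2 : fieldDeriv O Y (fun _ => (0 : ℂ)) = fun _ => 0 := funext fun p =>
        fieldDeriv_eq_zero h h1 isClosed_empty (fun _ _ => rfl) (Set.notMem_empty p)
      simp only [Finset.sum_empty, h2, orbInt, mul_zero, zero_mul, integral_zero, finsum_zero]
    | insert p s hp ih =>
      simp only [Finset.sum_insert hp]
      refine ⟨fun i => (hterm p i).add (ih.1 i), ?_⟩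
      rw [funext fun q => fieldDeriv_add h (hterm p) ih.1 q,
        orbInt_add hlam hρ hK (continuous_fieldDeriv h (hterm p))
          (fun q hq => fieldDeriv_eq_zero h (hterm p) hK.isClosed
            (fun q hq => by rw [hG0 q hq, mul_zero]) hq) (continuous_fieldDeriv h ih.1)
          (fun q hq => fieldDeriv_eq_zero h ih.1 hK.isClosed
            (fun q hq => by simp [hG0 q hq]) hq), hint p G hGs, ih.2, add_zero]
  have hHe : H = fun q => ∑ p ∈ t, (η p q : ℂ) * G q := by
    ext q
    rw [← Finset.sum_mul, ← Complex.ofReal_sum]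
    by_cases hq : q ∈ K
    · have : (E q : ℂ) ≠ 0 := by exact_mod_cast (hEpos q hq).ne'
      change H q = (E q : ℂ) * (H q * (E q : ℂ)⁻¹)
      field_simp
    · rw [hG0 q hq, h0 q hq, mul_zero]
  rw [hHe]
  exact (key t).2

end OrbifoldIntegral

end GeomQuant

namespace GeomQuant

/-! ## The corrected pairing for a Kähler polarization -/

section KahlerPairing

variable {X : Type*} [TopologicalSpace X] {n : ℕ} {O : Orbifold X (2 * n)} {Ω : SymplecticForm O}
  {P : Polarization Ω} {hbar : ℝ} {f : X → ℝ}

lemma isPreservedDensity_liouville (Ω : SymplecticForm O) (hf : OrbSmooth O f) :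
    IsPreservedDensity O (liouvilleDensity Ω) (hamVF Ω f) where
  smooth := contDiffOn_liouvilleDensity Ω
  naturality φ _ hx := liouvilleDensity_naturality Ω φ hx
  field_smooth := contDiffOn_hamVF Ω hf
  field_naturality φ _ hx := hamVF_naturality Ω hf φ hx
  preserved i _ hx := fderiv_liouvilleDensity Ω hf i hx

variable {L : PrequantumBundle Ω hbar} {δ : HalfFormBundle P}

lemma smoothOn_descend_pair (K : KahlerStructure P) {s t : O.ι → RV (2 * n) → ℂ}
    (hs : IsSection L δ s) (ht : IsSection L δ t) : SmoothOn O (descend O (K.pair δ s t)) :=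
  fun i => (contDiffOn_pair K hs ht i).congr fun _ hx => descend_π (pair_naturality K hs ht) hx

lemma kahlerPairing_eq_orbInt (K : KahlerStructure P) {s t : O.ι → RV (2 * n) → ℂ}
    (hs : IsSection L δ s) (ht : IsSection L δ t) (ρ : PartitionOfUnity O.ι X Set.univ) :
    kahlerPairing δ K ρ s t =
      orbInt O ρ (liouvilleDensity Ω) (descend O (K.pair δ s t)) := by
  refine finsum_congr fun i => ?_
  congr 1
  refine MeasureTheory.setIntegral_congr_fun (O.isOpen_V i).measurableSet fun x hx => ?_
  simp only [descend_π (pair_naturality K hs ht) hx, KahlerStructure.pair]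
  push_cast
  ring

lemma descend_pair_eq_zero (K : KahlerStructure P) (s t : O.ι → RV (2 * n) → ℂ) {p : X}
    (hp : p ∉ nonzeroSet O s ∨ p ∉ nonzeroSet O t) : descend O (K.pair δ s t) p = 0 := by
  have h := (O.covers p).choose_spec.choose_spec
  set i := (O.covers p).choose
  set x := (O.covers p).choose_spec.choose
  change (starRingEnd ℂ) (s i x) * t i x * _ = 0
  rcases hp with hp | hp
  · have : s i x = 0 := by
      by_contra h0
      exact hp ⟨i, x, h.1, h.2, h0⟩
    simp [this]
  · have : t i x = 0 := by
      by_contra h0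
      exact hp ⟨i, x, h.1, h.2, h0⟩
    simp [this]

/-- The pointwise defect is the derivative along the Hamiltonian field of `iħ⟨s, t⟩`, which vanishes
off the compact closure of the nonzero set of `s`. The field preserves the Liouville density, so the
integral of that derivative is zero. -/
theorem kahlerPairing_Qmeta [T2Space X] (K : KahlerStructure P) (hb : hbar ≠ 0)
    (hf : OrbSmooth O f) (hq : Quantizable P f) {ρ : PartitionOfUnity O.ι X Set.univ}
    (hρ : ρ.IsSubordinate fun i => O.π i '' O.V i) {s t : O.ι → RV (2 * n) → ℂ}
    (hs : KahlerDomain L δ s) (ht : KahlerDomain L δ t) :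
    kahlerPairing δ K ρ (Qmeta L δ f s) t = kahlerPairing δ K ρ s (Qmeta L δ f t) := by
  have hsQ := (hs.Qmeta hb hf hq).1
  have htQ := (ht.Qmeta hb hf hq).1
  have hd := isPreservedDensity_liouville Ω hf
  rw [kahlerPairing_eq_orbInt K hsQ ht.1, kahlerPairing_eq_orbInt K hs.1 htQ]
  set H : X → ℂ := fun p => Complex.I * hbar * descend O (K.pair δ s t) p with hH
  have hHs : SmoothOn O H := fun i => contDiffOn_const.mul (smoothOn_descend_pair K hs.1 ht.1 i)
  set C := closure (nonzeroSet O s) with hC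
  have hH0 : ∀ p, p ∉ C → H p = 0 := fun p hp => by
    simp only [hH, descend_pair_eq_zero K s t (Or.inl fun h => hp (subset_closure h)), mul_zero]
  have hR0 : ∀ p, p ∉ C → descend O (K.pair δ s (Qmeta L δ f t)) p = 0 := fun p hp =>
    descend_pair_eq_zero K _ _ (Or.inl fun h => hp (subset_closure h))
  have hsum : descend O (K.pair δ (Qmeta L δ f s) t) = fun p =>
      descend O (K.pair δ s (Qmeta L δ f t)) p + fieldDeriv O (hamVF Ω f) H p := by
    ext p
    obtain ⟨i, x, hx, rfl⟩ := O.covers p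
    rw [descend_π (pair_naturality K hsQ ht.1) hx, descend_π (pair_naturality K hs.1 htQ) hx,
      fieldDeriv_π hd hHs hx, ← sub_eq_iff_eq_add', pair_Qmeta_sub K hf hq hs.1 ht.1 hx]
    have h1 : (fun y => H (O.π i y)) =ᶠ[nhds x] fun y => Complex.I * hbar * K.pair δ s t i y := by
      filter_upwards [(O.isOpen_V i).mem_nhds hx] with y hy
      simp only [hH, descend_π (pair_naturality K hs.1 ht.1) hy]
    rw [h1.fderiv_eq, fderiv_const_mul (ContDiffOn.differentiableAt' (O.isOpen_V i)
      (contDiffOn_pair K hs.1 ht.1 i) hx)]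
    rfl
  rw [hsum, orbInt_add (fun i => (hd.smooth i).continuousOn) hρ hs.2.2
    (smoothOn_descend_pair K hs.1 htQ).continuous hR0 (continuous_fieldDeriv hd hHs)
    (fun p hp => fieldDeriv_eq_zero hd hHs isClosed_closure hH0 hp),
    orbInt_fieldDeriv hd hρ hHs hs.2.2 hH0, add_zero]

end KahlerPairing

end GeomQuant

/-! ### Both cases combined. -/

theorem mainTheorem9 {X : Type*} [TopologicalSpace X] [T2Space X] [ParacompactSpace X] {n : ℕ}
    (O : GeomQuant.Orbifold X (2 * n)) (Ω : GeomQuant.SymplecticForm O)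
    (P : GeomQuant.Polarization Ω) {hbar : ℝ} (hbar_pos : 0 < hbar)
    (L : GeomQuant.PrequantumBundle Ω hbar) (δ : GeomQuant.HalfFormBundle P)
    (f : X → ℝ) (hf : GeomQuant.OrbSmooth O f) (hq : GeomQuant.Quantizable P f) :
    (∀ K : GeomQuant.KahlerStructure P,
      (∀ s, GeomQuant.KahlerDomain L δ s →
        GeomQuant.KahlerDomain L δ (GeomQuant.Qmeta L δ f s)) ∧
      ∀ ρ : PartitionOfUnity O.ι X Set.univ,
        ρ.IsSubordinate (fun i => O.π i '' O.V i) →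
        ∀ s t, GeomQuant.KahlerDomain L δ s → GeomQuant.KahlerDomain L δ t →
          GeomQuant.kahlerPairing δ K ρ (GeomQuant.Qmeta L δ f s) t =
            GeomQuant.kahlerPairing δ K ρ s (GeomQuant.Qmeta L δ f t)) ∧
    (P.IsReal →
      (∀ s, GeomQuant.RealDomain L δ s →
        GeomQuant.RealDomain L δ (GeomQuant.Qmeta L δ f s)) ∧
      ∀ M : GeomQuant.SmoothLeafMeasure P, M.IntegrationByParts f →
        ∀ s t, GeomQuant.RealDomain L δ s → GeomQuant.RealDomain L δ t →
          GeomQuant.realPairing δ M (GeomQuant.Qmeta L δ f s) t =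
            GeomQuant.realPairing δ M s (GeomQuant.Qmeta L δ f t)) := by
  have hb : hbar ≠ 0 := hbar_pos.ne'
  exact ⟨fun K => ⟨fun s hs => hs.Qmeta hb hf hq,
      fun ρ hρ s t hs ht => GeomQuant.kahlerPairing_Qmeta K hb hf hq hρ hs ht⟩,
    fun hR => ⟨fun s hs => hs.Qmeta hb hf hq,
      fun M hM s t hs ht => GeomQuant.realPairing_Qmeta hb hf hq hR M hM hs ht⟩⟩
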